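/- \textbf{Theorem.} Let $M$ be a compact smooth three-dimensional manifold (without boundary), let $\kappa\in\mathbb{R}$, and let $(g,\varphi)$ be a smooth Riemannian metric and a smooth function on $M$ that form a Heterotic soliton with vanishing torsion, i.e. $\mathcal{E}(g,\varphi)=0$, where $\mathcal{E}=(\mathcal{E}_{\mathrm E},\mathcal{E}_{\mathrm{YM}},\mathcal{E}_{\mathrm D})$ is given by $$\mathcal{E}_{\mathrm E}(g,\varphi)=\mathrm{Ric}^g+\nabla^g d\varphi-\tfrac12 e^{2\varphi}g+\kappa\,\mathcal{R}^g\circ_g\mathcal{R}^g,\qquad \mathcal{E}_{\mathrm{YM}}(g,\varphi)=d_{\nabla^g}^*\mathcal{R}^g+\mathcal{R}^g(d\varphi),$$ $$\mathcal{E}_{\mathrm D}(g,\varphi)=\delta^g d\varphi+|d\varphi|_g^2-e^{2\varphi}+\kappa|\mathcal{R}^g|_g^2 .$$ Here $\mathcal{R}^g$ is the Riemann tensor, viewed as a four-tensor $\mathcal{R}^g_{v_1,v_2}(v_3,v_4)=g(\mathcal{R}^g_{v_1,v_2}v_3,v_4)$, and in any local orthonormal frame $(e_i)$, $$(\mathcal{R}^g\circ_g\mathcal{R}^g)(v,w)=\tfrac12\sum_{i,j,k}\mathcal{R}^g_{v,e_i}(e_j,e_k)\mathcal{R}^g_{w,e_i}(e_j,e_k),\qquad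 |\mathcal{R}^g|_g^2=\tfrac14\sum_{i,j,k,l}\mathcal{R}^g_{e_i,e_j}(e_k,e_l)^2,$$ $$(d_{\nabla^g}^*\mathcal{R}^g)(v_1,v_2,v_3)=-\sum_j(\nabla^g_{e_j}\mathcal{R}^g)_{e_j,v_1}(v_2,v_3),\qquad \mathcal{R}^g(d\varphi)(v_1,v_2,v_3)=\mathcal{R}^g_{\mathrm{grad}\,\varphi,v_1}(v_2,v_3),$$ and $\delta^g$ is the formal adjoint of $d$. Suppose that $g$ is not flat and that $\varphi$ is constant. Then the vector space of essential deformations of $(g,\varphi)$, $$\mathbb{E}_{(g,\varphi)}=\ker\big(d_{(g,\varphi)}\mathcal{E}\big)\cap\ker\big((h,\xi)\mapsto 2\nabla^{g*}h+\xi\,d\varphi\big),$$ is zero. Here $(h,\xi)$ ranges over the pairs of a smooth symmetric two-tensor and a smooth function on $M$, $\nabla^{g*}h=-\sum_i(\nabla^g_{e_i}h)(e_i,\cdot)$, and $(h,\xi)\mapsto 2\nabla^{g*}h+\xi\,d\varphi$ is the formal $L^2$-adjoint of the infinitesimal action $v\mapsto(\mathcal{L}_vg,d\varphi(v))$ of the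 diffeomorphism group at $(g,\varphi)$. -/

import Mathlib

open scoped Manifold ContDiff

noncomputable section

namespace HeteroticSoliton

/-- The model space of three-dimensional manifolds. -/
abbrev E3 : Type := EuclideanSpace ℝ (Fin 3)

/-! ### Riemannian geometry in coordinates

Here `G : E3 → Matrix (Fin 3) (Fin 3) ℝ` is the matrix `g_{ij}` of a metric in a coordinate system,
and `f : E3 → ℝ` is a function, both considered near the coordinate point `x`. -/

/-- The partial derivative `∂_i f` at `x`. -/
def pd (i : Fin 3) (f : E3 → ℝ) (x : E3) : ℝ :=
  fderiv ℝ f x (EuclideanSpace.single i 1)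

/-- The inverse metric `g^{ij}`. -/
def ginv (G : E3 → Matrix (Fin 3) (Fin 3) ℝ) (x : E3) (i j : Fin 3) : ℝ := (G x)⁻¹ i j

/-- The Christoffel symbols of the Levi-Civita connection: `∇_{∂_i} ∂_j = ∑_k Γ^k_{ij} ∂_k`, where
`Γ^k_{ij} = chr G i j k x`. -/
def chr (G : E3 → Matrix (Fin 3) (Fin 3) ℝ) (i j k : Fin 3) (x : E3) : ℝ :=
  (1 / 2) * ∑ l, ginv G x k l *
    (pd i (fun y => G y j l) x + pd j (fun y => G y i l) x - pd l (fun y => G y i j) x)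

/-- The components of the curvature endomorphism: `R_{∂_i,∂_j} ∂_k = ∑_l R_{ijk}^l ∂_l`, where
`R_{v,w} = ∇_v ∇_w - ∇_w ∇_v - ∇_{[v,w]}`. -/
def curvEnd (G : E3 → Matrix (Fin 3) (Fin 3) ℝ) (i j k l : Fin 3) (x : E3) : ℝ :=
  pd i (chr G j k l) x - pd j (chr G i k l) x +
    ∑ m, (chr G j k m x * chr G i m l x - chr G i k m x * chr G j m l x)

/-- The Riemann tensor `R_{ijkl} = g(R_{∂_i,∂_j} ∂_k, ∂_l)`. -/
def riem (G : E3 → Matrix (Fin 3) (Fin 3) ℝ) (i j k l : Fin 3) (x : E3) : ℝ :=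
  ∑ m, curvEnd G i j k m x * G x m l

/-- The Ricci tensor `Ric(v, w) = ∑_i R_{e_i, v}(w, e_i)`, with `e_i` an orthonormal frame. -/
def ric (G : E3 → Matrix (Fin 3) (Fin 3) ℝ) (a b : Fin 3) (x : E3) : ℝ :=
  ∑ i, ∑ l, ginv G x i l * riem G i a b l x

/-- The Hessian `∇ d f`. -/
def hess (G : E3 → Matrix (Fin 3) (Fin 3) ℝ) (f : E3 → ℝ) (a b : Fin 3) (x : E3) : ℝ :=
  pd a (pd b f) x - ∑ k, chr G a b k x * pd k f x

/-- `(R ∘ R)(v, w) = ½ ∑_{i,j,k} R_{v, e_i}(e_j, e_k) R_{w, e_i}(e_j, e_k)`. -/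
def riemSq (G : E3 → Matrix (Fin 3) (Fin 3) ℝ) (a b : Fin 3) (x : E3) : ℝ :=
  (1 / 2) * ∑ i, ∑ j, ∑ k, ∑ i', ∑ j', ∑ k',
    ginv G x i i' * ginv G x j j' * ginv G x k k' * riem G a i j k x * riem G b i' j' k' x

/-- `|R|² = ¼ ∑_{i,j,k,l} R_{e_i, e_j}(e_k, e_l)²`. -/
def riemNormSq (G : E3 → Matrix (Fin 3) (Fin 3) ℝ) (x : E3) : ℝ :=
  (1 / 4) * ∑ i, ∑ j, ∑ k, ∑ l, ∑ i', ∑ j', ∑ k', ∑ l',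
    ginv G x i i' * ginv G x j j' * ginv G x k k' * ginv G x l l' *
      riem G i j k l x * riem G i' j' k' l' x

/-- The covariant derivative `(∇_{∂_m} R)_{ijkl}`. -/
def covRiem (G : E3 → Matrix (Fin 3) (Fin 3) ℝ) (m i j k l : Fin 3) (x : E3) : ℝ :=
  pd m (riem G i j k l) x -
    ∑ p, (chr G m i p x * riem G p j k l x + chr G m j p x * riem G i p k l x +
      chr G m k p x * riem G i j p l x + chr G m l p x * riem G i j k p x)

/-- `d_∇^* R`, the formal adjoint of the exterior covariant derivative applied to the curvature:
`(d_∇^* R)(v₁, v₂, v₃) = - ∑_j (∇_{e_j} R)(e_j, v₁, v₂, v₃)`. -/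
def codiffRiem (G : E3 → Matrix (Fin 3) (Fin 3) ℝ) (j k l : Fin 3) (x : E3) : ℝ :=
  -∑ m, ∑ i, ginv G x m i * covRiem G m i j k l x

/-- `R(df)`, i.e. `(v₁, v₂, v₃) ↦ R_{grad f, v₁}(v₂, v₃)`. -/
def riemGrad (G : E3 → Matrix (Fin 3) (Fin 3) ℝ) (f : E3 → ℝ) (j k l : Fin 3) (x : E3) : ℝ :=
  ∑ i, ∑ m, ginv G x i m * pd m f x * riem G i j k l x

/-- `δ d f`, with `δ` the formal adjoint of `d`. -/
def codiffGrad (G : E3 → Matrix (Fin 3) (Fin 3) ℝ) (f : E3 → ℝ) (x : E3) : ℝ :=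
  -∑ a, ∑ b, ginv G x a b * hess G f a b x

/-- `|d f|²`. -/
def gradNormSq (G : E3 → Matrix (Fin 3) (Fin 3) ℝ) (f : E3 → ℝ) (x : E3) : ℝ :=
  ∑ a, ∑ b, ginv G x a b * pd a f x * pd b f x

/-- The covariant derivative `(∇_{∂_m} h)_{ij}` of a bilinear form with matrix `H`. -/
def covBilin (G H : E3 → Matrix (Fin 3) (Fin 3) ℝ) (m i j : Fin 3) (x : E3) : ℝ :=
  pd m (fun y => H y i j) x - ∑ p, (chr G m i p x * H x p j + chr G m j p x * H x i p)

/-- `(∇^* h)(v) = - ∑_i (∇_{e_i} h)(e_i, v)`. -/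
def divBilin (G H : E3 → Matrix (Fin 3) (Fin 3) ℝ) (j : Fin 3) (x : E3) : ℝ :=
  -∑ m, ∑ i, ginv G x m i * covBilin G H m i j x

/-- The Einstein operator `Ric + ∇dφ - ½ e^{2φ} g + κ R ∘ R`. -/
def einsteinOp (κ : ℝ) (G : E3 → Matrix (Fin 3) (Fin 3) ℝ) (f : E3 → ℝ) (a b : Fin 3)
    (x : E3) : ℝ :=
  ric G a b x + hess G f a b x - (1 / 2) * Real.exp (2 * f x) * G x a b + κ * riemSq G a b x

/-- The Yang-Mills operator `d_∇^* R + R(dφ)`. -/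
def yangMillsOp (G : E3 → Matrix (Fin 3) (Fin 3) ℝ) (f : E3 → ℝ) (j k l : Fin 3) (x : E3) : ℝ :=
  codiffRiem G j k l x + riemGrad G f j k l x

/-- The dilaton operator `δdφ + |dφ|² - e^{2φ} + κ |R|²`. -/
def dilatonOp (κ : ℝ) (G : E3 → Matrix (Fin 3) (Fin 3) ℝ) (f : E3 → ℝ) (x : E3) : ℝ :=
  codiffGrad G f x + gradNormSq G f x - Real.exp (2 * f x) + κ * riemNormSq G x

/-! ### Tensor fields on a three-manifold -/

section Manifold

variable (M : Type*) [TopologicalSpace M] [ChartedSpace E3 M]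

/-- Fields of bilinear forms on the tangent spaces (no regularity). -/
abbrev BilinField : Type _ :=
  (p : M) → TangentSpace (𝓡 3) p →L[ℝ] TangentSpace (𝓡 3) p →L[ℝ] ℝ

variable [IsManifold (𝓡 3) ∞ M]

/-- Smooth Riemannian metrics on `M`. -/
abbrev Metric : Type _ :=
  Bundle.ContMDiffRiemannianMetric (𝓡 3) ∞ E3 (fun p : M => TangentSpace (𝓡 3) p)

/-- Smooth sections of `T^*M ⊗ T^*M`. -/
abbrev TwoTensor : Type _ :=
  ContMDiffSection (𝓡 3) (E3 →L[ℝ] E3 →L[ℝ] ℝ) ∞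
    (fun p : M => TangentSpace (𝓡 3) p →L[ℝ] TangentSpace (𝓡 3) p →L[ℝ] ℝ)

/-- Smooth symmetric two-tensors on `M`, i.e. the tangent space to the space of metrics. -/
def SymTensor : Submodule ℝ (TwoTensor M) where
  carrier := {h | ∀ (p : M) (v w : TangentSpace (𝓡 3) p), h p v w = h p w v}
  add_mem' {h k} hh hk p v w := by
    simp only [ContMDiffSection.coe_add, Pi.add_apply, add_apply, hh p v w,
      hk p v w]
  zero_mem' p v w := by simp
  smul_mem' c h hh p v w := by
    simp only [ContMDiffSection.coe_smul, Pi.smul_apply, smul_apply, hh p v w]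

/-- The tangent space `T_{(g,φ)} Conf(M)` of the configuration space
`Conf(M) = Met(M) × C^∞(M)`, consisting of pairs `(h, ξ)`. -/
abbrev TangentConf : Type _ := SymTensor M × C^∞⟮𝓡 3, M; 𝓘(ℝ), ℝ⟯

variable {M}

/-- The matrix `B(∂_i, ∂_j)` of a field of bilinear forms in the coordinate system `e`, at the point
of `M` with coordinates `x`. -/
def inCoord (B : BilinField M) (e : OpenPartialHomeomorph M E3) (x : E3) :
    Matrix (Fin 3) (Fin 3) ℝ :=
  fun i j => B (e.symm x)
    (mfderiv (𝓡 3) (𝓡 3) e.symm x (EuclideanSpace.single i (1 : ℝ)))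
    (mfderiv (𝓡 3) (𝓡 3) e.symm x (EuclideanSpace.single j (1 : ℝ)))

/-- `g` is flat: its Riemann tensor vanishes identically. -/
def IsFlat (g : Metric M) : Prop :=
  ∀ e ∈ IsManifold.maximalAtlas (𝓡 3) ∞ M, ∀ x ∈ e.target, ∀ i j k l : Fin 3,
    riem (inCoord g.inner e) i j k l x = 0

/-- `(g, φ)` is a Heterotic soliton with vanishing torsion: it solves the Einstein, Yang-Mills and
dilaton equations. The equations are tensorial; they are written in all the smooth charts. -/
structure IsTorsionlessSoliton (κ : ℝ) (g : Metric M) (φ : C^∞⟮𝓡 3, M; 𝓘(ℝ), ℝ⟯) : Prop where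
  einstein : ∀ e ∈ IsManifold.maximalAtlas (𝓡 3) ∞ M, ∀ x ∈ e.target, ∀ a b : Fin 3,
    einsteinOp κ (inCoord g.inner e) (φ ∘ e.symm) a b x = 0
  yangMills : ∀ e ∈ IsManifold.maximalAtlas (𝓡 3) ∞ M, ∀ x ∈ e.target, ∀ j k l : Fin 3,
    yangMillsOp (inCoord g.inner e) (φ ∘ e.symm) j k l x = 0
  dilaton : ∀ e ∈ IsManifold.maximalAtlas (𝓡 3) ∞ M, ∀ x ∈ e.target,
    dilatonOp κ (inCoord g.inner e) (φ ∘ e.symm) x = 0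

/-- The field of bilinear forms `g + t h` (a Riemannian metric for small `t`, if `M` is compact). -/
def metricLine (g : Metric M) (h : SymTensor M) (t : ℝ) : BilinField M :=
  fun p => g.inner p + t • (h : TwoTensor M) p

/-- The function `φ + t ξ`. -/
def dilatonLine (φ ξ : C^∞⟮𝓡 3, M; 𝓘(ℝ), ℝ⟯) (t : ℝ) : M → ℝ := fun p => φ p + t * ξ p

/-- `(h, ξ)` is in the kernel of the differential at `(g, φ)` of the soliton operator: the
components of `(Einstein, Yang-Mills, dilaton)(g + t h, φ + t ξ)` have derivative `0` at `t = 0`, at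
every point and in all the smooth charts. -/
structure IsInfinitesimalDeformation (κ : ℝ) (g : Metric M) (φ : C^∞⟮𝓡 3, M; 𝓘(ℝ), ℝ⟯)
    (d : TangentConf M) : Prop where
  einstein : ∀ e ∈ IsManifold.maximalAtlas (𝓡 3) ∞ M, ∀ x ∈ e.target, ∀ a b : Fin 3,
    HasDerivAt (fun t : ℝ => einsteinOp κ (inCoord (metricLine g d.1 t) e)
      (dilatonLine φ d.2 t ∘ e.symm) a b x) 0 0
  yangMills : ∀ e ∈ IsManifold.maximalAtlas (𝓡 3) ∞ M, ∀ x ∈ e.target, ∀ j k l : Fin 3,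
    HasDerivAt (fun t : ℝ => yangMillsOp (inCoord (metricLine g d.1 t) e)
      (dilatonLine φ d.2 t ∘ e.symm) j k l x) 0 0
  dilaton : ∀ e ∈ IsManifold.maximalAtlas (𝓡 3) ∞ M, ∀ x ∈ e.target,
    HasDerivAt (fun t : ℝ => dilatonOp κ (inCoord (metricLine g d.1 t) e)
      (dilatonLine φ d.2 t ∘ e.symm) x) 0 0

/-- `(h, ξ)` is in the kernel of `(h, ξ) ↦ 2 ∇^* h + ξ dφ`, the formal `L²`-adjoint of the
infinitesimal action `v ↦ (L_v g, dφ(v))` of the diffeomorphism group at `(g, φ)`. -/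
def IsOrthogonalToOrbit (g : Metric M) (φ : C^∞⟮𝓡 3, M; 𝓘(ℝ), ℝ⟯) (d : TangentConf M) : Prop :=
  ∀ e ∈ IsManifold.maximalAtlas (𝓡 3) ∞ M, ∀ x ∈ e.target, ∀ j : Fin 3,
    2 * divBilin (inCoord g.inner e) (inCoord (d.1 : TwoTensor M) e) j x +
      d.2 (e.symm x) * pd j (φ ∘ e.symm) x = 0

/-- The essential deformations of `(g, φ)`. -/
def essentialDeformations (κ : ℝ) (g : Metric M) (φ : C^∞⟮𝓡 3, M; 𝓘(ℝ), ℝ⟯) :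
    Set (TangentConf M) :=
  {d | IsInfinitesimalDeformation κ g φ d ∧ IsOrthogonalToOrbit g φ d}

end Manifold

end HeteroticSoliton

end

/-!
The argument has a local part, carried out in charts with matrices of functions on open subsets of
three-space, and a global part, which consists of a single application of the divergence theorem.

*The soliton is hyperbolic.* In dimension three the Riemann tensor is the Kulkarni-Nomizu product
of `g` with the Schouten tensor (`IsMetricOn.riem_eq_schouten`), so `R ∘ R` and `|R|²` are
polynomials in the Ricci tensor. For constant `φ = c`, put `Λ = e^{2c}`. The Einstein equation
becomes the quadratic equation `κ E g⁻¹ E + E = (Λ / 4) g` for the Einstein tensor `E`, and the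
Yang-Mills equation says that `E` is a Codazzi tensor, so that `∇E` is totally symmetric. The
derivative of the quadratic equation says that `S = 2κ g⁻¹ E + 1` anticommutes with `∇E`; hence
`∇E · S = 0` (`mul_eq_zero_of_anticommute`). As `S²` is a positive multiple of the identity, `E` is
parallel (`IsConstSoliton.parallel`). A parallel `E` commutes with the curvature, which leaves only
`E = -(Λ / 12) g`: the metric has constant curvature `-k` with `k = 4 / κ`, and `Λ = 12 k`
(`IsConstSoliton.isHyperbolic`, `IsConstSoliton.kappa_mul_exp`).

*The dilaton variation vanishes.* Let `(h, ξ)` solve the linearized equations, and let `Ric'` be the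
first variation of the Ricci tensor along `h`. The linearized Einstein equation reads
`7 (Ric' + 2 k h) = ∇dξ - 12 k ξ g`, and its trace together with the linearized dilaton equation
makes `ξ` an eigenfunction of the Laplace operator (`IsVariation.linearized_einstein`,
`IsVariation.linearized_dilaton`). When these two relations are inserted into the linearized
Yang-Mills equation, everything cancels except a nonzero multiple of `dξ ∧ g`. Hence `dξ = 0`, and
the eigenvalue equation gives `ξ = 0` (`IsVariation.pd_dilaton_eq_zero`,
`IsVariation.dilaton_eq_zero`). What is left of the linearized Einstein equation is
`Ric' = -2 k h`, and the gauge condition says that `h` is divergence-free.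

*The metric variation vanishes.* This is the infinitesimal rigidity of closed hyperbolic manifolds
as Einstein manifolds. For a divergence-free `h` with `Ric' = -2 k h`, the divergence of the
one-form `w_a = h^{bc} (∇_a h_{bc} - ∇_b h_{ac}) + h_a^b ∂_b (tr h)` is
`½ |∇_a h_{bc} - ∇_b h_{ac}|² + k |h|² + k (tr h)²`
(`IsHyperbolic.exists_divForm_bochnerForm`). Its integral over the closed manifold is zero, so
`h = 0` (`metricVariation_eq_zero`). The divergence theorem is proved for vector densities given in
finitely many charts, by means of a partition of unity (`sum_integral_div_eq_zero`); it does not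
require an orientation.
-/

open scoped Manifold ContDiff

noncomputable section

namespace HeteroticSoliton

open scoped Topology Matrix

/-! ### Partial derivatives of smooth functions and of matrix fields -/

/-- Real `3 × 3` matrices: the components of bilinear forms and of endomorphisms. -/
abbrev Mat : Type := Matrix (Fin 3) (Fin 3) ℝ

section Smooth

variable {E : Type*} [NormedAddCommGroup E] [NormedSpace ℝ E]

/-- `f` is smooth at every point of `U`. -/
def Sm (U : Set E) (f : E → ℝ) : Prop := ∀ x ∈ U, ContDiffAt ℝ ∞ f x

/-- All the entries of the matrix field `A` are smooth at every point of `U`. -/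
def SmM (U : Set E) (A : E → Mat) : Prop := ∀ i j, Sm U (fun y => A y i j)

variable {U : Set E} {x : E} {f f₁ f₂ : E → ℝ} {A B : E → Mat}

theorem Sm.differentiableAt (hf : Sm U f) (hx : x ∈ U) : DifferentiableAt ℝ f x :=
  (hf x hx).differentiableAt (by simp)

theorem Sm.const (U : Set E) (c : ℝ) : Sm U (fun _ => c) := fun _ _ => contDiffAt_const

theorem Sm.add (h₁ : Sm U f₁) (h₂ : Sm U f₂) : Sm U (fun y => f₁ y + f₂ y) :=
  fun x hx => (h₁ x hx).add (h₂ x hx)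

theorem Sm.sub (h₁ : Sm U f₁) (h₂ : Sm U f₂) : Sm U (fun y => f₁ y - f₂ y) :=
  fun x hx => (h₁ x hx).sub (h₂ x hx)

theorem Sm.neg (h₁ : Sm U f₁) : Sm U (fun y => -f₁ y) :=
  fun x hx => (h₁ x hx).neg

theorem Sm.mul (h₁ : Sm U f₁) (h₂ : Sm U f₂) : Sm U (fun y => f₁ y * f₂ y) :=
  fun x hx => (h₁ x hx).mul (h₂ x hx)

theorem Sm.const_mul (c : ℝ) (h₁ : Sm U f₁) : Sm U (fun y => c * f₁ y) :=
  (Sm.const U c).mul h₁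

theorem Sm.inv (h₁ : Sm U f₁) (h : ∀ y ∈ U, f₁ y ≠ 0) : Sm U (fun y => (f₁ y)⁻¹) :=
  fun x hx => (h₁ x hx).inv (h x hx)

theorem Sm.sum {ι : Type*} {s : Finset ι} {F : ι → E → ℝ} (h : ∀ i ∈ s, Sm U (F i)) :
    Sm U (fun y => ∑ i ∈ s, F i y) :=
  fun x hx => ContDiffAt.sum fun i hi => h i hi x hx

theorem Sm.congr (hU : IsOpen U) (hf : Sm U f) (h : ∀ y ∈ U, f₁ y = f y) : Sm U f₁ :=
  fun x hx => (hf x hx).congr_of_eventuallyEq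
    (Filter.eventually_of_mem (hU.mem_nhds hx) h)

theorem SmM.add (hA : SmM U A) (hB : SmM U B) : SmM U (fun y => A y + B y) :=
  fun i j => (hA i j).add (hB i j)

theorem SmM.sub (hA : SmM U A) (hB : SmM U B) : SmM U (fun y => A y - B y) :=
  fun i j => (hA i j).sub (hB i j)

theorem SmM.smul (hf : Sm U f) (hA : SmM U A) : SmM U (fun y => f y • A y) :=
  fun i j => hf.mul (hA i j)

theorem SmM.mul (hA : SmM U A) (hB : SmM U B) : SmM U (fun y => A y * B y) := by
  intro i j
  simp only [Matrix.mul_apply]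
  exact Sm.sum fun k _ => (hA i k).mul (hB k j)

theorem SmM.transpose (hA : SmM U A) : SmM U (fun y => (A y)ᵀ) := fun i j => hA j i

theorem SmM.congr (hU : IsOpen U) (hA : SmM U A) (h : ∀ y ∈ U, B y = A y) : SmM U B :=
  fun i j => (hA i j).congr hU fun y hy => by rw [h y hy]

theorem SmM.trace (hA : SmM U A) : Sm U (fun y => (A y).trace) := Sm.sum fun i _ => hA i i

theorem SmM.det (hA : SmM U A) : Sm U (fun y => (A y).det) := by
  simp only [Matrix.det_fin_three]
  have h := hA
  exact ((((((((h 0 0).mul (h 1 1)).mul (h 2 2)).sub (((h 0 0).mul (h 1 2)).mul (h 2 1))).sub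
    (((h 0 1).mul (h 1 0)).mul (h 2 2))).add (((h 0 1).mul (h 1 2)).mul (h 2 0))).add
    (((h 0 2).mul (h 1 0)).mul (h 2 1))).sub (((h 0 2).mul (h 1 1)).mul (h 2 0)))

theorem SmM.inv (hA : SmM U A) (h : ∀ y ∈ U, (A y).det ≠ 0) : SmM U (fun y => (A y)⁻¹) := by
  have hadj : SmM U (fun y => (A y).adjugate) := by
    intro i j
    simp only [Matrix.adjugate_apply]
    refine SmM.det (A := fun y => (A y).updateRow j (Pi.single i 1)) fun k l => ?_
    by_cases hk : k = j
    · subst hk; simpa using Sm.const U _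
    · simpa [Matrix.updateRow_ne hk] using hA k l
  intro i j
  simp only [Matrix.inv_def, Ring.inverse_eq_inv', Matrix.smul_apply, smul_eq_mul]
  exact (hA.det.inv h).mul (hadj i j)

end Smooth

/-- The entrywise partial derivative `∂_m A` of a matrix field. -/
def dM (m : Fin 3) (A : E3 → Mat) (x : E3) : Mat := fun i j => pd m (fun y => A y i j) x

variable {U : Set E3} {x : E3} {f f₁ f₂ : E3 → ℝ} {A B : E3 → Mat}

theorem Sm.pd (m : Fin 3) (hf : Sm U f) : Sm U (pd m f) := fun x hx =>
  ((hf x hx).fderiv_right (m := ∞) (by simp)).clm_apply contDiffAt_const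

theorem pd_congr (hU : IsOpen U) (hx : x ∈ U) (h : ∀ y ∈ U, f₁ y = f₂ y) (m : Fin 3) :
    pd m f₁ x = pd m f₂ x := by
  have : f₁ =ᶠ[𝓝 x] f₂ := Filter.eventually_of_mem (hU.mem_nhds hx) h
  simp only [pd, this.fderiv_eq]

@[simp] theorem pd_const (m : Fin 3) (c : ℝ) : pd m (fun _ => c) x = 0 := by simp [pd]

theorem pd_add (h₁ : Sm U f₁) (h₂ : Sm U f₂) (hx : x ∈ U) (m : Fin 3) :
    pd m (fun y => f₁ y + f₂ y) x = pd m f₁ x + pd m f₂ x := by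
  simp only [pd]
  rw [fderiv_fun_add (h₁.differentiableAt hx) (h₂.differentiableAt hx)]; rfl

theorem pd_sub (h₁ : Sm U f₁) (h₂ : Sm U f₂) (hx : x ∈ U) (m : Fin 3) :
    pd m (fun y => f₁ y - f₂ y) x = pd m f₁ x - pd m f₂ x := by
  simp only [pd]
  rw [fderiv_fun_sub (h₁.differentiableAt hx) (h₂.differentiableAt hx)]; rfl

theorem pd_mul (h₁ : Sm U f₁) (h₂ : Sm U f₂) (hx : x ∈ U) (m : Fin 3) :
    pd m (fun y => f₁ y * f₂ y) x = pd m f₁ x * f₂ x + f₁ x * pd m f₂ x := by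
  simp only [pd]
  rw [fderiv_fun_mul (h₁.differentiableAt hx) (h₂.differentiableAt hx)]
  simp only [add_apply, smul_apply, smul_eq_mul]
  ring

theorem pd_const_mul (h₁ : Sm U f) (hx : x ∈ U) (c : ℝ) (m : Fin 3) :
    pd m (fun y => c * f y) x = c * pd m f x := by
  rw [pd_mul (Sm.const U c) h₁ hx]; simp

theorem pd_sum {ι : Type*} {s : Finset ι} {F : ι → E3 → ℝ} (h : ∀ i ∈ s, Sm U (F i))
    (hx : x ∈ U) (m : Fin 3) :
    pd m (fun y => ∑ i ∈ s, F i y) x = ∑ i ∈ s, pd m (F i) x := by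
  simp only [pd]
  rw [fderiv_fun_sum fun i hi => (h i hi).differentiableAt hx]
  simp

/-- Partial derivatives of smooth functions commute. -/
theorem pd_comm (hf : Sm U f) (hx : x ∈ U) (i j : Fin 3) : pd i (pd j f) x = pd j (pd i f) x := by
  have h2 : DifferentiableAt ℝ (fderiv ℝ f) x :=
    ((hf x hx).fderiv_right (m := ∞) (by simp)).differentiableAt (by simp)
  have key : ∀ i j : Fin 3, pd i (pd j f) x =
      fderiv ℝ (fderiv ℝ f) x (EuclideanSpace.single i 1) (EuclideanSpace.single j 1) := by
    intro i j
    have : HasFDerivAt (pd j f)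
        ((fderiv ℝ (fderiv ℝ f) x).flip (EuclideanSpace.single j 1)) x := by
      have := h2.hasFDerivAt.clm_apply
        (hasFDerivAt_const (EuclideanSpace.single j (1 : ℝ)) x)
      convert! this using 1
      ext; simp
    rw [pd, this.fderiv]; rfl
  rw [key, key]
  exact ((hf x hx).isSymmSndFDerivAt (by simpa using ENat.LEInfty.out)) _ _

theorem SmM.dM (m : Fin 3) (hA : SmM U A) : SmM U (dM m A) := fun i j => (hA i j).pd m

theorem dM_congr (hU : IsOpen U) (hx : x ∈ U) (h : ∀ y ∈ U, A y = B y) (m : Fin 3) :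
    dM m A x = dM m B x := by
  ext i j
  exact pd_congr hU hx (fun y hy => by rw [h y hy]) m

@[simp] theorem dM_const (m : Fin 3) (C : Mat) : dM m (fun _ => C) x = 0 := by
  ext i j; simp [dM]

theorem dM_add (hA : SmM U A) (hB : SmM U B) (hx : x ∈ U) (m : Fin 3) :
    dM m (fun y => A y + B y) x = dM m A x + dM m B x := by
  ext i j; exact pd_add (hA i j) (hB i j) hx m

theorem dM_sub (hA : SmM U A) (hB : SmM U B) (hx : x ∈ U) (m : Fin 3) :
    dM m (fun y => A y - B y) x = dM m A x - dM m B x := by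
  ext i j; exact pd_sub (hA i j) (hB i j) hx m

theorem dM_smul (hf : Sm U f) (hA : SmM U A) (hx : x ∈ U) (m : Fin 3) :
    dM m (fun y => f y • A y) x = pd m f x • A x + f x • dM m A x := by
  ext i j; exact pd_mul hf (hA i j) hx m

theorem dM_mul (hA : SmM U A) (hB : SmM U B) (hx : x ∈ U) (m : Fin 3) :
    dM m (fun y => A y * B y) x = dM m A x * B x + A x * dM m B x := by
  ext i j
  simp only [dM, Matrix.mul_apply, Matrix.add_apply]
  rw [pd_sum (fun k _ => (hA i k).mul (hB k j)) hx, ← Finset.sum_add_distrib]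
  exact Finset.sum_congr rfl fun k _ => pd_mul (hA i k) (hB k j) hx m

theorem dM_transpose (m : Fin 3) : dM m (fun y => (A y)ᵀ) x = (dM m A x)ᵀ := rfl

theorem pd_trace (hA : SmM U A) (hx : x ∈ U) (m : Fin 3) :
    pd m (fun y => (A y).trace) x = (dM m A x).trace :=
  pd_sum (fun i _ => hA i i) hx m

theorem dM_comm (hA : SmM U A) (hx : x ∈ U) (i j : Fin 3) :
    dM i (dM j A) x = dM j (dM i A) x := by
  ext k l; exact pd_comm (hA k l) hx i j

end HeteroticSoliton

end

noncomputable section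

namespace HeteroticSoliton

open scoped Topology Matrix

/-! ### Local Riemannian geometry in matrix notation -/

/-- `G` is the matrix of a smooth Riemannian metric on the open set `U`. -/
structure IsMetricOn (U : Set E3) (G : E3 → Mat) : Prop where
  isOpen : IsOpen U
  smooth : SmM U G
  posDef : ∀ x ∈ U, (G x).PosDef

/-- The Christoffel symbols `Γ^k_{mi}` as a matrix `Γ_m` with row index `i` and column index `k`. -/
def chrM (G : E3 → Mat) (m : Fin 3) (x : E3) : Mat := fun i k => chr G m i k x

/-- The covariant derivative `∇_m A` of a field of bilinear forms, as a matrix. -/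
def covM (G A : E3 → Mat) (m : Fin 3) (x : E3) : Mat :=
  dM m A x - chrM G m x * A x - A x * (chrM G m x)ᵀ

/-- The covariant derivative `(∇_m T)_i` of a three-tensor `T_{ijk}`, which is written as a family
of matrices indexed by `i`. -/
def cov3 (G : E3 → Mat) (T : Fin 3 → E3 → Mat) (m i : Fin 3) (x : E3) : Mat :=
  dM m (T i) x - chrM G m x * T i x - T i x * (chrM G m x)ᵀ - ∑ p, chr G m i p x • T p x

/-- The curvature endomorphism of `∂_i, ∂_j`, with row index the argument. -/
def curvM (G : E3 → Mat) (i j : Fin 3) (x : E3) : Mat := fun k l => curvEnd G i j k l x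

variable {U : Set E3} {x : E3} {G A B : E3 → Mat}

theorem covBilin_eq (G A : E3 → Mat) (m i j : Fin 3) (x : E3) :
    covBilin G A m i j x = covM G A m x i j := by
  simp only [covBilin, covM, Matrix.sub_apply, Matrix.mul_apply, Matrix.transpose_apply, dM, chrM,
    Finset.sum_add_distrib]
  rw [sub_sub]
  congr 2
  exact Finset.sum_congr rfl fun p _ => mul_comm _ _

theorem riem_eq (G : E3 → Mat) (i j : Fin 3) (x : E3) (k l : Fin 3) :
    riem G i j k l x = (curvM G i j x * G x) k l := rfl

theorem curvM_antisymm (G : E3 → Mat) (i j : Fin 3) (x : E3) :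
    curvM G i j x = -curvM G j i x := by
  ext k l
  simp only [curvM, curvEnd, Matrix.neg_apply, Finset.sum_sub_distrib]
  ring

theorem curvM_eq (G : E3 → Mat) (i j : Fin 3) (x : E3) : curvM G i j x =
    dM i (chrM G j) x - dM j (chrM G i) x + chrM G j x * chrM G i x
      - chrM G i x * chrM G j x := by
  ext k l
  simp only [curvM, curvEnd, Finset.sum_sub_distrib, Matrix.sub_apply, Matrix.add_apply,
    Matrix.mul_apply, dM, chrM]
  ring

namespace IsMetricOn

variable (hG : IsMetricOn U G)
include hG

theorem det_ne (hx : x ∈ U) : (G x).det ≠ 0 := (hG.posDef x hx).det_pos.ne'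

theorem transpose_eq (hx : x ∈ U) : (G x)ᵀ = G x := by
  have := (hG.posDef x hx).isHermitian
  rwa [Matrix.IsHermitian, Matrix.conjTranspose_eq_transpose_of_trivial] at this

theorem symm (hx : x ∈ U) (i j : Fin 3) : G x i j = G x j i := by
  conv_lhs => rw [← hG.transpose_eq hx]
  rfl

theorem inv_mul (hx : x ∈ U) : (G x)⁻¹ * G x = 1 :=
  Matrix.nonsing_inv_mul _ (isUnit_iff_ne_zero.2 (hG.det_ne hx))

theorem mul_inv (hx : x ∈ U) : G x * (G x)⁻¹ = 1 :=
  Matrix.mul_nonsing_inv _ (isUnit_iff_ne_zero.2 (hG.det_ne hx))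

theorem inv_transpose (hx : x ∈ U) : ((G x)⁻¹)ᵀ = (G x)⁻¹ := by
  rw [Matrix.transpose_nonsing_inv, hG.transpose_eq hx]

theorem inv_symm (hx : x ∈ U) (i j : Fin 3) : (G x)⁻¹ i j = (G x)⁻¹ j i := by
  conv_lhs => rw [← hG.inv_transpose hx]
  rfl

theorem smooth_inv : SmM U (fun y => (G y)⁻¹) := hG.smooth.inv fun _ hy => hG.det_ne hy

theorem smooth_chr (i j k : Fin 3) : Sm U (chr G i j k) :=
  Sm.const_mul _ (Sm.sum fun l _ => (hG.smooth_inv k l).mul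
    ((((hG.smooth j l).pd i).add ((hG.smooth i l).pd j)).sub ((hG.smooth i j).pd l)))

theorem smooth_chrM (m : Fin 3) : SmM U (chrM G m) := fun i k => hG.smooth_chr m i k

theorem smooth_covM (hA : SmM U A) (m : Fin 3) : SmM U (covM G A m) :=
  ((hA.dM m).sub ((hG.smooth_chrM m).mul hA)).sub (hA.mul (hG.smooth_chrM m).transpose)

theorem pd_symm (hx : x ∈ U) (m i j : Fin 3) :
    pd m (fun y => G y i j) x = pd m (fun y => G y j i) x :=
  pd_congr hG.isOpen hx (fun _ hy => hG.symm hy i j) m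

theorem chr_symm (hx : x ∈ U) (i j k : Fin 3) : chr G i j k x = chr G j i k x := by
  simp only [chr]
  congr 1
  refine Finset.sum_congr rfl fun l _ => ?_
  rw [hG.pd_symm hx l i j]
  ring

/-- Koszul formula. -/
theorem chrM_mul (hx : x ∈ U) (i j l : Fin 3) : (chrM G i x * G x) j l =
    (1 / 2) * (pd i (fun y => G y j l) x + pd j (fun y => G y i l) x
      - pd l (fun y => G y i j) x) := by
  set v : Fin 3 → ℝ := fun l => pd i (fun y => G y j l) x + pd j (fun y => G y i l) x
    - pd l (fun y => G y i j) x with hv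
  have h1 : ∀ k, chrM G i x j k = (1 / 2) * Matrix.vecMul v (G x)⁻¹ k := by
    intro k
    simp only [chrM, chr, Matrix.vecMul, dotProduct, ginv]
    congr 1
    refine Finset.sum_congr rfl fun l _ => ?_
    rw [hG.inv_symm hx k l, mul_comm]
  calc (chrM G i x * G x) j l = (1 / 2) * Matrix.vecMul (Matrix.vecMul v (G x)⁻¹) (G x) l := by
        simp only [Matrix.mul_apply, h1]
        rw [Matrix.vecMul, dotProduct, Finset.mul_sum]
        exact Finset.sum_congr rfl fun k _ => by ring
    _ = (1 / 2) * v l := by rw [Matrix.vecMul_vecMul, hG.inv_mul hx, Matrix.vecMul_one]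

/-- The Levi-Civita connection is metric. -/
theorem dM_metric (hx : x ∈ U) (m : Fin 3) :
    dM m G x = chrM G m x * G x + G x * (chrM G m x)ᵀ := by
  have h : G x * (chrM G m x)ᵀ = (chrM G m x * G x)ᵀ := by
    rw [Matrix.transpose_mul, hG.transpose_eq hx]
  rw [h]
  ext i j
  rw [Matrix.add_apply, Matrix.transpose_apply, hG.chrM_mul hx, hG.chrM_mul hx, dM,
    hG.pd_symm hx m j i, hG.pd_symm hx i m j, hG.pd_symm hx j m i]
  ring

theorem covM_metric (hx : x ∈ U) (m : Fin 3) : covM G G m x = 0 := by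
  rw [covM, hG.dM_metric hx]; abel

theorem dM_inv (hx : x ∈ U) (m : Fin 3) : dM m (fun y => (G y)⁻¹) x =
    -((G x)⁻¹ * chrM G m x) - (chrM G m x)ᵀ * (G x)⁻¹ := by
  have h0 : dM m (fun y => (G y)⁻¹ * G y) x = 0 := by
    rw [dM_congr hG.isOpen hx (B := fun _ => 1) (fun y hy => hG.inv_mul hy)]; simp
  rw [dM_mul hG.smooth_inv hG.smooth hx, hG.dM_metric hx] at h0
  have h1 := congrArg (· * (G x)⁻¹) h0
  simp only [add_mul, mul_add, zero_mul, mul_assoc, hG.mul_inv hx, mul_one] at h1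
  rw [← mul_assoc (G x)⁻¹ (G x), hG.inv_mul hx, one_mul] at h1
  rw [eq_sub_iff_add_eq, eq_neg_iff_add_eq_zero, ← h1]
  abel

/-- The Levi-Civita connection is the only torsion-free metric connection. -/
theorem chrM_unique (hx : x ∈ U) (C : Fin 3 → Mat) (hsymm : ∀ i j k, C i j k = C j i k)
    (hmetric : ∀ m, dM m G x = C m * G x + G x * (C m)ᵀ) (m : Fin 3) : C m = chrM G m x := by
  have key : ∀ i, C i * G x = chrM G i x * G x := by
    intro i
    ext j l
    have e : ∀ m i j, pd m (fun y => G y i j) x = (C m * G x) i j + (C m * G x) j i := by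
      intro m i j
      have h := congrFun (congrFun (hmetric m) i) j
      have h' : G x * (C m)ᵀ = (C m * G x)ᵀ := by
        rw [Matrix.transpose_mul, hG.transpose_eq hx]
      rw [h'] at h
      exact h
    have s : ∀ i j l, (C i * G x) j l = (C j * G x) i l := by
      intro i j l
      simp only [Matrix.mul_apply, hsymm i j]
    rw [hG.chrM_mul hx, e, e, e]
    linarith [s i j l, s l i j, s l j i]
  have h := congrArg (· * (G x)⁻¹) (key m)
  simpa only [mul_assoc, hG.mul_inv hx, mul_one] using h

theorem smooth_curvM (i j : Fin 3) : SmM U (curvM G i j) := by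
  refine SmM.congr hG.isOpen ?_ (fun y hy => curvM_eq G i j y)
  exact ((((hG.smooth_chrM j).dM i).sub ((hG.smooth_chrM i).dM j)).add
    ((hG.smooth_chrM j).mul (hG.smooth_chrM i))).sub ((hG.smooth_chrM i).mul (hG.smooth_chrM j))

/-- Ricci identity for bilinear forms. -/
theorem ricci_identity (hA : SmM U A) (hx : x ∈ U) (m i : Fin 3) :
    cov3 G (covM G A) m i x - cov3 G (covM G A) i m x =
      -(curvM G m i x * A x) - A x * (curvM G m i x)ᵀ := by
  have hd : ∀ m i, dM m (covM G A i) x = dM m (dM i A) x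
      - (dM m (chrM G i) x * A x + chrM G i x * dM m A x)
      - (dM m A x * (chrM G i x)ᵀ + A x * (dM m (chrM G i) x)ᵀ) := by
    intro m i
    have h1 := (hG.smooth_chrM i).mul hA
    have h2 := hA.mul (hG.smooth_chrM i).transpose
    have e : dM m (covM G A i) x = dM m (fun y => dM i A y - chrM G i y * A y
      - A y * (chrM G i y)ᵀ) x := rfl
    rw [e, dM_sub ((hA.dM i).sub h1) h2 hx, dM_sub (hA.dM i) h1 hx,
      dM_mul (hG.smooth_chrM i) hA hx, dM_mul hA (hG.smooth_chrM i).transpose hx]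
    rfl
  have hs : ∑ p, chr G m i p x • covM G A p x = ∑ p, chr G i m p x • covM G A p x :=
    Finset.sum_congr rfl fun p _ => by rw [hG.chr_symm hx]
  rw [cov3, cov3, hs, hd, hd, dM_comm hA hx m i, curvM_eq]
  simp only [covM, Matrix.transpose_sub, Matrix.transpose_add, Matrix.transpose_mul]
  noncomm_ring

/-- The Riemann tensor is antisymmetric in its last two arguments. -/
theorem curvM_mul_metric_antisymm (hx : x ∈ U) (m i : Fin 3) :
    curvM G m i x * G x + G x * (curvM G m i x)ᵀ = 0 := by
  have h := hG.ricci_identity hG.smooth hx m i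
  have h0 : ∀ m i, cov3 G (covM G G) m i x = 0 := by
    intro m i
    have e : ∀ p, ∀ y ∈ U, covM G G p y = (fun _ => (0 : Mat)) y :=
      fun p y hy => hG.covM_metric hy p
    rw [cov3, dM_congr hG.isOpen hx (e i)]
    simp [hG.covM_metric hx]
  rw [h0, h0] at h
  rw [← neg_eq_zero, neg_add, ← sub_eq_add_neg, ← h, sub_zero]

theorem riem_antisymm_right (hx : x ∈ U) (i j k l : Fin 3) :
    riem G i j k l x = -riem G i j l k x := by
  have h := congrFun (congrFun (hG.curvM_mul_metric_antisymm hx i j) k) l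
  have h' : G x * (curvM G i j x)ᵀ = (curvM G i j x * G x)ᵀ := by
    rw [Matrix.transpose_mul, hG.transpose_eq hx]
  rw [h'] at h
  exact eq_neg_of_add_eq_zero_left h

omit hG in
theorem _root_.HeteroticSoliton.riem_antisymm_left (i j k l : Fin 3) :
    riem G i j k l x = -riem G j i k l x := by
  rw [riem_eq, riem_eq, curvM_antisymm]; simp

/-- First Bianchi identity. -/
theorem riem_bianchi (hx : x ∈ U) (i j k l : Fin 3) :
    riem G i j k l x + riem G j k i l x + riem G k i j l x = 0 := by
  have h : ∀ m, curvEnd G i j k m x + curvEnd G j k i m x + curvEnd G k i j m x = 0 := by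
    intro m
    have hp : ∀ a b c, pd a (chr G b c m) x = pd a (chr G c b m) x := fun a b c =>
      pd_congr hG.isOpen hx (fun y hy => hG.chr_symm hy b c m) a
    simp only [curvEnd, Finset.sum_sub_distrib]
    rw [hp i k j, hp j i k, hp k j i]
    simp only [hG.chr_symm hx k j, hG.chr_symm hx k i, hG.chr_symm hx j i]
    ring
  simp only [riem, ← Finset.sum_add_distrib, ← add_mul, h, zero_mul, Finset.sum_const_zero]

theorem riem_pair_symm (hx : x ∈ U) (i j k l : Fin 3) :
    riem G i j k l x = riem G k l i j x := by
  have b := hG.riem_bianchi hx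
  have r := hG.riem_antisymm_right hx
  have s := fun i j k l => riem_antisymm_left (G := G) (x := x) i j k l
  linarith [b i j k l, b j k l i, b k l i j, b l i j k, r i j k l, r j k i l, r k i j l,
    r j k l i, r k l j i, r l j k i, r k l i j, r l i k j, r i k l j, r l i j k, r i j l k,
    r j l i k, s i j k l, s j k i l, s k i j l, s k l i j, s l i j k, s i k l j, s j l i k,
    s k i l j, s l j i k, s l j k i, s i k j l]

end IsMetricOn

theorem ric_eq (hG : IsMetricOn U G) (hx : x ∈ U) (a b : Fin 3) :
    ric G a b x = ∑ i, curvEnd G i a b i x := by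
  refine Finset.sum_congr rfl fun i _ => ?_
  have : ∑ l, ginv G x i l * riem G i a b l x = (curvM G i a x * G x * (G x)⁻¹) b i := by
    rw [Matrix.mul_apply]
    exact Finset.sum_congr rfl fun l _ => by
      rw [ginv, hG.inv_symm hx i l, mul_comm]; rfl
  rw [this, mul_assoc, hG.mul_inv hx, mul_one]; rfl

end HeteroticSoliton

end

noncomputable section

namespace HeteroticSoliton

open scoped Topology Matrix

/-! ### Orthonormal frames and the curvature tensor in dimension three -/

/-- The components of a bilinear form in the frame formed by the columns of `F`. -/
def hat2 (F : Mat) (X : Fin 3 → Fin 3 → ℝ) (a b : Fin 3) : ℝ := ∑ i, ∑ j, F i a * F j b * X i j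

/-- The components of a four-tensor in the frame formed by the columns of `F`. -/
def hat4 (F : Mat) (R : Fin 3 → Fin 3 → Fin 3 → Fin 3 → ℝ) (a b c d : Fin 3) : ℝ :=
  hat2 F (fun i j => hat2 F (R i j) c d) a b

/-- The columns of `F` form an orthonormal frame of the metric `G`. -/
structure IsFrame (G F : Mat) : Prop where
  mul_transpose : F * Fᵀ = G⁻¹
  transpose_mul : Fᵀ * G * F = 1

open scoped MatrixOrder Matrix.Norms.L2Operator in
theorem exists_isFrame {G : Mat} (hG : G.PosDef) : ∃ F : Mat, IsFrame G F := by
  obtain ⟨B, hB⟩ := CStarAlgebra.nonneg_iff_eq_star_mul_self.1 hG.posSemidef.nonneg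
  rw [Matrix.star_eq_conjTranspose, Matrix.conjTranspose_eq_transpose_of_trivial] at hB
  have hdet : B.det ≠ 0 := by
    intro h0
    have := hG.det_pos
    rw [hB, Matrix.det_mul, h0, mul_zero] at this
    exact lt_irrefl _ this
  have hu : IsUnit B.det := isUnit_iff_ne_zero.2 hdet
  refine ⟨B⁻¹, ?_, ?_⟩
  · rw [hB, Matrix.mul_inv_rev, Matrix.transpose_nonsing_inv]
  · rw [hB, Matrix.transpose_nonsing_inv, ← mul_assoc, Matrix.nonsing_inv_mul Bᵀ (by simpa using hu),
      one_mul, Matrix.mul_nonsing_inv _ hu]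

theorem hat2_eq_mul (F X : Mat) (a b : Fin 3) : hat2 F X a b = (Fᵀ * X * F) a b := by
  simp only [hat2, Matrix.mul_apply, Matrix.transpose_apply, Finset.sum_mul]
  rw [Finset.sum_comm]
  exact Finset.sum_congr rfl fun j _ => Finset.sum_congr rfl fun i _ => by ring

theorem hat2_add (F : Mat) (X Y : Fin 3 → Fin 3 → ℝ) (a b : Fin 3) :
    hat2 F (fun i j => X i j + Y i j) a b = hat2 F X a b + hat2 F Y a b := by
  simp only [hat2, mul_add, Finset.sum_add_distrib]

theorem hat2_sub (F : Mat) (X Y : Fin 3 → Fin 3 → ℝ) (a b : Fin 3) :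
    hat2 F (fun i j => X i j - Y i j) a b = hat2 F X a b - hat2 F Y a b := by
  simp only [hat2, mul_sub, Finset.sum_sub_distrib]

theorem hat2_neg (F : Mat) (X : Fin 3 → Fin 3 → ℝ) (a b : Fin 3) :
    hat2 F (fun i j => -X i j) a b = -hat2 F X a b := by
  simp only [hat2, mul_neg, Finset.sum_neg_distrib]

theorem hat2_mul_left (F : Mat) (c : ℝ) (X : Fin 3 → Fin 3 → ℝ) (a b : Fin 3) :
    hat2 F (fun i j => c * X i j) a b = c * hat2 F X a b := by
  simp only [hat2, Finset.mul_sum]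
  exact Finset.sum_congr rfl fun i _ => Finset.sum_congr rfl fun j _ => by ring

theorem hat2_mul_right (F : Mat) (c : ℝ) (X : Fin 3 → Fin 3 → ℝ) (a b : Fin 3) :
    hat2 F (fun i j => X i j * c) a b = hat2 F X a b * c := by
  simp only [hat2, Finset.sum_mul]
  exact Finset.sum_congr rfl fun i _ => Finset.sum_congr rfl fun j _ => by ring

theorem hat2_sum (F : Mat) {ι : Type*} (s : Finset ι) (X : ι → Fin 3 → Fin 3 → ℝ) (a b : Fin 3) :
    hat2 F (fun i j => ∑ k ∈ s, X k i j) a b = ∑ k ∈ s, hat2 F (X k) a b := by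
  simp only [hat2, Finset.mul_sum]
  calc _ = ∑ i, ∑ k ∈ s, ∑ j, F i a * F j b * X k i j :=
        Finset.sum_congr rfl fun i _ => Finset.sum_comm
    _ = _ := Finset.sum_comm

theorem hat2_swap (F : Mat) (X : Fin 3 → Fin 3 → ℝ) (a b : Fin 3) :
    hat2 F (fun i j => X j i) a b = hat2 F X b a := by
  simp only [hat2]
  rw [Finset.sum_comm]
  exact Finset.sum_congr rfl fun i _ => Finset.sum_congr rfl fun j _ => by ring

/-- Transforming the slots `1, 2` and then `3, 4` is the same as transforming the slots `1, 3` and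
then `2, 4`. -/
theorem hat2_hat2_comm (F : Mat) (R : Fin 3 → Fin 3 → Fin 3 → Fin 3 → ℝ) (a b c d : Fin 3) :
    hat2 F (fun i j => hat2 F (fun k l => R i j k l) c d) a b =
      hat2 F (fun i k => hat2 F (fun j l => R i j k l) b d) a c := by
  simp only [hat2, Finset.mul_sum]
  refine Finset.sum_congr rfl fun i _ => ?_
  rw [Finset.sum_comm]
  exact Finset.sum_congr rfl fun k _ => Finset.sum_congr rfl fun j _ =>
    Finset.sum_congr rfl fun l _ => by ring

/-- Transforming the slots `1, 2` and then `3, 4` is the same as transforming the slots `3, 4` and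
then `1, 2`. -/
theorem hat2_hat2_comm' (F : Mat) (R : Fin 3 → Fin 3 → Fin 3 → Fin 3 → ℝ) (a b c d : Fin 3) :
    hat2 F (fun i j => hat2 F (fun k l => R i j k l) c d) a b =
      hat2 F (fun k l => hat2 F (fun i j => R i j k l) a b) c d := by
  rw [hat2_hat2_comm, ← hat2_swap]
  simp only [← hat2_swap F _ d b]
  rw [hat2_hat2_comm]

variable {G F : Mat}

theorem IsFrame.isUnit (hF : IsFrame G F) : IsUnit F.det := by
  have h := congrArg Matrix.det hF.transpose_mul
  rw [Matrix.det_mul, Matrix.det_one] at h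
  exact IsUnit.of_mul_eq_one _ (by rw [mul_comm]; exact h)

theorem IsFrame.hat2_injective (hF : IsFrame G F) {X Y : Fin 3 → Fin 3 → ℝ}
    (h : ∀ a b, hat2 F X a b = hat2 F Y a b) (i j : Fin 3) : X i j = Y i j := by
  have h1 : Fᵀ * Matrix.of X * F = Fᵀ * Matrix.of Y * F := by
    ext a b
    rw [← hat2_eq_mul, ← hat2_eq_mul]
    exact h a b
  have h2 : ∀ Z : Mat, Z = (Fᵀ)⁻¹ * (Fᵀ * Z * F) * F⁻¹ := by
    intro Z
    rw [mul_assoc, mul_assoc (Fᵀ * Z), Matrix.mul_nonsing_inv _ hF.isUnit, mul_one, ← mul_assoc,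
      Matrix.nonsing_inv_mul _ (by simpa using hF.isUnit), one_mul]
  have h3 : Matrix.of X = Matrix.of Y := by rw [h2 (Matrix.of X), h2 (Matrix.of Y), h1]
  exact congrFun (congrFun h3 i) j

theorem IsFrame.hat4_injective (hF : IsFrame G F) {R S : Fin 3 → Fin 3 → Fin 3 → Fin 3 → ℝ}
    (h : ∀ a b c d, hat4 F R a b c d = hat4 F S a b c d) (i j k l : Fin 3) :
    R i j k l = S i j k l :=
  hF.hat2_injective (fun c d => hF.hat2_injective (X := fun i j => hat2 F (R i j) c d)
    (Y := fun i j => hat2 F (S i j) c d) (fun a b => h a b c d) i j) k l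

theorem IsFrame.hat2_metric (hF : IsFrame G F) (a b : Fin 3) :
    hat2 F (fun i j => G i j) a b = if a = b then 1 else 0 := by
  rw [hat2_eq_mul F G, hF.transpose_mul, Matrix.one_apply]

/-- Contraction with the inverse metric is contraction over an orthonormal frame. -/
theorem IsFrame.contract (hF : IsFrame G F) (X : Fin 3 → Fin 3 → ℝ) :
    ∑ i, ∑ j, G⁻¹ i j * X i j = ∑ c, hat2 F X c c := by
  have : ∀ i j, G⁻¹ i j = ∑ c, F i c * F j c := by
    intro i j
    rw [← hF.mul_transpose, Matrix.mul_apply]; rfl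
  simp only [this, hat2, Finset.sum_mul]
  calc _ = ∑ i, ∑ c, ∑ j, F i c * F j c * X i j :=
        Finset.sum_congr rfl fun i _ => Finset.sum_comm
    _ = _ := Finset.sum_comm

theorem hat2_hat2_mul (F : Mat) (X Y : Fin 3 → Fin 3 → ℝ) (a b c d : Fin 3) :
    hat2 F (fun i j => hat2 F (fun k l => X i k * Y j l) c d) a b =
      hat2 F X a c * hat2 F Y b d := by
  rw [hat2_hat2_comm]
  simp only [hat2_mul_left, hat2_mul_right]

theorem IsFrame.contract₂ (hF : IsFrame G F) (X Y : Fin 3 → Fin 3 → ℝ) :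
    ∑ j, ∑ j', ∑ k, ∑ k', G⁻¹ j j' * G⁻¹ k k' * (X j k * Y j' k') =
      ∑ d, ∑ e, hat2 F X d e * hat2 F Y d e := by
  have h : ∀ j j', ∑ k, ∑ k', G⁻¹ j j' * G⁻¹ k k' * (X j k * Y j' k') =
      G⁻¹ j j' * ∑ k, ∑ k', G⁻¹ k k' * (X j k * Y j' k') := by
    intro j j'
    simp only [Finset.mul_sum, mul_assoc]
  simp only [h]
  rw [hF.contract]
  simp only [hF.contract, hat2_sum, hat2_hat2_mul]

/-- A four-tensor with the symmetries of a Riemann tensor. -/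
structure IsCurvLike (R : Fin 3 → Fin 3 → Fin 3 → Fin 3 → ℝ) : Prop where
  left : ∀ i j k l, R i j k l = -R j i k l
  right : ∀ i j k l, R i j k l = -R i j l k
  pair : ∀ i j k l, R i j k l = R k l i j

theorem IsCurvLike.hat4 {R : Fin 3 → Fin 3 → Fin 3 → Fin 3 → ℝ} (hR : IsCurvLike R) (F : Mat) :
    IsCurvLike (hat4 F R) where
  left a b c d := by
    rw [HeteroticSoliton.hat4, HeteroticSoliton.hat4, ← hat2_swap, ← hat2_neg]
    congr; ext i j
    rw [← hat2_neg]
    congr; ext k l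
    rw [hR.left j i k l]
  right a b c d := by
    rw [HeteroticSoliton.hat4, HeteroticSoliton.hat4, ← hat2_neg]
    congr; ext i j
    rw [← hat2_swap, ← hat2_neg]
    congr; ext k l
    rw [hR.right i j l k]
  pair a b c d := by
    rw [HeteroticSoliton.hat4, HeteroticSoliton.hat4, hat2_hat2_comm']
    congr; ext i j
    congr; ext k l
    exact hR.pair k l i j

/-- In dimension three the curvature tensor is determined by its Ricci contraction: in an
orthonormal frame, it is the Kulkarni-Nomizu product of the metric and the Schouten tensor. -/
theorem IsCurvLike.eq_ric {R : Fin 3 → Fin 3 → Fin 3 → Fin 3 → ℝ} (hR : IsCurvLike R)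
    {r : Fin 3 → Fin 3 → ℝ} (hr : ∀ b c, r b c = ∑ a, R a b c a) (a b c d : Fin 3) :
    R a b c d =
      (if a = d then 1 else 0) * (r b c - (∑ e, r e e) / 4 * (if b = c then 1 else 0))
      - (if b = d then 1 else 0) * (r a c - (∑ e, r e e) / 4 * (if a = c then 1 else 0))
      + (r a d - (∑ e, r e e) / 4 * (if a = d then 1 else 0)) * (if b = c then 1 else 0)
      - (r b d - (∑ e, r e e) / 4 * (if b = d then 1 else 0)) * (if a = c then 1 else 0) := by
  have z1 : ∀ i k l, R i i k l = 0 := fun i k l => by linarith [hR.left i i k l]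
  have z2 : ∀ i j k, R i j k k = 0 := fun i j k => by linarith [hR.right i j k k]
  have l1 := hR.left 1 0
  have l2 := hR.left 2 0
  have l3 := hR.left 2 1
  have r1 := fun i j => hR.right i j 1 0
  have r2 := fun i j => hR.right i j 2 0
  have r3 := fun i j => hR.right i j 2 1
  have p1 := hR.pair 0 2 0 1
  have p2 := hR.pair 1 2 0 1
  have p3 := hR.pair 1 2 0 2
  simp only [hr, Fin.sum_univ_three]
  fin_cases a <;> fin_cases b <;> fin_cases c <;> fin_cases d <;>
    simp [z1, z2, l1, l2, l3, r1, r2, r3, p1, p2, p3] <;> ring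

/-- In dimension three the square of the curvature is a quadratic expression in the Ricci
tensor. -/
theorem IsCurvLike.sq_eq_ric {R : Fin 3 → Fin 3 → Fin 3 → Fin 3 → ℝ} (hR : IsCurvLike R)
    {r : Fin 3 → Fin 3 → ℝ} (hr : ∀ b c, r b c = ∑ a, R a b c a) (a b : Fin 3) :
    (1 / 2) * ∑ c, ∑ d, ∑ e, R a c d e * R b c d e =
      ((∑ d, ∑ e, r d e * r d e) - (∑ e, r e e) ^ 2 / 2) * (if a = b then 1 else 0)
      + (∑ e, r e e) * r a b - ∑ e, r a e * r e b := by
  have z1 : ∀ i k l, R i i k l = 0 := fun i k l => by linarith [hR.left i i k l]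
  have z2 : ∀ i j k, R i j k k = 0 := fun i j k => by linarith [hR.right i j k k]
  have l1 := hR.left 1 0
  have l2 := hR.left 2 0
  have l3 := hR.left 2 1
  have r1 := fun i j => hR.right i j 1 0
  have r2 := fun i j => hR.right i j 2 0
  have r3 := fun i j => hR.right i j 2 1
  have p1 := hR.pair 0 2 0 1
  have p2 := hR.pair 1 2 0 1
  have p3 := hR.pair 1 2 0 2
  simp only [hr, Fin.sum_univ_three]
  fin_cases a <;> fin_cases b <;>
    simp [z1, z2, l1, l2, l3, r1, r2, r3, p1, p2, p3] <;> ring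

/-- The components of the Ricci contraction in an orthonormal frame. -/
theorem IsFrame.hat2_ric (hF : IsFrame G F) (R : Fin 3 → Fin 3 → Fin 3 → Fin 3 → ℝ)
    (b c : Fin 3) :
    hat2 F (fun j k => ∑ i, ∑ l, G⁻¹ i l * R i j k l) b c = ∑ a, hat4 F R a b c a := by
  simp only [hF.contract, hat2_sum]
  refine Finset.sum_congr rfl fun a _ => ?_
  rw [hat2_hat2_comm', hat4]
  simp only [← hat2_swap F (R _ _) a c]
  rw [hat2_hat2_comm]

variable {U : Set E3} {x : E3} {G : E3 → Mat}

theorem IsMetricOn.isCurvLike (hG : IsMetricOn U G) (hx : x ∈ U) :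
    IsCurvLike (fun i j k l => riem G i j k l x) :=
  ⟨fun i j k l => riem_antisymm_left i j k l, hG.riem_antisymm_right hx, hG.riem_pair_symm hx⟩

/-- The scalar curvature. -/
def scal (G : E3 → Mat) (x : E3) : ℝ := ∑ a, ∑ b, (G x)⁻¹ a b * ric G a b x

/-- The Ricci tensor as a matrix. -/
def ricM (G : E3 → Mat) (x : E3) : Mat := fun a b => ric G a b x

theorem hat2_riemSq (hF : IsFrame (G x) F) (a b : Fin 3) :
    hat2 F (fun a b => riemSq G a b x) a b = (1 / 2) * ∑ c, ∑ d, ∑ e,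
      hat4 F (fun i j k l => riem G i j k l x) a c d e *
      hat4 F (fun i j k l => riem G i j k l x) b c d e := by
  have h1 : ∀ a b, riemSq G a b x = (1 / 2) * ∑ c, ∑ d, ∑ e, hat2 F (fun i i' =>
      hat2 F (fun j k => riem G a i j k x) d e * hat2 F (fun j k => riem G b i' j k x) d e) c c := by
    intro a b
    rw [riemSq]
    congr 1
    have h2 : ∀ i, (∑ j, ∑ k, ∑ i', ∑ j', ∑ k', ginv G x i i' * ginv G x j j' * ginv G x k k' *
        riem G a i j k x * riem G b i' j' k' x) = ∑ i', (G x)⁻¹ i i' *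
          ∑ d, ∑ e, hat2 F (fun j k => riem G a i j k x) d e *
            hat2 F (fun j k => riem G b i' j k x) d e := by
      intro i
      simp only [← hF.contract₂, Finset.mul_sum, ginv]
      calc _ = ∑ j, ∑ i', ∑ k, ∑ j', ∑ k', (G x)⁻¹ i i' * (G x)⁻¹ j j' * (G x)⁻¹ k k' *
            riem G a i j k x * riem G b i' j' k' x :=
            Finset.sum_congr rfl fun j _ => Finset.sum_comm
        _ = ∑ i', ∑ j, ∑ k, ∑ j', ∑ k', (G x)⁻¹ i i' * (G x)⁻¹ j j' * (G x)⁻¹ k k' *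
            riem G a i j k x * riem G b i' j' k' x := Finset.sum_comm
        _ = _ := by
          refine Finset.sum_congr rfl fun i' _ => Finset.sum_congr rfl fun j _ => ?_
          rw [Finset.sum_comm]
          exact Finset.sum_congr rfl fun j' _ => Finset.sum_congr rfl fun k _ =>
            Finset.sum_congr rfl fun k' _ => by ring
    simp only [h2]
    rw [hF.contract]
    simp only [hat2_sum]
  simp only [h1, hat2_mul_left, hat2_sum, hat2_hat2_mul]
  rfl

/-- The Schouten tensor `Ric - (s / 4) g` of a three-dimensional metric. -/
def schouten (G : E3 → Mat) (x : E3) : Mat := ricM G x - (scal G x / 4) • G x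

theorem hat2_ricM (hF : IsFrame (G x) F) (b c : Fin 3) :
    hat2 F (fun i j => ric G i j x) b c = ∑ a, hat4 F (fun i j k l => riem G i j k l x) a b c a :=
  hF.hat2_ric (fun i j k l => riem G i j k l x) b c

theorem scal_eq (hF : IsFrame (G x) F) : scal G x = ∑ a, hat2 F (fun i j => ric G i j x) a a :=
  hF.contract (fun i j => ric G i j x)

theorem hat2_schouten (hF : IsFrame (G x) F) (a b : Fin 3) : hat2 F (fun i j => schouten G x i j) a b =
    hat2 F (fun i j => ric G i j x) a b - (∑ e, hat2 F (fun i j => ric G i j x) e e) / 4 * (if a = b then 1 else 0) := by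
  rw [← scal_eq hF, ← hF.hat2_metric, ← hat2_mul_left F _ (fun i j => G x i j), ← hat2_sub]
  rfl

/-- In dimension three the Riemann tensor is the Kulkarni-Nomizu product of the metric and the
Schouten tensor. -/
theorem IsMetricOn.riem_eq_schouten (hG : IsMetricOn U G) (hx : x ∈ U) (i j k l : Fin 3) :
    riem G i j k l x = G x i l * schouten G x j k - schouten G x i k * G x j l
      + schouten G x i l * G x j k - G x i k * schouten G x j l := by
  obtain ⟨F, hF⟩ := exists_isFrame (hG.posDef x hx)
  obtain ⟨g, hg⟩ : ∃ g : Fin 3 → Fin 3 → ℝ, ∀ i j, G x i j = g i j := ⟨_, fun _ _ => rfl⟩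
  obtain ⟨p, hp⟩ : ∃ p : Fin 3 → Fin 3 → ℝ, ∀ i j, schouten G x i j = p i j :=
    ⟨_, fun _ _ => rfl⟩
  have hg' := hF.hat2_metric
  have hp' := hat2_schouten hF
  simp only [hg, hp] at hg' hp' ⊢
  have comm' : ∀ (X Y : Fin 3 → Fin 3 → ℝ) (a b c d : Fin 3),
      hat2 F (fun i j => hat2 F (fun k l => X i l * Y j k) c d) a b =
      hat2 F X a d * hat2 F Y b c := by
    intro X Y a b c d
    simp only [hat2_swap F (fun l k => X _ l * Y _ k), hat2_hat2_mul]
  refine hF.hat4_injective (R := fun i j k l => riem G i j k l x) (S := fun i j k l =>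
    g i l * p j k - p i k * g j l + p i l * g j k - g i k * p j l) (fun a b c d => ?_) i j k l
  rw [((hG.isCurvLike hx).hat4 F).eq_ric (hat2_ricM hF)]
  rw [hat4]
  simp only [hat2_sub, hat2_add, comm', hat2_hat2_mul, hg', hp']
  ring

/-- The squared norm of the Ricci tensor. -/
def ricSq (G : E3 → Mat) (x : E3) : ℝ :=
  ∑ a, ∑ b, (G x)⁻¹ a b * (ricM G x * (G x)⁻¹ * ricM G x) a b

theorem hat2_ric_mul_ric (hF : IsFrame (G x) F) (a b : Fin 3) :
    hat2 F (fun i j => (ricM G x * (G x)⁻¹ * ricM G x) i j) a b =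
      ∑ e, hat2 F (fun i j => ric G i j x) a e * hat2 F (fun i j => ric G i j x) e b := by
  have h : ∀ a b, hat2 F (fun i j => ric G i j x) a b = (Fᵀ * ricM G x * F) a b :=
    hat2_eq_mul F (ricM G x)
  simp only [h]
  rw [hat2_eq_mul F (ricM G x * (G x)⁻¹ * ricM G x), ← hF.mul_transpose, ← Matrix.mul_apply]
  simp only [mul_assoc]

theorem IsMetricOn.hat2_ricM_symm (hG : IsMetricOn U G) (hx : x ∈ U) (hF : IsFrame (G x) F)
    (a b : Fin 3) : hat2 F (fun i j => ric G i j x) a b = hat2 F (fun i j => ric G i j x) b a := by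
  have h := (hG.isCurvLike hx).hat4 F
  rw [hat2_ricM hF, hat2_ricM hF]
  exact Finset.sum_congr rfl fun e _ => by
    rw [h.pair, h.left, h.right, neg_neg]

theorem IsMetricOn.ric_symm (hG : IsMetricOn U G) (hx : x ∈ U) (a b : Fin 3) :
    ric G a b x = ric G b a x := by
  obtain ⟨F, hF⟩ := exists_isFrame (hG.posDef x hx)
  refine hF.hat2_injective (X := fun a b => ric G a b x) (Y := fun a b => ric G b a x)
    (fun c d => ?_) a b
  rw [hat2_swap F (fun a b => ric G a b x), hG.hat2_ricM_symm hx hF]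

/-- `R ∘ R` in terms of the Ricci tensor. -/
theorem IsMetricOn.riemSq_eq (hG : IsMetricOn U G) (hx : x ∈ U) (a b : Fin 3) :
    riemSq G a b x = (ricSq G x - scal G x ^ 2 / 2) * G x a b + scal G x * ric G a b x
      - (ricM G x * (G x)⁻¹ * ricM G x) a b := by
  obtain ⟨F, hF⟩ := exists_isFrame (hG.posDef x hx)
  refine hF.hat2_injective (X := fun a b => riemSq G a b x) (Y := fun a b =>
    (ricSq G x - scal G x ^ 2 / 2) * G x a b + scal G x * ric G a b x
      - (ricM G x * (G x)⁻¹ * ricM G x) a b) (fun c d => ?_) a b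
  have hsq : ricSq G x = ∑ e, hat2 F (fun i j => (ricM G x * (G x)⁻¹ * ricM G x) i j) e e :=
    hF.contract (fun i j => (ricM G x * (G x)⁻¹ * ricM G x) i j)
  have hg := hF.hat2_metric c d
  have hrr := hat2_ric_mul_ric hF
  obtain ⟨g, hg'⟩ : ∃ g : Fin 3 → Fin 3 → ℝ, ∀ i j, G x i j = g i j := ⟨_, fun _ _ => rfl⟩
  obtain ⟨q, hq⟩ : ∃ q : Fin 3 → Fin 3 → ℝ,
    ∀ i j, (ricM G x * (G x)⁻¹ * ricM G x) i j = q i j := ⟨_, fun _ _ => rfl⟩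
  rw [hat2_riemSq hF, ((hG.isCurvLike hx).hat4 F).sq_eq_ric (hat2_ricM hF)]
  simp only [hg', hq] at hsq hg hrr ⊢
  simp only [hat2_sub, hat2_add, hat2_mul_left, hg, hsq, hrr, scal_eq hF]
  congr 4
  exact Finset.sum_congr rfl fun e _ => Finset.sum_congr rfl fun e' _ => by
    rw [hG.hat2_ricM_symm hx hF e' e]

theorem riemNormSq_eq_contract (G : E3 → Mat) (x : E3) :
    riemNormSq G x = (1 / 2) * ∑ a, ∑ b, (G x)⁻¹ a b * riemSq G a b x := by
  simp only [riemNormSq, riemSq, Finset.mul_sum]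
  refine Finset.sum_congr rfl fun i _ => ?_
  calc _ = ∑ j, ∑ k, ∑ i', ∑ l, ∑ j', ∑ k', ∑ l', _ :=
        Finset.sum_congr rfl fun j _ => Finset.sum_congr rfl fun k _ => Finset.sum_comm
    _ = ∑ j, ∑ i', ∑ k, ∑ l, ∑ j', ∑ k', ∑ l', _ :=
        Finset.sum_congr rfl fun j _ => Finset.sum_comm
    _ = ∑ i', ∑ j, ∑ k, ∑ l, ∑ j', ∑ k', ∑ l', _ := Finset.sum_comm
    _ = _ := by
      refine Finset.sum_congr rfl fun i' _ => Finset.sum_congr rfl fun j _ =>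
        Finset.sum_congr rfl fun k _ => Finset.sum_congr rfl fun l _ =>
        Finset.sum_congr rfl fun j' _ => Finset.sum_congr rfl fun k' _ =>
        Finset.sum_congr rfl fun l' _ => ?_
      simp only [ginv]
      ring

/-- `|R|²` in terms of the Ricci tensor. -/
theorem IsMetricOn.riemNormSq_eq (hG : IsMetricOn U G) (hx : x ∈ U) :
    riemNormSq G x = ricSq G x - scal G x ^ 2 / 4 := by
  obtain ⟨F, hF⟩ := exists_isFrame (hG.posDef x hx)
  have h3 : ∑ a, ∑ b, (G x)⁻¹ a b * G x a b = 3 := by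
    rw [hF.contract (fun a b => G x a b)]; simp [hF.hat2_metric]
  rw [riemNormSq_eq_contract]
  have h : ∀ a b, (G x)⁻¹ a b * riemSq G a b x = (ricSq G x - scal G x ^ 2 / 2) *
      ((G x)⁻¹ a b * G x a b) + scal G x * ((G x)⁻¹ a b * ric G a b x) -
      (G x)⁻¹ a b * (ricM G x * (G x)⁻¹ * ricM G x) a b := by
    intro a b
    rw [hG.riemSq_eq hx]; ring
  simp only [h, Finset.sum_sub_distrib, Finset.sum_add_distrib, ← Finset.mul_sum, h3]
  rw [← ricSq, ← scal]
  ring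

theorem IsMetricOn.riemNormSq_nonneg (hG : IsMetricOn U G) (hx : x ∈ U) :
    0 ≤ riemNormSq G x := by
  obtain ⟨F, hF⟩ := exists_isFrame (hG.posDef x hx)
  rw [riemNormSq_eq_contract, hF.contract (fun a b => riemSq G a b x)]
  simp only [hat2_riemSq hF]
  refine mul_nonneg (by norm_num) (Finset.sum_nonneg fun a _ => mul_nonneg (by norm_num) ?_)
  exact Finset.sum_nonneg fun c _ => Finset.sum_nonneg fun d _ => Finset.sum_nonneg fun e _ =>
    mul_self_nonneg _

end HeteroticSoliton

end

noncomputable section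

namespace HeteroticSoliton

open scoped Topology Matrix

/-! ### Leibniz rules for covariant derivatives -/

variable {U : Set E3} {x : E3} {G A B : E3 → Mat}

theorem covM_transpose (G A : E3 → Mat) (m : Fin 3) (x : E3) :
    covM G (fun y => (A y)ᵀ) m x = (covM G A m x)ᵀ := by
  simp only [covM, dM_transpose, Matrix.transpose_sub, Matrix.transpose_mul,
    Matrix.transpose_transpose]
  abel

theorem covM_symm (hU : IsOpen U) (hx : x ∈ U) (hA : ∀ y ∈ U, (A y)ᵀ = A y) (m i j : Fin 3) :
    covM G A m x i j = covM G A m x j i := by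
  have h : covM G A m x = (covM G A m x)ᵀ := by
    rw [← covM_transpose, covM, covM, dM_congr hU hx hA, hA x hx]
  conv_lhs => rw [h]
  rfl

theorem covM_congr (hU : IsOpen U) (hx : x ∈ U) (h : ∀ y ∈ U, A y = B y) (m : Fin 3) :
    covM G A m x = covM G B m x := by
  rw [covM, covM, dM_congr hU hx h, h x hx]

theorem covM_add (hA : SmM U A) (hB : SmM U B) (hx : x ∈ U) (m : Fin 3) :
    covM G (fun y => A y + B y) m x = covM G A m x + covM G B m x := by
  simp only [covM, dM_add hA hB hx]
  noncomm_ring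

theorem covM_smul {f : E3 → ℝ} (hf : Sm U f) (hA : SmM U A) (hx : x ∈ U) (m : Fin 3) :
    covM G (fun y => f y • A y) m x = pd m f x • A x + f x • covM G A m x := by
  simp only [covM, dM_smul hf hA hx, smul_sub, Matrix.mul_smul, Matrix.smul_mul]
  abel

theorem covM_const_smul (c : ℝ) (hA : SmM U A) (hx : x ∈ U) (m : Fin 3) :
    covM G (fun y => c • A y) m x = c • covM G A m x := by
  rw [covM_smul (Sm.const U c) hA hx]; simp

namespace IsMetricOn

variable (hG : IsMetricOn U G)
include hG

theorem covM_mul_inv_mul (hA : SmM U A) (hB : SmM U B) (hx : x ∈ U) (m : Fin 3) :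
    covM G (fun y => A y * (G y)⁻¹ * B y) m x =
      covM G A m x * (G x)⁻¹ * B x + A x * (G x)⁻¹ * covM G B m x := by
  rw [covM, dM_mul (hA.mul hG.smooth_inv) hB hx, dM_mul hA hG.smooth_inv hx, hG.dM_inv hx]
  simp only [covM]
  noncomm_ring

/-- Contraction with the metric commutes with covariant derivatives. -/
theorem trace_covM (hA : SmM U A) (hx : x ∈ U) (m : Fin 3) :
    ((G x)⁻¹ * covM G A m x).trace = pd m (fun y => ((G y)⁻¹ * A y).trace) x := by
  rw [pd_trace (hG.smooth_inv.mul hA) hx, dM_mul hG.smooth_inv hA hx, hG.dM_inv hx, covM]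
  simp only [mul_sub, sub_mul, Matrix.trace_sub, Matrix.trace_add, neg_mul,
    Matrix.trace_neg]
  rw [mul_assoc (chrM G m x)ᵀ, Matrix.trace_mul_comm (chrM G m x)ᵀ]
  simp only [mul_assoc]
  ring

theorem smooth_ricM : SmM U (ricM G) := fun a b =>
  (Sm.sum (s := Finset.univ) fun i _ => hG.smooth_curvM i a b i).congr hG.isOpen
    fun _ hy => ric_eq hG hy a b

omit hG in
theorem _root_.HeteroticSoliton.contract_eq_trace (N X : Mat) (hN : Nᵀ = N) :
    ∑ a, ∑ b, N a b * X a b = (N * X).trace := by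
  simp only [Matrix.trace, Matrix.diag, Matrix.mul_apply]
  rw [Finset.sum_comm]
  refine Finset.sum_congr rfl fun a _ => Finset.sum_congr rfl fun b _ => ?_
  conv_lhs => rw [← hN]
  rfl

theorem scal_eq_trace (hx : x ∈ U) : scal G x = ((G x)⁻¹ * ricM G x).trace :=
  contract_eq_trace _ (ricM G x) (hG.inv_transpose hx)

theorem smooth_scal : Sm U (scal G) :=
  ((hG.smooth_inv.mul hG.smooth_ricM).trace).congr hG.isOpen fun _ hy => hG.scal_eq_trace hy

theorem smooth_schouten : SmM U (schouten G) :=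
  hG.smooth_ricM.sub (SmM.smul ((hG.smooth_scal.mul (Sm.const U (4⁻¹))).congr hG.isOpen
    fun _ _ => div_eq_mul_inv _ _) hG.smooth)

theorem pd_metric (hx : x ∈ U) (m i j : Fin 3) : pd m (fun y => G y i j) x =
    ∑ p, (chr G m i p x * G x p j + chr G m j p x * G x i p) := by
  have h := congrFun (congrFun (hG.dM_metric hx m) i) j
  rw [Finset.sum_add_distrib]
  refine h.trans ?_
  simp only [Matrix.add_apply, Matrix.mul_apply, chrM, Matrix.transpose_apply]
  congr 1
  exact Finset.sum_congr rfl fun p _ => mul_comm _ _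

theorem covRiem_eq (hx : x ∈ U) (m i j k l : Fin 3) :
    covRiem G m i j k l x = G x i l * covM G (schouten G) m x j k
      - covM G (schouten G) m x i k * G x j l + covM G (schouten G) m x i l * G x j k
      - G x i k * covM G (schouten G) m x j l := by
  have s := fun i j => hG.smooth i j
  have t := fun i j => hG.smooth_schouten i j
  have hpd : pd m (riem G i j k l) x = pd m (fun y => G y i l * schouten G y j k
      - schouten G y i k * G y j l + schouten G y i l * G y j k
      - G y i k * schouten G y j l) x :=
    pd_congr hG.isOpen hx (fun y hy => hG.riem_eq_schouten hy i j k l) m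
  rw [pd_sub ((((s i l).mul (t j k)).sub ((t i k).mul (s j l))).add ((t i l).mul (s j k)))
    ((s i k).mul (t j l)) hx, pd_add (((s i l).mul (t j k)).sub ((t i k).mul (s j l)))
    ((t i l).mul (s j k)) hx, pd_sub ((s i l).mul (t j k)) ((t i k).mul (s j l)) hx,
    pd_mul (s i l) (t j k) hx, pd_mul (t i k) (s j l) hx, pd_mul (t i l) (s j k) hx,
    pd_mul (s i k) (t j l) hx] at hpd
  rw [covRiem, hpd]
  simp only [hG.riem_eq_schouten hx, hG.pd_metric hx, ← covBilin_eq, covBilin,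
    Fin.sum_univ_three]
  ring

theorem contract_metric (hx : x ∈ U) (X : Fin 3 → ℝ) (l : Fin 3) :
    ∑ m, ∑ i, (G x)⁻¹ m i * (G x i l * X m) = X l := by
  have : ∀ m, ∑ i, (G x)⁻¹ m i * (G x i l * X m) = (1 : Mat) m l * X m := by
    intro m
    rw [← hG.inv_mul hx, Matrix.mul_apply, Finset.sum_mul]
    exact Finset.sum_congr rfl fun i _ => by ring
  simp [this, Matrix.one_apply]

/-- The divergence of the Riemann tensor in terms of the Schouten tensor. -/
theorem codiffRiem_eq (hx : x ∈ U) (j k l : Fin 3) :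
    codiffRiem G j k l x = -(covM G (schouten G) l x j k
      - (∑ m, ∑ i, (G x)⁻¹ m i * covM G (schouten G) m x i k) * G x j l
      + (∑ m, ∑ i, (G x)⁻¹ m i * covM G (schouten G) m x i l) * G x j k
      - covM G (schouten G) k x j l) := by
  rw [codiffRiem]
  congr 1
  have h1 := hG.contract_metric hx (fun m => covM G (schouten G) m x j k) l
  have h2 := hG.contract_metric hx (fun m => covM G (schouten G) m x j l) k
  rw [← h1, ← h2, Finset.sum_mul, Finset.sum_mul, ← Finset.sum_sub_distrib,
    ← Finset.sum_add_distrib, ← Finset.sum_sub_distrib]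
  refine Finset.sum_congr rfl fun m _ => ?_
  rw [Finset.sum_mul, Finset.sum_mul, ← Finset.sum_sub_distrib,
    ← Finset.sum_add_distrib, ← Finset.sum_sub_distrib]
  refine Finset.sum_congr rfl fun i _ => ?_
  rw [hG.covRiem_eq hx, ginv]
  ring

end IsMetricOn

end HeteroticSoliton

end

noncomputable section

namespace HeteroticSoliton

open scoped Topology Matrix

/-! ### Solitons with constant dilaton are hyperbolic -/

variable {U : Set E3} {x : E3} {G : E3 → Mat} {κ c : ℝ}

/-- The soliton equations on `U` for the metric `G` and the constant dilaton `c`. -/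
structure IsConstSoliton (U : Set E3) (G : E3 → Mat) (κ c : ℝ) : Prop where
  einstein : ∀ x ∈ U, ∀ a b, einsteinOp κ G (fun _ => c) a b x = 0
  yangMills : ∀ x ∈ U, ∀ j k l, yangMillsOp G (fun _ => c) j k l x = 0
  dilaton : ∀ x ∈ U, dilatonOp κ G (fun _ => c) x = 0

@[simp] theorem hess_const (G : E3 → Mat) (c : ℝ) (a b : Fin 3) (x : E3) :
    hess G (fun _ => c) a b x = 0 := by
  have : pd b (fun _ : E3 => c) = fun _ => 0 := by ext; simp
  simp [hess, this]

/-- The Einstein tensor of a metric of scalar curvature `-Λ / 2`. Its eigenvalues are the sectional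
curvatures of the planes orthogonal to the eigenvectors. -/
def einsteinTensor (Λ : ℝ) (G : E3 → Mat) (x : E3) : Mat := (-(Λ / 4)) • G x - ricM G x

/-- The cubic matrix identity of Cayley and Hamilton. -/
theorem cayley_hamilton_three (W : Mat) : W * W * W - W.trace • (W * W)
    + ((W.trace ^ 2 - (W * W).trace) / 2) • W - W.det • (1 : Mat) = 0 := by
  ext i j
  simp only [Matrix.sub_apply, Matrix.add_apply, Matrix.smul_apply, Matrix.mul_apply,
    Matrix.trace, Matrix.diag, Fin.sum_univ_three, Matrix.det_fin_three, smul_eq_mul,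
    Matrix.zero_apply]
  fin_cases i <;> fin_cases j <;> simp <;> ring

/-- A symmetric three-tensor on which `S` anticommutes between any two slots is annihilated
by `S`: applying `S` in the last slot gives a tensor that is symmetric in the first two
indices and skew in the last two. -/
theorem mul_eq_zero_of_anticommute {T : Fin 3 → Mat} {S : Mat} (h1 : ∀ m i j, T m i j = T i m j)
    (h2 : ∀ m i j, T m i j = T m j i) (h : ∀ m, T m * S = -(Sᵀ * T m)) (m : Fin 3) :
    T m * S = 0 := by
  have hs : ∀ m i j, (T m * S) i j = (T i * S) m j := by
    intro m i j
    simp only [Matrix.mul_apply, h1 m i]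
  have ha : ∀ m i j, (T m * S) i j = -(T m * S) j i := by
    intro m i j
    have h' := congrFun (congrFun (h m) i) j
    rw [h', Matrix.neg_apply]
    congr 1
    simp only [Matrix.mul_apply, Matrix.transpose_apply]
    exact Finset.sum_congr rfl fun p _ => by rw [h2 m p j, mul_comm]
  ext i j
  rw [Matrix.zero_apply]
  linarith [hs m i j, ha m i j, hs m j i, ha m j i, ha i m j, hs i j m, ha j m i, hs j i m,
    hs i m j, ha j i m]

namespace IsMetricOn

variable (hG : IsMetricOn U G)
include hG

theorem trace_metric (hx : x ∈ U) : ((G x)⁻¹ * G x).trace = 3 := by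
  rw [hG.inv_mul hx]; simp

theorem ricM_symm (hx : x ∈ U) : (ricM G x)ᵀ = ricM G x := by
  ext a b; exact hG.ric_symm hx b a

theorem smooth_einsteinTensor (Λ : ℝ) : SmM U (einsteinTensor Λ G) :=
  (SmM.smul (Sm.const U _) hG.smooth).sub hG.smooth_ricM

theorem einsteinTensor_symm (Λ : ℝ) (hx : x ∈ U) :
    (einsteinTensor Λ G x)ᵀ = einsteinTensor Λ G x := by
  simp [einsteinTensor, hG.transpose_eq hx, hG.ricM_symm hx]

end IsMetricOn

namespace IsConstSoliton

variable (hG : IsMetricOn U G) (hS : IsConstSoliton U G κ c)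
include hS

theorem riemNormSq_eq (hx : x ∈ U) : κ * riemNormSq G x = Real.exp (2 * c) := by
  have h := hS.dilaton x hx
  simp [dilatonOp, codiffGrad, gradNormSq] at h
  linarith

theorem ric_equation (hx : x ∈ U) (a b : Fin 3) :
    ric G a b x - (1 / 2) * Real.exp (2 * c) * G x a b + κ * riemSq G a b x = 0 := by
  have h := hS.einstein x hx a b
  simpa [einsteinOp] using h

include hG

theorem kappa_pos (hx : x ∈ U) : 0 < κ := by
  have h := hS.riemNormSq_eq hx
  have h0 := hG.riemNormSq_nonneg hx
  by_contra hk
  have := mul_nonpos_of_nonpos_of_nonneg (not_lt.1 hk) h0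
  linarith [Real.exp_pos (2 * c)]

theorem scal_eq (hx : x ∈ U) : scal G x = -(Real.exp (2 * c) / 2) := by
  have h3 : ∑ a, ∑ b, (G x)⁻¹ a b * G x a b = 3 := by
    rw [contract_eq_trace _ _ (hG.inv_transpose hx), hG.trace_metric hx]
  have h : ∑ a, ∑ b, (G x)⁻¹ a b * (ric G a b x - (1 / 2) * Real.exp (2 * c) * G x a b
      + κ * riemSq G a b x) = 0 := by
    simp only [hS.ric_equation hx, mul_zero, Finset.sum_const_zero]
  have e : ∀ a b, (G x)⁻¹ a b * (ric G a b x - (1 / 2) * Real.exp (2 * c) * G x a b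
      + κ * riemSq G a b x) = (G x)⁻¹ a b * ric G a b x
      - (1 / 2) * Real.exp (2 * c) * ((G x)⁻¹ a b * G x a b)
      + κ * ((G x)⁻¹ a b * riemSq G a b x) := by intro a b; ring
  simp only [e, Finset.sum_add_distrib, Finset.sum_sub_distrib, ← Finset.mul_sum, h3] at h
  have h2 := hS.riemNormSq_eq hx
  rw [riemNormSq_eq_contract] at h2
  rw [scal]
  linarith

/-- The Einstein equation is a quadratic equation for the Einstein tensor. -/
theorem quadratic (hx : x ∈ U) :
    κ • (einsteinTensor (Real.exp (2 * c)) G x * (G x)⁻¹ * einsteinTensor (Real.exp (2 * c)) G x)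
      + einsteinTensor (Real.exp (2 * c)) G x = (Real.exp (2 * c) / 4) • G x := by
  have e1 : einsteinTensor (Real.exp (2 * c)) G x * (G x)⁻¹ *
      einsteinTensor (Real.exp (2 * c)) G x = ((Real.exp (2 * c) / 4) ^ 2) • G x
      + (Real.exp (2 * c) / 2) • ricM G x + ricM G x * (G x)⁻¹ * ricM G x := by
    simp only [einsteinTensor, sub_mul, mul_sub, Matrix.smul_mul, Matrix.mul_smul, hG.mul_inv hx,
      one_mul, mul_assoc, hG.inv_mul hx, mul_one]
    module
  rw [e1]
  ext a b
  have h1 := hS.ric_equation hx a b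
  rw [hG.riemSq_eq hx] at h1
  have h2 := hS.riemNormSq_eq hx
  rw [hG.riemNormSq_eq hx] at h2
  rw [hS.scal_eq hG hx] at h1 h2
  simp only [Matrix.add_apply, Matrix.smul_apply, smul_eq_mul, einsteinTensor, Matrix.sub_apply,
    ricM] at h1 ⊢
  linear_combination (-1) * h1 + G x a b * h2

theorem trace_einsteinTensor (hx : x ∈ U) :
    ((G x)⁻¹ * einsteinTensor (Real.exp (2 * c)) G x).trace = -(Real.exp (2 * c) / 4) := by
  rw [einsteinTensor, mul_sub, Matrix.trace_sub, ← hG.scal_eq_trace hx, Matrix.mul_smul,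
    Matrix.trace_smul, hG.trace_metric hx, hS.scal_eq hG hx, smul_eq_mul]
  ring

theorem schouten_eq (hx : x ∈ U) : schouten G x =
    (-(Real.exp (2 * c) / 8)) • G x + (-1 : ℝ) • einsteinTensor (Real.exp (2 * c)) G x := by
  rw [schouten, hS.scal_eq hG hx, einsteinTensor]
  module

theorem covM_schouten (hx : x ∈ U) (m : Fin 3) : covM G (schouten G) m x =
    -covM G (einsteinTensor (Real.exp (2 * c)) G) m x := by
  have hE := hG.smooth_einsteinTensor (Real.exp (2 * c))
  rw [covM_congr hG.isOpen hx (fun y hy => hS.schouten_eq hG hy),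
    covM_add (SmM.smul (Sm.const U _) hG.smooth) (SmM.smul (Sm.const U _) hE) hx,
    covM_const_smul _ hG.smooth hx, covM_const_smul _ hE hx, hG.covM_metric hx]
  simp

/-- By the Yang-Mills equation, the Einstein tensor is a Codazzi tensor. -/
theorem codazzi (hx : x ∈ U) (l k j : Fin 3) :
    covM G (einsteinTensor (Real.exp (2 * c)) G) l x k j =
      covM G (einsteinTensor (Real.exp (2 * c)) G) k x l j := by
  set T := fun m => covM G (einsteinTensor (Real.exp (2 * c)) G) m x with hT
  have hsymm : ∀ m i j, T m i j = T m j i := fun m i j =>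
    covM_symm hG.isOpen hx (fun y hy => hG.einsteinTensor_symm _ hy) m i j
  set d := fun k => ∑ m, ∑ i, (G x)⁻¹ m i * T m i k with hd
  have h1 : ∀ j k l, T l j k - d k * G x j l + d l * G x j k - T k j l = 0 := by
    intro j k l
    have h := hS.yangMills x hx j k l
    simp only [yangMillsOp, riemGrad, pd_const, mul_zero, zero_mul, Finset.sum_const_zero,
      add_zero] at h
    rw [hG.codiffRiem_eq hx] at h
    simp only [hS.covM_schouten hG hx, Matrix.neg_apply, mul_neg, Finset.sum_neg_distrib] at h
    simp only [hT, hd]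
    linarith
  have htr : ∀ l, ∑ j, ∑ k, (G x)⁻¹ j k * T l j k = 0 := by
    intro l
    rw [contract_eq_trace _ _ (hG.inv_transpose hx), hT,
      hG.trace_covM (hG.smooth_einsteinTensor _) hx,
      pd_congr hG.isOpen hx (fun y hy => hS.trace_einsteinTensor hG hy)]
    simp
  have hd0 : ∀ l, d l = 0 := by
    intro l
    have h2 : ∑ j, ∑ k, (G x)⁻¹ j k * (T l j k - d k * G x j l + d l * G x j k - T k j l) = 0 := by
      simp [h1]
    have e : ∀ j k, (G x)⁻¹ j k * (T l j k - d k * G x j l + d l * G x j k - T k j l) =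
      (G x)⁻¹ j k * T l j k - (G x)⁻¹ k j * (G x j l * d k) + d l * ((G x)⁻¹ j k * G x j k)
        - (G x)⁻¹ k j * T k j l := by
      intro j k
      rw [hG.inv_symm hx k j]; ring
    simp only [e, Finset.sum_add_distrib, Finset.sum_sub_distrib, ← Finset.mul_sum] at h2
    rw [htr, contract_eq_trace _ _ (hG.inv_transpose hx), hG.trace_metric hx,
      Finset.sum_comm, hG.contract_metric hx] at h2
    have h3 : ∑ j, ∑ k, (G x)⁻¹ k j * T k j l = d l := by rw [Finset.sum_comm]
    rw [h3] at h2
    linarith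
  have h := h1 j k l
  rw [hd0, hd0] at h
  change T l k j = T k l j
  rw [hsymm l k j, hsymm k l j]
  linarith

/-- The Einstein tensor is parallel. -/
theorem parallel (hx : x ∈ U) (m : Fin 3) :
    covM G (einsteinTensor (Real.exp (2 * c)) G) m x = 0 := by
  set E := einsteinTensor (Real.exp (2 * c)) G with hE
  have hEs : SmM U E := hG.smooth_einsteinTensor _
  have hEt : (E x)ᵀ = E x := hG.einsteinTensor_symm _ hx
  -- `S` is the derivative of the quadratic polynomial satisfied by the Einstein tensor
  set S : Mat := (2 * κ) • ((G x)⁻¹ * E x) + 1 with hSdef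
  have hSt : Sᵀ = (2 * κ) • (E x * (G x)⁻¹) + 1 := by
    simp [hSdef, Matrix.transpose_mul, hEt, hG.inv_transpose hx]
  have hder : ∀ m, κ • (covM G E m x * (G x)⁻¹ * E x + E x * (G x)⁻¹ * covM G E m x)
      + covM G E m x = 0 := by
    intro m
    have h := covM_congr (G := G) hG.isOpen hx (fun y hy => hS.quadratic hG hy) m
    rw [covM_add (A := fun y => κ • (E y * (G y)⁻¹ * E y))
      (SmM.smul (Sm.const U _) ((hEs.mul hG.smooth_inv).mul hEs)) hEs hx,
      covM_const_smul _ ((hEs.mul hG.smooth_inv).mul hEs) hx, covM_const_smul _ hG.smooth hx,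
      hG.covM_mul_inv_mul hEs hEs hx, hG.covM_metric hx, smul_zero] at h
    exact h
  have hSS : S * S = (κ * Real.exp (2 * c) + 1) • (1 : Mat) := by
    have h := congrArg (fun X => (4 * κ) • ((G x)⁻¹ * X)) (hS.quadratic hG hx)
    simp only [mul_add, Matrix.mul_smul, hG.inv_mul hx] at h
    have e : S * S = (4 * κ) • (κ • ((G x)⁻¹ * (E x * (G x)⁻¹ * E x)) + (G x)⁻¹ * E x) + 1 := by
      simp only [hSdef, add_mul, mul_add, one_mul, mul_one, Matrix.smul_mul, Matrix.mul_smul,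
        mul_assoc]
      module
    rw [e, h]
    module
  have hTS : covM G E m x * S = 0 := by
    refine mul_eq_zero_of_anticommute (T := fun m => covM G E m x)
      (fun m i j => hS.codazzi hG hx m i j)
      (fun m i j => covM_symm hG.isOpen hx (fun y hy => hG.einsteinTensor_symm _ hy) m i j)
      (fun m => ?_) m
    rw [← sub_eq_zero, sub_neg_eq_add, hSt, hSdef]
    have h2 := congrArg ((2 : ℝ) • ·) (hder m)
    simp only [smul_zero] at h2
    rw [← h2]
    simp only [add_mul, mul_add, one_mul, mul_one, Matrix.smul_mul, Matrix.mul_smul, mul_assoc]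
    module
  have h := congrArg (· * S) hTS
  simp only [mul_assoc, hSS, zero_mul, Matrix.mul_smul, mul_one] at h
  refine (smul_eq_zero.1 h).resolve_left ?_
  have := mul_pos (hS.kappa_pos hG hx) (Real.exp_pos (2 * c))
  linarith

/-- A parallel Einstein tensor commutes with the curvature, which is invertible on bivectors. -/
theorem einsteinTensor_mul_eq (hx : x ∈ U) : (1 / κ - Real.exp (2 * c) / 4) •
    ((3 : ℝ) • einsteinTensor (Real.exp (2 * c)) G x + (Real.exp (2 * c) / 4) • G x) = 0 := by
  have hκ := (hS.kappa_pos hG hx).ne'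
  set Λ := Real.exp (2 * c) with hΛ
  set E := einsteinTensor Λ G with hE
  have hEs : SmM U E := hG.smooth_einsteinTensor _
  have hEt : (E x)ᵀ = E x := hG.einsteinTensor_symm _ hx
  -- the Ricci identity for the parallel tensor `E`
  have hcomm : ∀ i j, curvM G i j x * E x + E x * (curvM G i j x)ᵀ = 0 := by
    intro i j
    have h := hG.ricci_identity hEs hx i j
    have h0 : ∀ m i, cov3 G (covM G E) m i x = 0 := by
      intro m i
      have e : ∀ p, ∀ y ∈ U, covM G E p y = (fun _ => (0 : Mat)) y :=
        fun p y hy => hS.parallel hG hy p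
      have e' : ∀ p, covM G E p x = 0 := fun p => hS.parallel hG hx p
      rw [cov3, dM_congr hG.isOpen hx (e i)]
      simp [e']
    rw [h0, h0] at h
    rw [← neg_eq_zero, neg_add, ← sub_eq_add_neg, ← h, sub_zero]
  have hP := hS.schouten_eq hG hx
  have hEE : E x * ((G x)⁻¹ * E x) = (Λ / 4 / κ) • G x - (1 / κ) • E x := by
    have h := congrArg ((1 / κ) • ·) (hS.quadratic hG hx)
    simp only [smul_add, smul_smul] at h
    rw [one_div, inv_mul_cancel₀ hκ, one_smul, mul_assoc] at h
    rw [eq_sub_iff_add_eq, one_div, h]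
    congr 1
    ring
  have hPE : schouten G x * ((G x)⁻¹ * E x) =
      (1 / κ - Λ / 8) • E x + (-(Λ / 4 / κ)) • G x := by
    rw [hP, add_mul, Matrix.smul_mul, Matrix.smul_mul, ← mul_assoc (G x), hG.mul_inv hx, one_mul,
      hEE]
    module
  have hGE : G x * ((G x)⁻¹ * E x) = E x := by rw [← mul_assoc, hG.mul_inv hx, one_mul]
  have hcE : ∀ i j k l, (curvM G i j x * E x) k l =
      E x i l * schouten G x j k - schouten G x i k * E x j l
      + (schouten G x * ((G x)⁻¹ * E x)) i l * G x j k
      - G x i k * (schouten G x * ((G x)⁻¹ * E x)) j l := by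
    intro i j k l
    have h : curvM G i j x * E x = curvM G i j x * G x * ((G x)⁻¹ * E x) := by
      rw [mul_assoc, hGE]
    rw [h]
    generalize (G x)⁻¹ * E x = Y at hGE ⊢
    rw [← hGE, Matrix.mul_apply]
    simp only [← riem_eq, hG.riem_eq_schouten hx]
    simp only [Matrix.mul_apply (M := G x), Matrix.mul_apply (M := schouten G x), Finset.sum_mul,
      Finset.mul_sum]
    rw [← Finset.sum_sub_distrib, ← Finset.sum_add_distrib, ← Finset.sum_sub_distrib]
    exact Finset.sum_congr rfl fun p _ => by ring
  have hN : ∀ i j k l, (1 / κ - Λ / 4) * (E x i l * G x j k - E x j l * G x i k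
      + E x i k * G x j l - E x j k * G x i l) = 0 := by
    intro i j k l
    have h := congrFun (congrFun (hcomm i j) k) l
    have h' : E x * (curvM G i j x)ᵀ = (curvM G i j x * E x)ᵀ := by
      rw [Matrix.transpose_mul, hEt]
    rw [h', Matrix.add_apply, Matrix.transpose_apply, hcE, hcE, hPE, hP] at h
    simp only [Matrix.add_apply, Matrix.smul_apply, smul_eq_mul, Matrix.zero_apply] at h
    linear_combination h
  have hEsymm : ∀ i j, E x i j = E x j i := fun i j => by
    conv_lhs => rw [← hEt]
    rfl
  have htr : ∑ j, ∑ k, (G x)⁻¹ j k * G x j k = 3 := by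
    rw [contract_eq_trace _ _ (hG.inv_transpose hx), hG.trace_metric hx]
  have htrE : ∑ j, ∑ k, (G x)⁻¹ j k * E x j k = -(Λ / 4) := by
    rw [contract_eq_trace _ _ (hG.inv_transpose hx), hS.trace_einsteinTensor hG hx]
  ext i l
  have h2 : ∑ j, ∑ k, (G x)⁻¹ j k * ((1 / κ - Λ / 4) * (E x i l * G x j k - E x j l * G x i k
      + E x i k * G x j l - E x j k * G x i l)) = 0 := by
    simp only [hN, mul_zero, Finset.sum_const_zero]
  have e : ∀ j k, (G x)⁻¹ j k * ((1 / κ - Λ / 4) * (E x i l * G x j k - E x j l * G x i k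
      + E x i k * G x j l - E x j k * G x i l)) = (1 / κ - Λ / 4) *
      (E x i l * ((G x)⁻¹ j k * G x j k) - (G x)⁻¹ j k * (G x k i * E x j l)
      + (G x)⁻¹ k j * (G x j l * E x i k) - G x i l * ((G x)⁻¹ j k * E x j k)) := by
    intro j k
    rw [hG.inv_symm hx k j, hG.symm hx k i]; ring
  simp only [e, Finset.sum_add_distrib, Finset.sum_sub_distrib, ← Finset.mul_sum] at h2
  rw [htr, htrE, hG.contract_metric hx, Finset.sum_comm (f := fun j k =>
    (G x)⁻¹ k j * (G x j l * E x i k)), hG.contract_metric hx] at h2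
  simp only [Matrix.smul_apply, Matrix.add_apply, smul_eq_mul, Matrix.zero_apply]
  linear_combination h2

/-- With `Λ = e^{2φ}`, this says `κ Λ ≠ 4`. Otherwise the eigenvalues of `g⁻¹ E` would be among
`(Λ / 8) (-1 ± √5)` by the quadratic equation, and no three of these add up to its trace
`-Λ / 4`. -/
theorem kappa_mul_exp_ne (hx : x ∈ U) : 1 / κ - Real.exp (2 * c) / 4 ≠ 0 := by
  intro h0
  have hκ := hS.kappa_pos hG hx
  have hΛ := Real.exp_pos (2 * c)
  have hκΛ : κ * Real.exp (2 * c) = 4 := by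
    field_simp at h0
    linarith
  set Λ := Real.exp (2 * c) with hΛdef
  set W : Mat := (G x)⁻¹ * einsteinTensor Λ G x with hW
  have htr : W.trace = -(Λ / 4) := hS.trace_einsteinTensor hG hx
  have hWW : W * W = (-(Λ / 4)) • W + (Λ ^ 2 / 16) • (1 : Mat) := by
    have h := congrArg (fun X => (Λ / 4) • ((G x)⁻¹ * X)) (hS.quadratic hG hx)
    simp only [mul_add, Matrix.mul_smul, hG.inv_mul hx, smul_add, smul_smul] at h
    have h1 : Λ / 4 * κ = 1 := by linarith
    rw [h1, one_smul, mul_assoc, ← mul_assoc (G x)⁻¹] at h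
    rw [hW]
    rw [eq_sub_of_add_eq h]
    module
  have htr2 : (W * W).trace = Λ ^ 2 / 4 := by
    rw [hWW, Matrix.trace_add, Matrix.trace_smul, Matrix.trace_smul, htr, Matrix.trace_one]
    simp
    ring
  have hch := cayley_hamilton_three W
  rw [htr, htr2, hWW, add_mul, Matrix.smul_mul, Matrix.smul_mul, one_mul, hWW] at hch
  have hch2 : (-(Λ ^ 2 / 32)) • W = W.det • (1 : Mat) := by
    rw [← sub_eq_zero, ← hch]
    module
  have hw : W = (-(32 / Λ ^ 2) * W.det) • (1 : Mat) := by
    rw [mul_smul, ← hch2, smul_smul]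
    have : -(32 / Λ ^ 2) * -(Λ ^ 2 / 32) = 1 := by field_simp
    rw [this, one_smul]
  obtain ⟨w, hw'⟩ : ∃ w : ℝ, W = w • (1 : Mat) := ⟨_, hw⟩
  rw [hw'] at htr hWW
  have e1 : 3 * w = -(Λ / 4) := by
    rw [← htr, Matrix.trace_smul, Matrix.trace_one]; simp; ring
  have e2 := congrFun (congrFun hWW 0) 0
  simp at e2
  nlinarith

end IsConstSoliton

/-- A metric on `U` is hyperbolic if it has constant sectional curvature `-k` with `k > 0`. In
dimension three this is a condition on the Ricci tensor. -/
structure IsHyperbolic (U : Set E3) (G : E3 → Mat) (k : ℝ) : Prop where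
  pos : 0 < k
  ric_eq : ∀ x ∈ U, ∀ a b, ric G a b x = -(2 * k) * G x a b

namespace IsConstSoliton

variable (hG : IsMetricOn U G) (hS : IsConstSoliton U G κ c)
include hS hG

theorem einsteinTensor_eq (hx : x ∈ U) : einsteinTensor (Real.exp (2 * c)) G x =
    (-(Real.exp (2 * c) / 12)) • G x := by
  have h := (smul_eq_zero.1 (hS.einsteinTensor_mul_eq hG hx)).resolve_left
    (hS.kappa_mul_exp_ne hG hx)
  have h' := congrArg ((1 / 3 : ℝ) • ·) h
  simp only [smul_add, smul_smul, smul_zero] at h'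
  rw [← sub_eq_zero, ← h']
  module

theorem kappa_mul_exp (hx : x ∈ U) : κ * Real.exp (2 * c) = 48 := by
  have hE := hS.einsteinTensor_eq hG hx
  have hq := hS.quadratic hG hx
  have h := congrArg (fun X => ((G x)⁻¹ * X).trace) hq
  simp only [hE, Matrix.smul_mul, Matrix.mul_smul, mul_add, hG.mul_inv hx, one_mul,
    Matrix.trace_add, Matrix.trace_smul, hG.trace_metric hx, smul_eq_mul] at h
  have hΛ := Real.exp_pos (2 * c)
  have : Real.exp (2 * c) * (κ * Real.exp (2 * c) - 48) = 0 := by linarith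
  have := (mul_eq_zero.1 this).resolve_left hΛ.ne'
  linarith

theorem isHyperbolic (hne : U.Nonempty) : IsHyperbolic U G (4 / κ) := by
  obtain ⟨x₀, hx₀⟩ := hne
  have hκ := hS.kappa_pos hG hx₀
  refine ⟨by positivity, fun x hx a b => ?_⟩
  have h := congrFun (congrFun (hS.einsteinTensor_eq hG hx) a) b
  have hk := hS.kappa_mul_exp hG hx
  have hΛ : Real.exp (2 * c) = 48 / κ := by field_simp; linarith
  simp only [einsteinTensor, Matrix.sub_apply, Matrix.smul_apply, ricM, smul_eq_mul, hΛ] at h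
  field_simp at h ⊢
  linarith

end IsConstSoliton

namespace IsHyperbolic

variable {k : ℝ} (hG : IsMetricOn U G) (hH : IsHyperbolic U G k)
include hH

theorem ricM_eq (hx : x ∈ U) : ricM G x = (-(2 * k)) • G x := by
  ext a b; exact hH.ric_eq x hx a b

include hG

theorem scal_eq (hx : x ∈ U) : scal G x = -(6 * k) := by
  rw [hG.scal_eq_trace hx, hH.ricM_eq hx, Matrix.mul_smul, Matrix.trace_smul, hG.trace_metric hx, smul_eq_mul]
  ring

theorem schouten_eq (hx : x ∈ U) : schouten G x = (-(k / 2)) • G x := by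
  rw [schouten, hH.scal_eq hG hx, hH.ricM_eq hx]
  module

theorem riem_eq (hx : x ∈ U) (i j m l : Fin 3) :
    riem G i j m l x = -k * (G x i l * G x j m - G x i m * G x j l) := by
  rw [hG.riem_eq_schouten hx, hH.schouten_eq hG hx]
  simp only [Matrix.smul_apply, smul_eq_mul]
  ring

theorem curvM_mul (A : Mat) (hx : x ∈ U) (i j m l : Fin 3) :
    (curvM G i j x * A) m l = -k * (A i l * G x j m - G x i m * A j l) := by
  have hGA : G x * ((G x)⁻¹ * A) = A := by rw [← mul_assoc, hG.mul_inv hx, one_mul]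
  have h : curvM G i j x * A = curvM G i j x * G x * ((G x)⁻¹ * A) := by
    rw [mul_assoc, hGA]
  rw [h, Matrix.mul_apply]
  simp only [← HeteroticSoliton.riem_eq, hH.riem_eq hG hx]
  conv_rhs => rw [← hGA]
  simp only [Matrix.mul_apply (M := G x), Finset.sum_mul, Finset.mul_sum]
  rw [← Finset.sum_sub_distrib, Finset.mul_sum]
  exact Finset.sum_congr rfl fun p _ => by ring

end IsHyperbolic

end HeteroticSoliton

end

noncomputable section

namespace HeteroticSoliton

open scoped Topology Matrix

/-! ### Families of functions depending on a parameter -/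

/-- The time derivative at `t = 0` of a family of functions. -/
def dot (F : ℝ → E3 → ℝ) (y : E3) : ℝ := deriv (fun t => F t y) 0

/-- The time derivative at `t = 0` of a family of matrix fields. -/
def dotM (A : ℝ → E3 → Mat) (y : E3) : Mat := fun i j => dot (fun t y => A t y i j) y

/-- Joint smoothness on `T × V` of a family of functions. -/
def JSm (T : Set ℝ) (V : Set E3) (F : ℝ → E3 → ℝ) : Prop :=
  Sm (T ×ˢ V) (fun z : ℝ × E3 => F z.1 z.2)

/-- Joint smoothness on `T × V` of a family of matrix fields. -/
def JSmM (T : Set ℝ) (V : Set E3) (A : ℝ → E3 → Mat) : Prop :=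
  ∀ i j, JSm T V (fun t y => A t y i j)

variable {T : Set ℝ} {V : Set E3} {F F₁ F₂ : ℝ → E3 → ℝ} {A B : ℝ → E3 → Mat} {x : E3} {t : ℝ}

theorem JSm.of_sm {f : E3 → ℝ} (hf : Sm V f) : JSm T V (fun _ => f) := fun z hz =>
  ContDiffAt.comp z (hf z.2 hz.2) contDiffAt_snd

theorem JSm.time : JSm T V (fun t _ => t) := fun _ _ => contDiffAt_fst

theorem JSm.congr (hT : IsOpen T) (hV : IsOpen V) (hF : JSm T V F)
    (h : ∀ t ∈ T, ∀ y ∈ V, F₁ t y = F t y) : JSm T V F₁ :=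
  Sm.congr (hT.prod hV) hF fun z hz => h z.1 hz.1 z.2 hz.2

theorem JSmM.congr (hT : IsOpen T) (hV : IsOpen V) (hA : JSmM T V A)
    (h : ∀ t ∈ T, ∀ y ∈ V, B t y = A t y) : JSmM T V B :=
  fun i j => (hA i j).congr hT hV fun t ht y hy => by rw [h t ht y hy]

theorem JSmM.of_smM {A : E3 → Mat} (hA : SmM V A) : JSmM T V (fun _ => A) :=
  fun i j => JSm.of_sm (hA i j)

theorem JSm.pd_eq (hF : JSm T V F) (ht : t ∈ T) (hx : x ∈ V) (m : Fin 3) :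
    pd m (F t) x =
      fderiv ℝ (fun z : ℝ × E3 => F z.1 z.2) (t, x) (0, EuclideanSpace.single m 1) := by
  have h := ((hF (t, x) ⟨ht, hx⟩).differentiableAt (by simp)).hasFDerivAt
  have h2 : HasFDerivAt (fun y : E3 => (t, y)) (ContinuousLinearMap.inr ℝ ℝ E3) x :=
    hasFDerivAt_prodMk_right t x
  have h3 : HasFDerivAt (F t) _ x :=
    HasFDerivAt.comp (g := fun z : ℝ × E3 => F z.1 z.2) x h h2
  rw [pd, h3.fderiv]
  rfl

theorem JSm.hasDerivAt_time (hF : JSm T V F) (ht : t ∈ T) (hx : x ∈ V) :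
    HasDerivAt (fun s => F s x) (fderiv ℝ (fun z : ℝ × E3 => F z.1 z.2) (t, x) (1, 0)) t := by
  have h := ((hF (t, x) ⟨ht, hx⟩).differentiableAt (by simp)).hasFDerivAt
  have h2 : HasDerivAt (fun s : ℝ => (s, x)) ((1 : ℝ), (0 : E3)) t :=
    (hasDerivAt_id t).prodMk (hasDerivAt_const t x)
  exact HasFDerivAt.comp_hasDerivAt t h h2

theorem JSm.hasDerivAt (hF : JSm T V F) (h0 : (0 : ℝ) ∈ T) (hx : x ∈ V) :
    HasDerivAt (fun s => F s x) (dot F x) 0 :=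
  (hF.hasDerivAt_time h0 hx).differentiableAt.hasDerivAt

theorem JSm.smooth_fderiv (hF : JSm T V F) (v : ℝ × E3) :
    Sm (T ×ˢ V) (fun z => fderiv ℝ (fun z : ℝ × E3 => F z.1 z.2) z v) := fun z hz =>
  ((hF z hz).fderiv_right (m := ∞) (by simp)).clm_apply contDiffAt_const

theorem JSm.pd (hT : IsOpen T) (hV : IsOpen V) (hF : JSm T V F) (m : Fin 3) :
    JSm T V (fun t => pd m (F t)) :=
  Sm.congr (hT.prod hV) (hF.smooth_fderiv (0, EuclideanSpace.single m 1)) fun _ hz =>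
    hF.pd_eq hz.1 hz.2 m

theorem JSmM.dM (hT : IsOpen T) (hV : IsOpen V) (hA : JSmM T V A) (m : Fin 3) :
    JSmM T V (fun t => dM m (A t)) := fun i j => (hA i j).pd hT hV m

theorem JSm.dot_eq (hF : JSm T V F) (h0 : (0 : ℝ) ∈ T) (hx : x ∈ V) :
    dot F x = fderiv ℝ (fun z : ℝ × E3 => F z.1 z.2) (0, x) (1, 0) :=
  (hF.hasDerivAt_time h0 hx).deriv

/-- The time derivative commutes with partial derivatives. -/
theorem JSm.dot_pd (hT : IsOpen T) (hV : IsOpen V) (h0 : (0 : ℝ) ∈ T) (hF : JSm T V F)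
    (hx : x ∈ V) (m : Fin 3) :
    HeteroticSoliton.dot (fun t => HeteroticSoliton.pd m (F t)) x =
      HeteroticSoliton.pd m (HeteroticSoliton.dot F) x := by
  set Φ := fun z : ℝ × E3 => F z.1 z.2 with hΦ
  have hz : ((0 : ℝ), x) ∈ T ×ˢ V := ⟨h0, hx⟩
  have h2 : DifferentiableAt ℝ (fderiv ℝ Φ) (0, x) :=
    ((hF _ hz).fderiv_right (m := ∞) (by simp)).differentiableAt (by simp)
  have key : ∀ v w : ℝ × E3, fderiv ℝ (fun z => fderiv ℝ Φ z v) (0, x) w =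
      fderiv ℝ (fderiv ℝ Φ) (0, x) w v := by
    intro v w
    have : HasFDerivAt (fun z => fderiv ℝ Φ z v)
        ((fderiv ℝ (fderiv ℝ Φ) (0, x)).flip v) (0, x) := by
      have := h2.hasFDerivAt.clm_apply (hasFDerivAt_const v ((0 : ℝ), x))
      convert! this using 1
      ext <;> simp
    rw [this.fderiv]; rfl
  have e1 : HeteroticSoliton.dot (fun t => HeteroticSoliton.pd m (F t)) x =
      fderiv ℝ (fderiv ℝ Φ) (0, x) (1, 0) (0, EuclideanSpace.single m 1) := by
    rw [(hF.pd hT hV m).dot_eq h0 hx, ← key]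
    have : (fun z : ℝ × E3 => HeteroticSoliton.pd m (F z.1) z.2) =ᶠ[𝓝 (0, x)]
        fun z => fderiv ℝ Φ z (0, EuclideanSpace.single m 1) :=
      Filter.eventually_of_mem ((hT.prod hV).mem_nhds hz) fun z hz => hF.pd_eq hz.1 hz.2 m
    rw [this.fderiv_eq]
  have e2 : HeteroticSoliton.pd m (HeteroticSoliton.dot F) x =
      fderiv ℝ (fderiv ℝ Φ) (0, x) (0, EuclideanSpace.single m 1) (1, 0) := by
    have hs : JSm T V (fun t y => fderiv ℝ Φ (t, y) (1, 0)) := hF.smooth_fderiv (1, 0)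
    rw [pd_congr hV hx (fun y hy => hF.dot_eq h0 hy), ← key,
      hs.pd_eq (F := fun t y => fderiv ℝ Φ (t, y) (1, 0)) h0 hx]
  rw [e1, e2]
  exact ((hF _ hz).isSymmSndFDerivAt (by simpa using ENat.LEInfty.out)) _ _

theorem JSmM.dotM_dM (hT : IsOpen T) (hV : IsOpen V) (h0 : (0 : ℝ) ∈ T) (hA : JSmM T V A)
    (hx : x ∈ V) (m : Fin 3) :
    HeteroticSoliton.dotM (fun t => HeteroticSoliton.dM m (A t)) x =
      HeteroticSoliton.dM m (HeteroticSoliton.dotM A) x := by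
  ext i j
  exact (hA i j).dot_pd hT hV h0 hx m

theorem dot_congr (hT : IsOpen T) (h0 : (0 : ℝ) ∈ T) (h : ∀ t ∈ T, F₁ t x = F₂ t x) :
    dot F₁ x = dot F₂ x := by
  have : (fun t => F₁ t x) =ᶠ[𝓝 0] fun t => F₂ t x :=
    Filter.eventually_of_mem (hT.mem_nhds h0) h
  exact this.deriv_eq

theorem dotM_congr (hT : IsOpen T) (h0 : (0 : ℝ) ∈ T) (h : ∀ t ∈ T, A t x = B t x) :
    dotM A x = dotM B x := by
  ext i j
  exact dot_congr (F₁ := fun t y => A t y i j) (F₂ := fun t y => B t y i j) hT h0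
    fun t ht => by rw [h t ht]

@[simp] theorem dot_const (f : E3 → ℝ) : dot (fun _ => f) x = 0 := by simp [dot]

@[simp] theorem dotM_const (A : E3 → Mat) : dotM (fun _ => A) x = 0 := by
  ext i j; simp [dotM, dot]

theorem dot_add (h0 : (0 : ℝ) ∈ T) (hx : x ∈ V) (h₁ : JSm T V F₁) (h₂ : JSm T V F₂) :
    dot (fun t y => F₁ t y + F₂ t y) x = dot F₁ x + dot F₂ x :=
  ((h₁.hasDerivAt h0 hx).add (h₂.hasDerivAt h0 hx)).deriv

theorem dot_sub (h0 : (0 : ℝ) ∈ T) (hx : x ∈ V) (h₁ : JSm T V F₁) (h₂ : JSm T V F₂) :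
    dot (fun t y => F₁ t y - F₂ t y) x = dot F₁ x - dot F₂ x :=
  ((h₁.hasDerivAt h0 hx).sub (h₂.hasDerivAt h0 hx)).deriv

theorem dot_mul (h0 : (0 : ℝ) ∈ T) (hx : x ∈ V) (h₁ : JSm T V F₁) (h₂ : JSm T V F₂) :
    dot (fun t y => F₁ t y * F₂ t y) x = dot F₁ x * F₂ 0 x + F₁ 0 x * dot F₂ x :=
  ((h₁.hasDerivAt h0 hx).mul (h₂.hasDerivAt h0 hx)).deriv

theorem dot_sum {ι : Type*} {s : Finset ι} {F : ι → ℝ → E3 → ℝ} (h0 : (0 : ℝ) ∈ T) (hx : x ∈ V)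
    (h : ∀ i ∈ s, JSm T V (F i)) :
    dot (fun t y => ∑ i ∈ s, F i t y) x = ∑ i ∈ s, dot (F i) x :=
  (HasDerivAt.fun_sum fun i hi => (h i hi).hasDerivAt h0 hx).deriv

/-- The time derivative of `t * F t` at `t = 0` is the value of `F` at `t = 0`. -/
theorem JSm.hasDerivAt_time_mul (hF : JSm T V F) (h0 : (0 : ℝ) ∈ T) (hx : x ∈ V) :
    HasDerivAt (fun t => t * F t x) (F 0 x) 0 := by
  have h := (hasDerivAt_id (0 : ℝ)).mul (hF.hasDerivAt h0 hx)
  simpa using! h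

theorem JSmM.add (hA : JSmM T V A) (hB : JSmM T V B) : JSmM T V (fun t y => A t y + B t y) :=
  fun i j => Sm.add (hA i j) (hB i j)

theorem JSmM.sub (hA : JSmM T V A) (hB : JSmM T V B) : JSmM T V (fun t y => A t y - B t y) :=
  fun i j => Sm.sub (hA i j) (hB i j)

theorem JSmM.smul (hF : JSm T V F) (hA : JSmM T V A) : JSmM T V (fun t y => F t y • A t y) :=
  fun i j => Sm.mul hF (hA i j)

theorem JSmM.mul (hA : JSmM T V A) (hB : JSmM T V B) : JSmM T V (fun t y => A t y * B t y) :=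
  SmM.mul (A := fun z : ℝ × E3 => A z.1 z.2) (B := fun z : ℝ × E3 => B z.1 z.2) hA hB

theorem JSmM.transpose (hA : JSmM T V A) : JSmM T V (fun t y => (A t y)ᵀ) := fun i j => hA j i

theorem JSmM.inv (hA : JSmM T V A) (h : ∀ t ∈ T, ∀ y ∈ V, (A t y).det ≠ 0) :
    JSmM T V (fun t y => (A t y)⁻¹) :=
  SmM.inv (A := fun z : ℝ × E3 => A z.1 z.2) hA fun z hz => h z.1 hz.1 z.2 hz.2

theorem JSmM.trace (hA : JSmM T V A) : JSm T V (fun t y => (A t y).trace) :=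
  SmM.trace (A := fun z : ℝ × E3 => A z.1 z.2) hA

theorem dotM_add (h0 : (0 : ℝ) ∈ T) (hx : x ∈ V) (hA : JSmM T V A) (hB : JSmM T V B) :
    dotM (fun t y => A t y + B t y) x = dotM A x + dotM B x := by
  ext i j; exact dot_add h0 hx (hA i j) (hB i j)

theorem dotM_sub (h0 : (0 : ℝ) ∈ T) (hx : x ∈ V) (hA : JSmM T V A) (hB : JSmM T V B) :
    dotM (fun t y => A t y - B t y) x = dotM A x - dotM B x := by
  ext i j; exact dot_sub h0 hx (hA i j) (hB i j)

theorem dotM_smul (h0 : (0 : ℝ) ∈ T) (hx : x ∈ V) (hF : JSm T V F) (hA : JSmM T V A) :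
    dotM (fun t y => F t y • A t y) x = dot F x • A 0 x + F 0 x • dotM A x := by
  ext i j; exact dot_mul h0 hx hF (hA i j)

theorem dotM_const_smul (h0 : (0 : ℝ) ∈ T) (hx : x ∈ V) (c : ℝ) (hA : JSmM T V A) :
    dotM (fun t y => c • A t y) x = c • dotM A x := by
  rw [dotM_smul h0 hx (JSm.of_sm (Sm.const V c)) hA]; simp

theorem dotM_mul (h0 : (0 : ℝ) ∈ T) (hx : x ∈ V) (hA : JSmM T V A) (hB : JSmM T V B) :
    dotM (fun t y => A t y * B t y) x = dotM A x * B 0 x + A 0 x * dotM B x := by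
  ext i j
  simp only [dotM, Matrix.mul_apply, Matrix.add_apply]
  rw [dot_sum h0 hx (F := fun k t y => A t y i k * B t y k j)
    (fun k _ => Sm.mul (hA i k) (hB k j)), ← Finset.sum_add_distrib]
  exact Finset.sum_congr rfl fun k _ => dot_mul h0 hx (hA i k) (hB k j)

theorem dot_trace (h0 : (0 : ℝ) ∈ T) (hx : x ∈ V) (hA : JSmM T V A) :
    dot (fun t y => (A t y).trace) x = (dotM A x).trace :=
  dot_sum h0 hx (F := fun i t y => A t y i i) fun i _ => hA i i

end HeteroticSoliton

end

noncomputable section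

namespace HeteroticSoliton

open scoped Topology Matrix

/-! ### The first variation of the Ricci tensor -/

/-- The line of metrics `G + t H`. -/
def line (G H : E3 → Mat) (t : ℝ) (y : E3) : Mat := G y + t • H y

/-- The first variation of the Christoffel symbols of `G` in the direction `H`, with lowered
index. -/
def chrVar (G H : E3 → Mat) (i : Fin 3) (y : E3) : Mat := fun j l =>
  (1 / 2) * (covM G H i y j l + covM G H j y i l - covM G H l y i j)

/-- `G + t H` is a smooth metric on `V` for all `t` in an open set `T` that contains `0`. -/
structure IsVariation (T : Set ℝ) (V : Set E3) (G H : E3 → Mat) : Prop where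
  isOpen_time : IsOpen T
  zero_mem : (0 : ℝ) ∈ T
  smooth : SmM V H
  symm : ∀ y ∈ V, (H y)ᵀ = H y
  metric : ∀ t ∈ T, IsMetricOn V (line G H t)

variable {T : Set ℝ} {U V : Set E3} {G H : E3 → Mat} {x : E3}

theorem line_zero (G H : E3 → Mat) : line G H 0 = G := by ext; simp [line]

/-- Positive definiteness is an open condition. -/
theorem exists_isVariation (hG : IsMetricOn U G) (hH : SmM U H) (hHs : ∀ y ∈ U, (H y)ᵀ = H y)
    (hx : x ∈ U) : ∃ T : Set ℝ, ∃ V ⊆ U, x ∈ V ∧ IsVariation T V G H := by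
  have hcont : ∀ v : Fin 3 → ℝ, ∀ z : ℝ × E3, z.2 ∈ U → ContinuousAt
      (fun p : (ℝ × E3) × (Fin 3 → ℝ) => p.2 ⬝ᵥ (line G H p.1.1 p.1.2 *ᵥ p.2)) (z, v) := by
    intro v z hz
    have hent : ∀ i j, ContinuousAt (fun p : (ℝ × E3) × (Fin 3 → ℝ) => line G H p.1.1 p.1.2 i j)
        (z, v) := by
      intro i j
      have hg : ContinuousAt (fun p : (ℝ × E3) × (Fin 3 → ℝ) => G p.1.2 i j) (z, v) :=
        ContinuousAt.comp (f := fun p : (ℝ × E3) × (Fin 3 → ℝ) => p.1.2)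
          (g := fun y => G y i j) (hG.smooth i j z.2 hz).continuousAt
          (continuous_fst.snd.continuousAt)
      have hh : ContinuousAt (fun p : (ℝ × E3) × (Fin 3 → ℝ) => H p.1.2 i j) (z, v) :=
        ContinuousAt.comp (f := fun p : (ℝ × E3) × (Fin 3 → ℝ) => p.1.2)
          (g := fun y => H y i j) (hH i j z.2 hz).continuousAt
          (continuous_fst.snd.continuousAt)
      exact hg.add (continuous_fst.fst.continuousAt.mul hh)
    simp only [dotProduct, Matrix.mulVec]
    refine tendsto_finsetSum _ fun i _ => ContinuousAt.mul ?_ (tendsto_finsetSum _ fun j _ =>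
      (hent i j).mul ?_)
    · exact ((continuous_apply i).comp continuous_snd).continuousAt
    · exact ((continuous_apply j).comp continuous_snd).continuousAt
  have hev : ∀ᶠ z : ℝ × E3 in 𝓝 (0, x), ∀ v ∈ Metric.sphere (0 : Fin 3 → ℝ) 1,
      0 < v ⬝ᵥ (line G H z.1 z.2 *ᵥ v) := by
    refine (isCompact_sphere (0 : Fin 3 → ℝ) 1).eventually_forall_of_forall_eventually ?_
    intro v hv
    refine (hcont v (0, x) hx).eventually (lt_mem_nhds ?_)
    have hv0 : v ≠ 0 := by
      rintro rfl
      simp at hv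
    have := (hG.posDef x hx).dotProduct_mulVec_pos hv0
    simpa [line_zero] using this
  have hU : ∀ᶠ z : ℝ × E3 in 𝓝 (0, x), z.2 ∈ U :=
    continuous_snd.continuousAt.eventually (hG.isOpen.mem_nhds hx)
  obtain ⟨T, V, hT, h0, hV, hxV, hTV⟩ := mem_nhds_prod_iff'.1 (hev.and hU)
  have hVU : V ⊆ U := fun y hy => (hTV (Set.mk_mem_prod h0 hy)).2
  refine ⟨T, V, hVU, hxV, hT, h0, fun i j y hy => hH i j y (hVU hy),
    fun y hy => hHs y (hVU hy), fun t ht => ⟨hV, ?_, fun y hy => ?_⟩⟩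
  · exact SmM.add (fun i j y hy => hG.smooth i j y (hVU hy))
      (SmM.smul (Sm.const V t) fun i j y hy => hH i j y (hVU hy))
  · refine Matrix.PosDef.of_dotProduct_mulVec_pos ?_ fun v hv => ?_
    · rw [Matrix.IsHermitian, Matrix.conjTranspose_eq_transpose_of_trivial, line,
        Matrix.transpose_add, Matrix.transpose_smul, hHs y (hVU hy), hG.transpose_eq (hVU hy)]
    · have hn : ‖v‖ ≠ 0 := norm_ne_zero_iff.2 hv
      have h1 := (hTV (Set.mk_mem_prod ht hy)).1 (‖v‖⁻¹ • v) (by simp [norm_smul, hn])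
      simp only [Matrix.mulVec_smul, dotProduct_smul, smul_dotProduct, smul_eq_mul] at h1
      have h2 : 0 < ‖v‖⁻¹ := by positivity
      rw [star_trivial]
      exact (mul_pos_iff_of_pos_left h2).1 ((mul_pos_iff_of_pos_left h2).1 h1)

namespace IsVariation

variable (hv : IsVariation T V G H)
include hv

theorem metric_zero : IsMetricOn V G := by
  have := hv.metric 0 hv.zero_mem
  rwa [line_zero] at this

theorem isOpen : IsOpen V := hv.metric_zero.isOpen

theorem smooth_line : JSmM T V (line G H) :=
  (JSmM.of_smM hv.metric_zero.smooth).add (JSmM.smul JSm.time (JSmM.of_smM hv.smooth))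

omit hv in
theorem _root_.HeteroticSoliton.dotM_line (G H : E3 → Mat) (x : E3) : dotM (line G H) x = H x := by
  ext i j
  have h : HasDerivAt (fun t : ℝ => G x i j + t * H x i j) (1 * H x i j) 0 :=
    ((hasDerivAt_id (0 : ℝ)).mul_const (H x i j)).const_add (G x i j)
  rw [one_mul] at h
  exact h.deriv

theorem smooth_inv : JSmM T V (fun t y => (line G H t y)⁻¹) :=
  hv.smooth_line.inv fun t ht _ hy => (hv.metric t ht).det_ne hy

theorem smooth_chr (i j k : Fin 3) : JSm T V (fun t => chr (line G H t) i j k) :=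
  Sm.const_mul _ (Sm.sum fun l _ => Sm.mul (hv.smooth_inv k l)
    (((((hv.smooth_line j l).pd hv.isOpen_time hv.isOpen i).add
      ((hv.smooth_line i l).pd hv.isOpen_time hv.isOpen j))).sub
      ((hv.smooth_line i j).pd hv.isOpen_time hv.isOpen l)))

theorem smooth_chrM (m : Fin 3) : JSmM T V (fun t => chrM (line G H t) m) :=
  fun i k => hv.smooth_chr m i k

theorem smooth_curvM (i j : Fin 3) : JSmM T V (fun t => curvM (line G H t) i j) := by
  refine JSmM.congr hv.isOpen_time hv.isOpen ?_ (fun t _ y _ => curvM_eq _ i j y)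
  have hd := fun i j => (hv.smooth_chrM j).dM hv.isOpen_time hv.isOpen i
  exact (((hd i j).sub (hd j i)).add
    ((hv.smooth_chrM j).mul (hv.smooth_chrM i))).sub ((hv.smooth_chrM i).mul (hv.smooth_chrM j))

theorem smooth_ricM : JSmM T V (fun t => ricM (line G H t)) := fun a b =>
  JSm.congr (F := fun t y => ∑ i, curvM (line G H t) i a y b i) hv.isOpen_time hv.isOpen
    (Sm.sum (s := Finset.univ) fun i _ => hv.smooth_curvM i a b i)
    fun t ht _ hy => ric_eq (hv.metric t ht) hy a b

theorem dotM_inv (hx : x ∈ V) :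
    dotM (fun t y => (line G H t y)⁻¹) x = -((G x)⁻¹ * H x * (G x)⁻¹) := by
  have hG := hv.metric_zero
  have h0 : dotM (fun t y => (line G H t y)⁻¹ * line G H t y) x = 0 := by
    rw [dotM_congr hv.isOpen_time hv.zero_mem (B := fun _ _ => 1)
      (fun t ht => (hv.metric t ht).inv_mul hx)]
    exact dotM_const _
  rw [dotM_mul hv.zero_mem hx hv.smooth_inv hv.smooth_line, dotM_line, line_zero] at h0
  have h1 := congrArg (· * (G x)⁻¹) h0
  simp only [add_mul, zero_mul, mul_assoc, hG.mul_inv hx, mul_one] at h1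
  rw [eq_neg_iff_add_eq_zero, mul_assoc, h1]

/-- The first variation of the Christoffel symbols, with lowered index. -/
theorem dotM_chrM_mul (hx : x ∈ V) (i j l : Fin 3) :
    (dotM (fun t => chrM (line G H t) i) x * G x) j l = (1 / 2) *
      (covM G H i x j l + covM G H j x i l - covM G H l x i j) := by
  have hG := hv.metric_zero
  have h1 : dot (fun t y => (chrM (line G H t) i y * line G H t y) j l) x = (1 / 2) *
      (pd i (fun y => H y j l) x + pd j (fun y => H y i l) x - pd l (fun y => H y i j) x) := by
    have hp : ∀ t : ℝ, ∀ m a b, pd m (fun y => line G H t y a b) x =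
        pd m (fun y => G y a b) x + t * pd m (fun y => H y a b) x := by
      intro t m a b
      have e : (fun y => line G H t y a b) = fun y => G y a b + t * H y a b := rfl
      rw [e, pd_add (hG.smooth a b) ((hv.smooth a b).const_mul t) hx,
        pd_const_mul (hv.smooth a b) hx]
    rw [dot_congr hv.isOpen_time hv.zero_mem (F₂ := fun t y =>
      (1 / 2) * (pd i (fun y => G y j l) y + pd j (fun y => G y i l) y - pd l (fun y => G y i j) y)
      + t * ((1 / 2) * (pd i (fun y => H y j l) y + pd j (fun y => H y i l) y
        - pd l (fun y => H y i j) y)))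
      (fun t ht => by rw [(hv.metric t ht).chrM_mul hx, hp, hp, hp]; ring)]
    have h := ((hasDerivAt_id (0 : ℝ)).mul_const ((1 / 2) * (pd i (fun y => H y j l) x
        + pd j (fun y => H y i l) x - pd l (fun y => H y i j) x))).const_add
        ((1 / 2) * (pd i (fun y => G y j l) x + pd j (fun y => G y i l) x
          - pd l (fun y => G y i j) x))
    rw [one_mul] at h
    exact h.deriv
  have h2 : dotM (fun t y => chrM (line G H t) i y * line G H t y) x =
      dotM (fun t => chrM (line G H t) i) x * G x + chrM G i x * H x := by
    rw [dotM_mul hv.zero_mem hx (hv.smooth_chrM i) hv.smooth_line, dotM_line, line_zero]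
  have h3 := congrFun (congrFun h2 j) l
  rw [dotM, h1] at h3
  have hs : ∀ a b, H x a b = H x b a := fun a b => by
    conv_lhs => rw [← hv.symm x hx]
    rfl
  have e : (dotM (fun t => chrM (line G H t) i) x * G x) j l = (1 / 2) *
      (pd i (fun y => H y j l) x + pd j (fun y => H y i l) x - pd l (fun y => H y i j) x)
      - (chrM G i x * H x) j l := by
    rw [h3, Matrix.add_apply]; ring
  rw [e, ← covBilin_eq, ← covBilin_eq, ← covBilin_eq]
  simp only [covBilin, Matrix.mul_apply, chrM, Fin.sum_univ_three]
  rw [hG.chr_symm hx j i, hG.chr_symm hx j i, hG.chr_symm hx j i, hG.chr_symm hx l i,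
    hG.chr_symm hx l i, hG.chr_symm hx l i, hG.chr_symm hx l j, hG.chr_symm hx l j,
    hG.chr_symm hx l j, hs 0 l, hs 1 l, hs 2 l, hs 0 j, hs 1 j, hs 2 j]
  ring

theorem dotM_chrM (hx : x ∈ V) (i : Fin 3) :
    dotM (fun t => chrM (line G H t) i) x = chrVar G H i x * (G x)⁻¹ := by
  have h : dotM (fun t => chrM (line G H t) i) x * G x = chrVar G H i x := by
    ext j l; exact hv.dotM_chrM_mul hx i j l
  rw [← h, mul_assoc, hv.metric_zero.mul_inv hx, mul_one]

theorem smooth_chrVar (i : Fin 3) : SmM V (chrVar G H i) := fun j l =>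
  have s := fun p q r => hv.metric_zero.smooth_covM hv.smooth p q r
  Sm.const_mul _ (((s i j l).add (s j i l)).sub (s l i j))

/-- The first variation of the curvature. -/
theorem dotM_curvM (hx : x ∈ V) (i j : Fin 3) : dotM (fun t => curvM (line G H t) i j) x =
    (cov3 G (chrVar G H) i j x - cov3 G (chrVar G H) j i x) * (G x)⁻¹ := by
  have hG := hv.metric_zero
  have hT := hv.isOpen_time
  have h0 := hv.zero_mem
  set Γ' := fun i => dotM (fun t => chrM (line G H t) i) with hΓ'
  have hΓ : ∀ i, ∀ y ∈ V, Γ' i y = chrVar G H i y * (G y)⁻¹ :=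
    fun i y hy => hv.dotM_chrM hy i
  have hcs : ∀ i, SmM V (chrVar G H i) := hv.smooth_chrVar
  have hd := fun i j => (hv.smooth_chrM j).dM hT hv.isOpen i
  have hm := fun i j => (hv.smooth_chrM i).mul (hv.smooth_chrM j)
  have h1 : dotM (fun t => curvM (line G H t) i j) x = dM i (Γ' j) x - dM j (Γ' i) x
      + (Γ' j x * chrM G i x + chrM G j x * Γ' i x)
      - (Γ' i x * chrM G j x + chrM G i x * Γ' j x) := by
    rw [dotM_congr (A := fun t => curvM (line G H t) i j) (B := fun t y =>
        dM i (chrM (line G H t) j) y - dM j (chrM (line G H t) i) y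
        + chrM (line G H t) j y * chrM (line G H t) i y
        - chrM (line G H t) i y * chrM (line G H t) j y) hT h0 (fun t _ => curvM_eq _ i j x),
      dotM_sub h0 hx (((hd i j).sub (hd j i)).add (hm j i)) (hm i j),
      dotM_add h0 hx ((hd i j).sub (hd j i)) (hm j i), dotM_sub h0 hx (hd i j) (hd j i),
      dotM_mul h0 hx (hv.smooth_chrM j) (hv.smooth_chrM i),
      dotM_mul h0 hx (hv.smooth_chrM i) (hv.smooth_chrM j), line_zero,
      (hv.smooth_chrM j).dotM_dM hT hv.isOpen h0 hx, (hv.smooth_chrM i).dotM_dM hT hv.isOpen h0 hx]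
  have h2 : ∀ i j, dM i (Γ' j) x = cov3 G (chrVar G H) i j x * (G x)⁻¹ + chrM G i x * Γ' j x
      - Γ' j x * chrM G i x + (∑ p, chr G i j p x • chrVar G H p x) * (G x)⁻¹ := by
    intro i j
    rw [dM_congr hv.isOpen hx (hΓ j), dM_mul (hcs j) hG.smooth_inv hx, hG.dM_inv hx, cov3,
      hΓ j x hx]
    noncomm_ring
  have hs : ∑ p, chr G i j p x • chrVar G H p x = ∑ p, chr G j i p x • chrVar G H p x :=
    Finset.sum_congr rfl fun p _ => by rw [hG.chr_symm hx]
  rw [h1, h2 i j, h2 j i, hs]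
  noncomm_ring

/-- The first variation of the Ricci tensor. -/
theorem dotM_ricM (hx : x ∈ V) (a b : Fin 3) :
    dotM (fun t => ricM (line G H t)) x a b = ∑ i, ∑ l, (G x)⁻¹ i l * ((1 / 2) *
      (cov3 G (covM G H) i a x b l + cov3 G (covM G H) i b x a l
        - cov3 G (covM G H) i l x a b - cov3 G (covM G H) a b x i l)) := by
  have hG := hv.metric_zero
  have hcc : ∀ i j k l, cov3 G (chrVar G H) i j x k l = (1 / 2) * (cov3 G (covM G H) i j x k l
      + cov3 G (covM G H) i k x j l - cov3 G (covM G H) i l x j k) := by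
    intro i j k l
    have e : dM i (chrVar G H j) x k l = (1 / 2) * (dM i (covM G H j) x k l + dM i (covM G H k) x j l
        - dM i (covM G H l) x j k) := by
      have s := fun p q r => hG.smooth_covM hv.smooth p q r
      change pd i (fun y => (1 / 2) * (covM G H j y k l + covM G H k y j l - covM G H l y j k)) x = _
      rw [pd_const_mul (((s j k l).add (s k j l)).sub (s l j k)) hx,
        pd_sub ((s j k l).add (s k j l)) (s l j k) hx, pd_add (s j k l) (s k j l) hx]
      rfl
    simp only [cov3, Matrix.sub_apply, Matrix.sum_apply, Matrix.smul_apply, Matrix.mul_apply,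
      Matrix.transpose_apply, chrM, smul_eq_mul, e]
    simp only [chrVar, Fin.sum_univ_three]
    ring
  have hsym : ∀ m i j l, cov3 G (covM G H) m i x j l = cov3 G (covM G H) m i x l j := by
    intro m i j l
    have hs : ∀ p, ∀ y ∈ V, (covM G H p y)ᵀ = covM G H p y := fun p y hy => by
      ext a b; exact covM_symm hv.isOpen hy hv.symm p b a
    have e : cov3 G (covM G H) m i x = (cov3 G (covM G H) m i x)ᵀ := by
      simp only [cov3, Matrix.transpose_sub, Matrix.transpose_mul, Matrix.transpose_transpose,
        Matrix.transpose_sum, Matrix.transpose_smul, hs _ x hx]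
      rw [← dM_transpose, dM_congr hv.isOpen hx (hs i)]
      abel
    conv_lhs => rw [e]
    rfl
  have h1 : dotM (fun t => ricM (line G H t)) x a b =
      ∑ i, dotM (fun t => curvM (line G H t) i a) x b i := by
    have e := dot_congr (F₁ := fun t y => ricM (line G H t) y a b)
      (F₂ := fun t y => ∑ i, curvM (line G H t) i a y b i) hv.isOpen_time hv.zero_mem
      (fun t ht => ric_eq (hv.metric t ht) hx a b)
    rw [dotM, e]
    exact dot_sum hv.zero_mem hx fun i _ => hv.smooth_curvM i a b i
  rw [h1]
  have h2 : ∀ i, dotM (fun t => curvM (line G H t) i a) x b i = ∑ l, (G x)⁻¹ i l *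
      ((1 / 2) * (cov3 G (covM G H) i a x b l + cov3 G (covM G H) i b x a l
        - cov3 G (covM G H) i l x a b - cov3 G (covM G H) a b x i l))
      - ((1 / 2) * ∑ l, (G x)⁻¹ i l * cov3 G (covM G H) a i x b l
        - (1 / 2) * ∑ l, (G x)⁻¹ l i * cov3 G (covM G H) a l x b i) := by
    intro i
    rw [hv.dotM_curvM hx, Matrix.mul_apply, Finset.mul_sum, Finset.mul_sum,
      ← Finset.sum_sub_distrib, ← Finset.sum_sub_distrib]
    refine Finset.sum_congr rfl fun l _ => ?_
    rw [Matrix.sub_apply, hcc, hcc, hG.inv_symm hx l i, hsym a l i b]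
    ring
  simp only [h2, Finset.sum_sub_distrib, ← Finset.mul_sum]
  rw [Finset.sum_comm (f := fun i l => (G x)⁻¹ l i * cov3 G (covM G H) a l x b i)]
  ring

end IsVariation

end HeteroticSoliton

end

noncomputable section

namespace HeteroticSoliton

open scoped Topology Matrix

/-! ### The linearized soliton equations -/

/-- The Hessian as a matrix. -/
def hessM (G : E3 → Mat) (f : E3 → ℝ) (x : E3) : Mat := fun a b => hess G f a b x

/-- The linearization of the soliton equations at the metric `G` and the constant dilaton `c`, in
the direction `(H, ξ)`. -/
structure IsLocalDeformation (V : Set E3) (G H : E3 → Mat) (κ c : ℝ) (ξ : E3 → ℝ) : Prop where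
  einstein : ∀ x ∈ V, ∀ a b, HasDerivAt (fun t : ℝ =>
    einsteinOp κ (line G H t) (fun y => c + t * ξ y) a b x) 0 0
  yangMills : ∀ x ∈ V, ∀ j k l, HasDerivAt (fun t : ℝ =>
    yangMillsOp (line G H t) (fun y => c + t * ξ y) j k l x) 0 0
  dilaton : ∀ x ∈ V, HasDerivAt (fun t : ℝ =>
    dilatonOp κ (line G H t) (fun y => c + t * ξ y) x) 0 0

variable {T : Set ℝ} {U V : Set E3} {G H : E3 → Mat} {x : E3} {ξ : E3 → ℝ} {κ c k : ℝ}

section DilatonLine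

theorem pd_dilatonLine (hξ : Sm V ξ) (hx : x ∈ V) (c t : ℝ) (m : Fin 3) :
    pd m (fun y => c + t * ξ y) x = t * pd m ξ x := by
  rw [pd_add (Sm.const V c) (hξ.const_mul t) hx, pd_const_mul hξ hx, pd_const, zero_add]

theorem hess_dilatonLine (hV : IsOpen V) (hξ : Sm V ξ) (hx : x ∈ V) (A : E3 → Mat) (c t : ℝ)
    (a b : Fin 3) : hess A (fun y => c + t * ξ y) a b x = t * hess A ξ a b x := by
  rw [hess, pd_congr hV hx (fun y hy => pd_dilatonLine hξ hy c t b), pd_const_mul (hξ.pd b) hx,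
    hess, mul_sub, Finset.mul_sum]
  congr 1
  exact Finset.sum_congr rfl fun p _ => by rw [pd_dilatonLine hξ hx]; ring

theorem codiffGrad_dilatonLine (hV : IsOpen V) (hξ : Sm V ξ) (hx : x ∈ V) (A : E3 → Mat)
    (c t : ℝ) : codiffGrad A (fun y => c + t * ξ y) x = t * codiffGrad A ξ x := by
  simp only [codiffGrad, hess_dilatonLine hV hξ hx, mul_neg, Finset.mul_sum]
  congr 1
  exact Finset.sum_congr rfl fun p _ => Finset.sum_congr rfl fun q _ => by ring

theorem gradNormSq_dilatonLine (hξ : Sm V ξ) (hx : x ∈ V) (A : E3 → Mat)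
    (c t : ℝ) : gradNormSq A (fun y => c + t * ξ y) x = t * (t * gradNormSq A ξ x) := by
  simp only [gradNormSq, pd_dilatonLine hξ hx, Finset.mul_sum]
  exact Finset.sum_congr rfl fun p _ => Finset.sum_congr rfl fun q _ => by ring

theorem riemGrad_dilatonLine (hξ : Sm V ξ) (hx : x ∈ V) (A : E3 → Mat) (c t : ℝ)
    (p q r : Fin 3) : riemGrad A (fun y => c + t * ξ y) p q r x = t * riemGrad A ξ p q r x := by
  simp only [riemGrad, pd_dilatonLine hξ hx, Finset.mul_sum]
  exact Finset.sum_congr rfl fun p _ => Finset.sum_congr rfl fun q _ => by ring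

end DilatonLine

namespace IsVariation

variable (hv : IsVariation T V G H)
include hv

theorem smooth_hess (hξ : Sm V ξ) (a b : Fin 3) : JSm T V (fun t => hess (line G H t) ξ a b) :=
  Sm.sub (JSm.of_sm ((hξ.pd b).pd a))
    (Sm.sum fun p _ => Sm.mul (hv.smooth_chr a b p) (JSm.of_sm (hξ.pd p)))

theorem smooth_codiffGrad (hξ : Sm V ξ) : JSm T V (fun t => codiffGrad (line G H t) ξ) :=
  Sm.neg (Sm.sum fun a _ => Sm.sum fun b _ => Sm.mul (hv.smooth_inv a b) (hv.smooth_hess hξ a b))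

theorem smooth_gradNormSq (hξ : Sm V ξ) : JSm T V (fun t => gradNormSq (line G H t) ξ) :=
  Sm.sum fun a _ => Sm.sum fun b _ => Sm.mul (Sm.mul (hv.smooth_inv a b) (JSm.of_sm (hξ.pd a)))
    (JSm.of_sm (hξ.pd b))

theorem smooth_riemGrad (hξ : Sm V ξ) (p q r : Fin 3) :
    JSm T V (fun t => riemGrad (line G H t) ξ p q r) :=
  Sm.sum fun a _ => Sm.sum fun b _ => Sm.mul (Sm.mul (hv.smooth_inv a b) (JSm.of_sm (hξ.pd b)))
    ((hv.smooth_curvM a p).mul hv.smooth_line q r)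

theorem smooth_scal : JSm T V (fun t => scal (line G H t)) :=
  JSm.congr (F := fun t y => ((line G H t y)⁻¹ * ricM (line G H t) y).trace) hv.isOpen_time
    hv.isOpen ((hv.smooth_inv.mul hv.smooth_ricM).trace)
    fun t ht _ hy => (hv.metric t ht).scal_eq_trace hy

theorem smooth_schouten : JSmM T V (fun t => schouten (line G H t)) :=
  hv.smooth_ricM.sub (JSmM.smul (F := fun t y => scal (line G H t) y / 4)
    (JSm.congr (F := fun t y => scal (line G H t) y * 4⁻¹) hv.isOpen_time hv.isOpen
      (Sm.mul hv.smooth_scal (Sm.const _ _)) fun _ _ _ _ => div_eq_mul_inv _ _) hv.smooth_line)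

/-! In the following, the variation starts at a hyperbolic metric, and `r` is the first variation
of the Ricci tensor. -/

variable (hH : IsHyperbolic V G k)
include hH

/-- The first variation of the Ricci endomorphism. -/
theorem dotM_inv_mul_ricM (hx : x ∈ V) :
    dotM (fun t y => (line G H t y)⁻¹ * ricM (line G H t) y) x =
      (G x)⁻¹ * (dotM (fun t => ricM (line G H t)) x + (2 * k) • H x) := by
  rw [dotM_mul hv.zero_mem hx hv.smooth_inv hv.smooth_ricM, hv.dotM_inv hx, line_zero,
    hH.ricM_eq hx, Matrix.mul_smul, neg_mul, mul_assoc, hv.metric_zero.inv_mul hx, mul_one,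
    mul_add, Matrix.mul_smul]
  module

theorem dot_scal (hx : x ∈ V) : dot (fun t => scal (line G H t)) x =
    ((G x)⁻¹ * (dotM (fun t => ricM (line G H t)) x + (2 * k) • H x)).trace := by
  rw [dot_congr hv.isOpen_time hv.zero_mem
    (F₂ := fun t y => ((line G H t y)⁻¹ * ricM (line G H t) y).trace)
    (fun t ht => (hv.metric t ht).scal_eq_trace hx),
    dot_trace hv.zero_mem hx (hv.smooth_inv.mul hv.smooth_ricM), hv.dotM_inv_mul_ricM hH hx]

theorem hasDerivAt_scal (hx : x ∈ V) : HasDerivAt (fun t => scal (line G H t) x)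
    ((G x)⁻¹ * (dotM (fun t => ricM (line G H t)) x + (2 * k) • H x)).trace 0 := by
  rw [← hv.dot_scal hH hx]
  exact hv.smooth_scal.hasDerivAt hv.zero_mem hx

omit hv in
omit hH in
theorem _root_.HeteroticSoliton.IsMetricOn.ricSq_eq_trace (hG : IsMetricOn V G) (hx : x ∈ V) :
    ricSq G x = ((G x)⁻¹ * ricM G x * ((G x)⁻¹ * ricM G x)).trace := by
  rw [ricSq, contract_eq_trace _ _ (hG.inv_transpose hx)]
  simp only [mul_assoc]

theorem hasDerivAt_ricSq (hx : x ∈ V) : HasDerivAt (fun t => ricSq (line G H t) x)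
    (-(4 * k) * ((G x)⁻¹ * (dotM (fun t => ricM (line G H t)) x + (2 * k) • H x)).trace) 0 := by
  have hρ := hv.smooth_inv.mul hv.smooth_ricM
  have h := (hρ.mul hρ).trace.hasDerivAt hv.zero_mem hx
  have hz : (line G H 0 x)⁻¹ * ricM (line G H 0) x = (-(2 * k)) • 1 := by
    rw [line_zero, hH.ricM_eq hx, Matrix.mul_smul, hv.metric_zero.inv_mul hx]
  rw [dot_trace hv.zero_mem hx (hρ.mul hρ), dotM_mul hv.zero_mem hx hρ hρ, hz,
    hv.dotM_inv_mul_ricM hH hx] at h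
  refine (h.congr_of_eventuallyEq (Filter.eventually_of_mem
    (hv.isOpen_time.mem_nhds hv.zero_mem) fun t ht => (hv.metric t ht).ricSq_eq_trace hx)).congr_deriv
    ?_
  simp only [Matrix.mul_smul, Matrix.smul_mul, mul_one, one_mul, Matrix.trace_add,
    Matrix.trace_smul, smul_eq_mul]
  ring

theorem hasDerivAt_ric_inv_ric (hx : x ∈ V) (a b : Fin 3) : HasDerivAt
    (fun t => (ricM (line G H t) x * (line G H t x)⁻¹ * ricM (line G H t) x) a b)
    ((-(4 * k)) * dotM (fun t => ricM (line G H t)) x a b - 4 * k ^ 2 * H x a b) 0 := by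
  have hρ := hv.smooth_inv.mul hv.smooth_ricM
  have h := (hv.smooth_ricM.mul hρ a b).hasDerivAt hv.zero_mem hx
  have hz : (line G H 0 x)⁻¹ * ricM (line G H 0) x = (-(2 * k)) • 1 := by
    rw [line_zero, hH.ricM_eq hx, Matrix.mul_smul, hv.metric_zero.inv_mul hx]
  have e : dot (fun t y => (ricM (line G H t) y * ((line G H t y)⁻¹ * ricM (line G H t) y)) a b) x
      = (-(4 * k)) * dotM (fun t => ricM (line G H t)) x a b - 4 * k ^ 2 * H x a b := by
    have e1 := dotM_mul hv.zero_mem hx hv.smooth_ricM hρ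
    rw [hz, hv.dotM_inv_mul_ricM hH hx, line_zero, hH.ricM_eq hx, Matrix.smul_mul,
      ← mul_assoc, hv.metric_zero.mul_inv hx, one_mul] at e1
    have e2 := congrFun (congrFun e1 a) b
    refine e2.trans ?_
    simp only [Matrix.mul_smul, mul_one, Matrix.add_apply, Matrix.smul_apply, smul_eq_mul]
    ring
  rw [e] at h
  simpa only [mul_assoc] using h

variable (hξ : Sm V ξ)
include hξ

/-- The linearized Einstein equation. Since `κ k = 4`, the terms of `κ (R ∘ R)` that are quadratic in
the Ricci tensor contribute `-2 κ k Ric' = -8 Ric'`, which accounts for the factor `7`; the terms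
with the trace of `Ric' + 2 k h` cancel. -/
theorem linearized_einstein (hS : IsConstSoliton V G κ c)
    (hd : IsLocalDeformation V G H κ c ξ) (hκk : κ * k = 4)
    (hx : x ∈ V) : (7 : ℝ) • (dotM (fun t => ricM (line G H t)) x + (2 * k) • H x) =
      hessM G ξ x - (12 * k * ξ x) • G x := by
  have hG := hv.metric_zero
  have hΛ : Real.exp (2 * c) = 12 * k := by
    have h1 := hS.kappa_mul_exp hG hx
    have h2 := (hS.kappa_pos hG hx).ne'
    apply mul_left_cancel₀ h2
    linarith
  ext a b
  set r := dotM (fun t => ricM (line G H t)) x with hr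
  set ζ := ((G x)⁻¹ * (r + (2 * k) • H x)).trace with hζ
  have dR : HasDerivAt (fun t => ric (line G H t) a b x) (r a b) 0 :=
    (hv.smooth_ricM a b).hasDerivAt hv.zero_mem hx
  have ds := hv.hasDerivAt_scal hH hx
  have dq := hv.hasDerivAt_ricSq hH hx
  have dQ := hv.hasDerivAt_ric_inv_ric hH hx a b
  have dG : HasDerivAt (fun t => line G H t x a b) (H x a b) 0 := by
    have h := (hv.smooth_line a b).hasDerivAt hv.zero_mem hx
    have e : dot (fun t y => line G H t y a b) x = H x a b := by rw [← dotM_line G H x]; rfl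
    rwa [e] at h
  have dh := (hv.smooth_hess hξ a b).hasDerivAt_time_mul hv.zero_mem hx
  have de : HasDerivAt (fun t : ℝ => Real.exp (2 * (c + t * ξ x)))
      (Real.exp (2 * c) * (2 * ξ x)) 0 := by
    have h1 : HasDerivAt (fun t : ℝ => 2 * (c + t * ξ x)) (2 * (1 * ξ x)) 0 :=
      (((hasDerivAt_id (0 : ℝ)).mul_const (ξ x)).const_add c).const_mul 2
    simpa using h1.exp
  rw [← hr, ← hζ] at ds dq
  rw [← hr] at dQ
  have h := ((dR.add dh).sub ((de.const_mul (1 / 2)).mul dG)).add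
    ((((((dq.sub ((ds.mul ds).const_mul (1 / 2))).mul dG).add (ds.mul dR)).sub dQ)).const_mul κ)
  have h' := h.unique ((hd.einstein x hx a b).congr_of_eventuallyEq (Filter.eventually_of_mem
    (hv.isOpen_time.mem_nhds hv.zero_mem) fun t ht => by
      simp only [Pi.add_apply, Pi.sub_apply, Pi.mul_apply]
      rw [einsteinOp, hess_dilatonLine hv.isOpen hξ hx, (hv.metric t ht).riemSq_eq hx]
      ring))
  have hq0 : ricSq G x = 12 * k ^ 2 := by
    rw [hG.ricSq_eq_trace hx, hH.ricM_eq hx, Matrix.mul_smul, hG.inv_mul hx]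
    simp
    ring
  simp only [line_zero, Pi.mul_apply, Pi.sub_apply, hH.scal_eq hG hx, hH.ric_eq x hx, hq0, zero_mul, add_zero,
    hΛ] at h'
  simp only [Matrix.add_apply, Matrix.sub_apply, Matrix.smul_apply, smul_eq_mul, hessM]
  linear_combination (-1) * h' + (-2 * r a b - 2 * k * H x a b) * hκk

/-- The trace of the linearized Einstein equation and the linearized dilaton equation say that `ξ`
is an eigenfunction of the Laplace operator. -/
theorem linearized_dilaton (hS : IsConstSoliton V G κ c)
    (hd : IsLocalDeformation V G H κ c ξ) (hκk : κ * k = 4)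
    (hx : x ∈ V) : ((G x)⁻¹ * hessM G ξ x).trace = -(24 / 11) * k * ξ x := by
  have hG := hv.metric_zero
  have hΛ : Real.exp (2 * c) = 12 * k := by
    have h1 := hS.kappa_mul_exp hG hx
    have h2 := (hS.kappa_pos hG hx).ne'
    apply mul_left_cancel₀ h2
    linarith
  have hE := congrArg (fun X => ((G x)⁻¹ * X).trace)
    (hv.linearized_einstein hH hξ hS hd hκk hx)
  simp only [Matrix.mul_smul, mul_sub, Matrix.trace_smul, Matrix.trace_sub, hG.trace_metric hx,
    smul_eq_mul] at hE
  set r := dotM (fun t => ricM (line G H t)) x with hr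
  set ζ := ((G x)⁻¹ * (r + (2 * k) • H x)).trace with hζ
  have ds := hv.hasDerivAt_scal hH hx
  have dq := hv.hasDerivAt_ricSq hH hx
  rw [← hr, ← hζ] at ds dq
  have dc := (hv.smooth_codiffGrad hξ).hasDerivAt_time_mul hv.zero_mem hx
  have dg := (JSm.hasDerivAt_time_mul (F := fun t y => t * gradNormSq (line G H t) ξ y)
    (Sm.mul JSm.time (hv.smooth_gradNormSq hξ))) hv.zero_mem hx
  have de : HasDerivAt (fun t : ℝ => Real.exp (2 * (c + t * ξ x)))
      (Real.exp (2 * c) * (2 * ξ x)) 0 := by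
    have h1 : HasDerivAt (fun t : ℝ => 2 * (c + t * ξ x)) (2 * (1 * ξ x)) 0 :=
      (((hasDerivAt_id (0 : ℝ)).mul_const (ξ x)).const_add c).const_mul 2
    simpa using h1.exp
  have h := ((dc.add dg).sub de).add ((dq.sub ((ds.mul ds).const_mul (1 / 4))).const_mul κ)
  have h' := h.unique ((hd.dilaton x hx).congr_of_eventuallyEq (Filter.eventually_of_mem
    (hv.isOpen_time.mem_nhds hv.zero_mem) fun t ht => by
      simp only [Pi.add_apply, Pi.sub_apply, Pi.mul_apply]
      rw [dilatonOp, codiffGrad_dilatonLine hv.isOpen hξ hx, gradNormSq_dilatonLine hξ hx,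
        (hv.metric t ht).riemNormSq_eq hx]
      ring))
  have hcod : codiffGrad G ξ x = -((G x)⁻¹ * hessM G ξ x).trace := by
    rw [← contract_eq_trace _ (hessM G ξ x) (hG.inv_transpose hx)]; rfl
  simp only [line_zero, hH.scal_eq hG hx, zero_mul, add_zero, hΛ, hcod] at h'
  linear_combination (-7 / 11) * h' + (-7 / 11) * ζ * hκk - 4 / 11 * hE

end IsVariation

end HeteroticSoliton

end

noncomputable section

namespace HeteroticSoliton

open scoped Topology Matrix

/-! ### The linearized Yang-Mills equation forces the dilaton variation to vanish -/

variable {T : Set ℝ} {U V : Set E3} {G H : E3 → Mat} {x : E3} {ξ : E3 → ℝ} {κ c k : ℝ}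

namespace IsMetricOn

variable (hG : IsMetricOn U G) (hξ : Sm U ξ)
include hG hξ

theorem smooth_hessM : SmM U (hessM G ξ) := fun a b =>
  ((hξ.pd b).pd a).sub (Sm.sum fun p _ => (hG.smooth_chr a b p).mul (hξ.pd p))

theorem hessM_symm (hx : x ∈ U) : (hessM G ξ x)ᵀ = hessM G ξ x := by
  ext a b
  simp only [Matrix.transpose_apply, hessM, hess]
  rw [pd_comm hξ hx]
  simp only [hG.chr_symm hx b a]

/-- Ricci identity for the one-form `dξ`. -/
theorem covM_hessM_sub (hx : x ∈ U) (l m j : Fin 3) :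
    covM G (hessM G ξ) l x m j - covM G (hessM G ξ) m x l j =
      -∑ p, curvEnd G l m j p x * pd p ξ x := by
  have hd : ∀ l m, pd l (fun y => hessM G ξ y m j) x = pd l (pd m (pd j ξ)) x
      - ∑ p, (pd l (chr G m j p) x * pd p ξ x + chr G m j p x * pd l (pd p ξ) x) := by
    intro l m
    have hs : ∀ p ∈ Finset.univ, Sm U (fun y => chr G m j p y * pd p ξ y) :=
      fun p _ => (hG.smooth_chr m j p).mul (hξ.pd p)
    change pd l (fun y => pd m (pd j ξ) y - ∑ p, chr G m j p y * pd p ξ y) x = _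
    rw [pd_sub ((hξ.pd j).pd m) (Sm.sum hs) hx, pd_sum hs hx]
    congr 1
    exact Finset.sum_congr rfl fun p _ => pd_mul (hG.smooth_chr m j p) (hξ.pd p) hx l
  rw [← covBilin_eq, ← covBilin_eq, covBilin, covBilin, hd, hd, pd_comm (hξ.pd j) hx l m]
  simp only [hessM, hess, curvEnd, Fin.sum_univ_three]
  rw [hG.chr_symm hx m l, hG.chr_symm hx m l, hG.chr_symm hx m l]
  ring

theorem covM_hessM_symm (hx : x ∈ U) (m i j : Fin 3) :
    covM G (hessM G ξ) m x i j = covM G (hessM G ξ) m x j i :=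
  covM_symm hG.isOpen hx (fun _ hy => hG.hessM_symm hξ hy) m i j

end IsMetricOn

/-- Ricci identity for a one-form on a hyperbolic manifold. -/
theorem IsHyperbolic.covM_hessM_sub (hH : IsHyperbolic U G k) (hG : IsMetricOn U G) (hξ : Sm U ξ)
    (hx : x ∈ U) (l m j : Fin 3) :
    covM G (hessM G ξ) l x m j - covM G (hessM G ξ) m x l j =
      k * (pd l ξ x * G x m j - pd m ξ x * G x l j) := by
  rw [hG.covM_hessM_sub hξ hx]
  have h : ∀ p, curvEnd G l m j p x =
      -k * ((1 : Mat) l p * G x m j - G x l j * (1 : Mat) m p) := by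
    intro p
    have := hH.curvM_mul hG 1 hx l m j p
    rwa [mul_one] at this
  simp only [h, Matrix.one_apply]
  fin_cases l <;> fin_cases m <;> simp [Fin.sum_univ_three] <;> ring

/-- The divergence of the Hessian. -/
theorem IsHyperbolic.div_hessM (hH : IsHyperbolic U G k) (hG : IsMetricOn U G) (hξ : Sm U ξ)
    (hx : x ∈ U) (l : Fin 3) :
    ∑ m, ∑ i, (G x)⁻¹ m i * covM G (hessM G ξ) m x i l =
      pd l (fun y => ((G y)⁻¹ * hessM G ξ y).trace) x - 2 * k * pd l ξ x := by
  have e : ∀ m i, (G x)⁻¹ m i * covM G (hessM G ξ) m x i l =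
      (G x)⁻¹ m i * covM G (hessM G ξ) l x m i + k * ((G x)⁻¹ m i * (G x i l * pd m ξ x))
      - k * pd l ξ x * ((G x)⁻¹ m i * G x m i) := by
    intro m i
    have h := hH.covM_hessM_sub hG hξ hx m l i
    rw [hG.covM_hessM_symm hξ hx m i l, eq_add_of_sub_eq h, hG.symm hx l i]
    ring
  simp only [e, Finset.sum_add_distrib, Finset.sum_sub_distrib, ← Finset.mul_sum]
  rw [hG.contract_metric hx, contract_eq_trace _ (covM G (hessM G ξ) l x) (hG.inv_transpose hx),
    contract_eq_trace _ (G x) (hG.inv_transpose hx), hG.trace_metric hx,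
    hG.trace_covM (hG.smooth_hessM hξ) hx]
  ring

namespace IsVariation

variable (hv : IsVariation T V G H) (hH : IsHyperbolic V G k) (hξ : Sm V ξ)
  (hS : IsConstSoliton V G κ c) (hd : IsLocalDeformation V G H κ c ξ) (hκk : κ * k = 4)
include hv hH hξ hS hd hκk

/-- The first variation of `P + (k / 2) g`, where `P` is the Schouten tensor. -/
theorem dotM_schouten (hx : x ∈ V) :
    dotM (fun t y => schouten (line G H t) y + (k / 2) • line G H t y) x =
      (1 / 7 : ℝ) • hessM G ξ x - (27 / 77 * k * ξ x) • G x := by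
  have hG := hv.metric_zero
  have hE := hv.linearized_einstein hH hξ hS hd hκk hx
  have hD := hv.linearized_dilaton hH hξ hS hd hκk hx
  have hs4 : JSm T V (fun t y => scal (line G H t) y / 4) :=
    JSm.congr (F := fun t y => scal (line G H t) y * 4⁻¹) hv.isOpen_time hv.isOpen
      (Sm.mul hv.smooth_scal (Sm.const _ _)) fun _ _ _ _ => div_eq_mul_inv _ _
  have ds : dot (fun t y => scal (line G H t) y / 4) x = -(15 / 11) * k * ξ x := by
    have h1 := (hv.hasDerivAt_scal hH hx).div_const 4
    rw [dot, h1.deriv]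
    have h2 := congrArg (fun X => ((G x)⁻¹ * X).trace) hE
    simp only [Matrix.mul_smul, mul_sub, Matrix.trace_smul, Matrix.trace_sub, hG.trace_metric hx,
      smul_eq_mul] at h2
    rw [hD] at h2
    linarith
  have h : dotM (fun t y => schouten (line G H t) y + (k / 2) • line G H t y) x =
      dotM (fun t => ricM (line G H t)) x
      - (dot (fun t y => scal (line G H t) y / 4) x • G x + (scal G x / 4) • H x)
      + (k / 2) • H x := by
    rw [dotM_add hv.zero_mem hx hv.smooth_schouten
      (JSmM.smul (JSm.of_sm (Sm.const V _)) hv.smooth_line),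
      dotM_const_smul hv.zero_mem hx _ hv.smooth_line, dotM_line]
    have e : dotM (fun t => schouten (line G H t)) x = dotM (fun t y => ricM (line G H t) y
      - (scal (line G H t) y / 4) • line G H t y) x := rfl
    rw [e, dotM_sub hv.zero_mem hx hv.smooth_ricM (JSmM.smul hs4 hv.smooth_line),
      dotM_smul hv.zero_mem hx hs4 hv.smooth_line, dotM_line, line_zero]
  have hZ := congrArg ((1 / 7 : ℝ) • ·) hE
  simp only [smul_smul] at hZ
  rw [h, ds, hH.scal_eq hG hx]
  norm_num at hZ
  rw [eq_sub_of_add_eq hZ]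
  module

/-- The first variation of the covariant derivative of the Schouten tensor `P_t`. As `P_t` may be
replaced by `P_t + (k / 2) g_t`, which is zero at `t = 0`, the variation of the connection does not
contribute. -/
theorem hasDerivAt_covM_schouten (hx : x ∈ V) (m i j : Fin 3) :
    HasDerivAt (fun t => covM (line G H t) (schouten (line G H t)) m x i j)
      ((1 / 7) * covM G (hessM G ξ) m x i j - 27 / 77 * k * pd m ξ x * G x i j) 0 := by
  have hG := hv.metric_zero
  have hT := hv.isOpen_time
  have h0 := hv.zero_mem
  set A : ℝ → E3 → Mat := fun t y => schouten (line G H t) y + (k / 2) • line G H t y with hA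
  have hAs : JSmM T V A := hv.smooth_schouten.add
    (JSmM.smul (JSm.of_sm (Sm.const V _)) hv.smooth_line)
  have hA0 : A 0 x = 0 := by
    rw [hA]
    simp only [line_zero, hH.schouten_eq hG hx]
    module
  have hcov : ∀ t ∈ T, covM (line G H t) (schouten (line G H t)) m x =
      covM (line G H t) (A t) m x := by
    intro t ht
    have ht' := hv.metric t ht
    rw [hA, covM_add ht'.smooth_schouten (SmM.smul (Sm.const V _) ht'.smooth) hx,
      covM_const_smul _ ht'.smooth hx, ht'.covM_metric hx]
    simp
  have hΓ := hv.smooth_chrM m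
  have hJ : JSmM T V (fun t => covM (line G H t) (A t) m) :=
    ((hAs.dM hT hv.isOpen m).sub (hΓ.mul hAs)).sub (hAs.mul hΓ.transpose)
  have hdot : dotM (fun t => covM (line G H t) (A t) m) x = covM G (dotM A) m x := by
    have e : dotM (fun t => covM (line G H t) (A t) m) x = dotM (fun t y => dM m (A t) y
      - chrM (line G H t) m y * A t y - A t y * (chrM (line G H t) m y)ᵀ) x := rfl
    rw [e, dotM_sub h0 hx ((hAs.dM hT hv.isOpen m).sub (hΓ.mul hAs)) (hAs.mul hΓ.transpose),
      dotM_sub h0 hx (hAs.dM hT hv.isOpen m) (hΓ.mul hAs), dotM_mul h0 hx hΓ hAs,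
      dotM_mul h0 hx hAs hΓ.transpose, hA0, line_zero, hAs.dotM_dM hT hv.isOpen h0 hx, covM]
    simp
  have hval : covM G (dotM A) m x i j =
      (1 / 7) * covM G (hessM G ξ) m x i j - 27 / 77 * k * pd m ξ x * G x i j := by
    have hcg : ∀ y ∈ V, dotM A y = (1 / 7 : ℝ) • hessM G ξ y + (-(27 / 77 * k) * ξ y) • G y := by
      intro y hy
      rw [hA, hv.dotM_schouten hH hξ hS hd hκk hy]
      module
    have hf : Sm V (fun y => -(27 / 77 * k) * ξ y) := hξ.const_mul _
    rw [covM_congr hv.isOpen hx hcg, covM_add (SmM.smul (Sm.const V _) (hG.smooth_hessM hξ))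
      (SmM.smul hf hG.smooth) hx, covM_const_smul _ (hG.smooth_hessM hξ) hx,
      covM_smul hf hG.smooth hx, hG.covM_metric hx, pd_const_mul hξ hx]
    simp only [Matrix.add_apply, Matrix.smul_apply, smul_eq_mul, smul_zero, add_zero]
    ring
  rw [← hval, ← hdot]
  exact ((hJ i j).hasDerivAt h0 hx).congr_of_eventuallyEq (Filter.eventually_of_mem
    (hT.mem_nhds h0) fun t ht => by
      show covM (line G H t) (schouten (line G H t)) m x i j = covM (line G H t) (A t) m x i j
      rw [hcov t ht])

/-- The linearized Yang-Mills equation is `(12 / 77) k (dξ ∧ g) = 0`: the terms with third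
derivatives of `ξ` reduce to first derivatives by the Ricci identity and the eigenvalue equation
for `ξ`. -/
theorem pd_dilaton_eq_zero (hx : x ∈ V) (l : Fin 3) : pd l ξ x = 0 := by
  have hG := hv.metric_zero
  have hT := hv.isOpen_time
  have h0 := hv.zero_mem
  have hk := hH.pos
  set Q : ℝ → Fin 3 → Fin 3 → Fin 3 → ℝ :=
    fun t m i j => covM (line G H t) (schouten (line G H t)) m x i j with hQ
  set Q' : Fin 3 → Fin 3 → Fin 3 → ℝ := fun m i j =>
    (1 / 7) * covM G (hessM G ξ) m x i j - 27 / 77 * k * pd m ξ x * G x i j with hQ'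
  have dQ : ∀ m i j, HasDerivAt (fun t => Q t m i j) (Q' m i j) 0 :=
    hv.hasDerivAt_covM_schouten hH hξ hS hd hκk hx
  have hQ0 : ∀ m i j, Q 0 m i j = 0 := by
    intro m i j
    simp only [hQ, line_zero]
    rw [covM_congr hG.isOpen hx (fun y hy => hH.schouten_eq hG hy),
      covM_const_smul _ hG.smooth hx, hG.covM_metric hx]
    simp
  have dG : ∀ a b, HasDerivAt (fun t => line G H t x a b) (H x a b) 0 := by
    intro a b
    have h := (hv.smooth_line a b).hasDerivAt h0 hx
    have e : dot (fun t y => line G H t y a b) x = H x a b := by rw [← dotM_line G H x]; rfl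
    rwa [e] at h
  have dd : ∀ j, HasDerivAt (fun t => ∑ m, ∑ i, (line G H t x)⁻¹ m i * Q t m i j)
      (∑ m, ∑ i, (G x)⁻¹ m i * Q' m i j) 0 := by
    intro j
    refine HasDerivAt.fun_sum fun m _ => HasDerivAt.fun_sum fun i _ => ?_
    have h := ((hv.smooth_inv m i).hasDerivAt h0 hx).mul (dQ m i j)
    simpa [hQ0, line_zero] using! h
  -- the coefficient of `dξ ∧ g` in the linearized Yang-Mills equation
  have main : ∀ j m l, pd l ξ x * G x j m - pd m ξ x * G x j l = 0 := by
    intro j m l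
    have dr := (hv.smooth_riemGrad hξ j m l).hasDerivAt_time_mul h0 hx
    have h := (((((dQ l j m).sub ((dd m).mul (dG j l))).add ((dd l).mul (dG j m))).sub
      (dQ m j l)).neg).add dr
    have h' := h.unique ((hd.yangMills x hx j m l).congr_of_eventuallyEq
      (Filter.eventually_of_mem (hT.mem_nhds h0) fun t ht => by
        simp only [Pi.add_apply, Pi.sub_apply, Pi.mul_apply, Pi.neg_apply]
        rw [yangMillsOp, riemGrad_dilatonLine hξ hx, (hv.metric t ht).codiffRiem_eq hx]))
    simp only [line_zero, hQ0, mul_zero, Finset.sum_const_zero, zero_mul, add_zero] at h'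
    have hrg : riemGrad G ξ j m l x = -k * (pd l ξ x * G x j m - pd m ξ x * G x j l) := by
      have e1 := hG.contract_metric hx (fun p => pd p ξ x) l
      have e2 := hG.contract_metric hx (fun p => pd p ξ x) m
      rw [← e1, ← e2, riemGrad, Finset.sum_comm, Finset.sum_mul, Finset.sum_mul,
        ← Finset.sum_sub_distrib, Finset.mul_sum]
      refine Finset.sum_congr rfl fun p _ => ?_
      rw [Finset.sum_mul, Finset.sum_mul, ← Finset.sum_sub_distrib, Finset.mul_sum]
      refine Finset.sum_congr rfl fun q _ => ?_
      rw [hH.riem_eq hG hx, ginv, hG.inv_symm hx q p]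
      ring
    have hdiv : ∀ j, ∑ m, ∑ i, (G x)⁻¹ m i * Q' m i j = -(73 / 77) * k * pd j ξ x := by
      intro j
      have e : ∀ m i, (G x)⁻¹ m i * Q' m i j = (1 / 7) * ((G x)⁻¹ m i *
          covM G (hessM G ξ) m x i j) - 27 / 77 * k * ((G x)⁻¹ m i * (G x i j * pd m ξ x)) := by
        intro m i; simp only [hQ']; ring
      simp only [e, Finset.sum_sub_distrib, ← Finset.mul_sum]
      rw [hG.contract_metric hx, hH.div_hessM hG hξ hx,
        pd_congr hG.isOpen hx (fun y hy => hv.linearized_dilaton hH hξ hS hd hκk hy),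
        pd_const_mul hξ hx]
      ring
    have hQQ : Q' l j m - Q' m j l = -(16 / 77) * k * (pd l ξ x * G x j m - pd m ξ x * G x j l) := by
      have h1 := hH.covM_hessM_sub hG hξ hx l m j
      simp only [hQ']
      rw [hG.covM_hessM_symm hξ hx l j m, hG.covM_hessM_symm hξ hx m j l, hG.symm hx j m,
        hG.symm hx j l]
      linear_combination (1 / 7) * h1
    rw [hdiv, hdiv, hrg] at h'
    have h'' : (12 / 77 * k) * (pd l ξ x * G x j m - pd m ξ x * G x j l) = 0 := by
      linear_combination h' + hQQ
    exact (mul_eq_zero.1 h'').resolve_left (by positivity)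
  have h2 : ∑ j, ∑ m, (G x)⁻¹ j m * (pd l ξ x * G x j m - pd m ξ x * G x j l) = 0 := by
    simp [main]
  have e : ∀ j m, (G x)⁻¹ j m * (pd l ξ x * G x j m - pd m ξ x * G x j l) =
      pd l ξ x * ((G x)⁻¹ j m * G x j m) - (G x)⁻¹ m j * (G x j l * pd m ξ x) := by
    intro j m; rw [hG.inv_symm hx m j]; ring
  simp only [e, Finset.sum_sub_distrib, ← Finset.mul_sum] at h2
  rw [contract_eq_trace _ _ (hG.inv_transpose hx), hG.trace_metric hx,
    Finset.sum_comm (f := fun j m => (G x)⁻¹ m j * (G x j l * pd m ξ x)),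
    hG.contract_metric hx] at h2
  linarith

theorem hessM_dilaton_eq_zero (hx : x ∈ V) : hessM G ξ x = 0 := by
  ext a b
  have h : ∀ y ∈ V, ∀ l, pd l ξ y = 0 := fun y hy l =>
    hv.pd_dilaton_eq_zero hH hξ hS hd hκk hy l
  simp only [hessM, hess, h x hx, mul_zero, Finset.sum_const_zero, sub_zero, Matrix.zero_apply]
  rw [pd_congr hv.isOpen hx (fun y hy => h y hy b), pd_const]

theorem dilaton_eq_zero (hx : x ∈ V) : ξ x = 0 := by
  have h := hv.linearized_dilaton hH hξ hS hd hκk hx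
  rw [hv.hessM_dilaton_eq_zero hH hξ hS hd hκk hx] at h
  simp only [mul_zero, Matrix.trace_zero] at h
  have hk := hH.pos
  have : (24 / 11 * k) * ξ x = 0 := by linarith
  exact (mul_eq_zero.1 this).resolve_left (by positivity)

/-- The metric variation of a deformation preserves the Einstein equation to first order. -/
theorem dotM_ricM_eq (hx : x ∈ V) :
    dotM (fun t => ricM (line G H t)) x = (-(2 * k)) • H x := by
  have h := hv.linearized_einstein hH hξ hS hd hκk hx
  rw [hv.hessM_dilaton_eq_zero hH hξ hS hd hκk hx, hv.dilaton_eq_zero hH hξ hS hd hκk hx] at h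
  simp only [mul_zero, zero_smul, sub_zero] at h
  rw [neg_smul]
  exact eq_neg_of_add_eq_zero_left ((smul_eq_zero.1 h).resolve_left (by norm_num))

end IsVariation

end HeteroticSoliton

end

noncomputable section

namespace HeteroticSoliton

open scoped Topology Matrix

/-! ### A Bochner formula for infinitesimal Einstein deformations -/

/-- The three-tensor `T_{bac}`, as a function of `T_{abc}`. -/
def exch (T : Fin 3 → E3 → Mat) (a : Fin 3) (x : E3) : Mat := fun b c => T b x a c

/-- The one-form `w_a = h^{bc} (∇_a h_{bc} - ∇_b h_{ac}) + h_a^b ∂_b (tr h)`. -/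
def bochnerForm (G H : E3 → Mat) (a : Fin 3) (x : E3) : ℝ :=
  ((G x)⁻¹ * H x * (G x)⁻¹ * (covM G H a x - exch (covM G H) a x)ᵀ).trace +
    ∑ b, (H x * (G x)⁻¹) a b * pd b (fun y => ((G y)⁻¹ * H y).trace) x

/-- The divergence of a one-form. -/
def divForm (G : E3 → Mat) (w : Fin 3 → E3 → ℝ) (x : E3) : ℝ :=
  ∑ m, ∑ a, (G x)⁻¹ m a * (pd m (w a) x - ∑ p, chr G m a p x * w p x)

variable {U : Set E3} {x : E3} {G H A : E3 → Mat} {T T' : Fin 3 → E3 → Mat} {k : ℝ} {u : E3 → ℝ}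

theorem smooth_exch (hT : ∀ a, SmM U (T a)) (a : Fin 3) : SmM U (exch T a) :=
  fun b c => hT b a c

theorem cov3_exch (G : E3 → Mat) (T : Fin 3 → E3 → Mat) (m i : Fin 3) (x : E3) (j l : Fin 3) :
    cov3 G (exch T) m i x j l = cov3 G T m j x i l := by
  simp only [cov3, Matrix.sub_apply, Matrix.mul_apply, Matrix.sum_apply, Matrix.smul_apply,
    Matrix.transpose_apply, chrM, exch, smul_eq_mul, dM]
  ring

theorem cov3_sub (hT : ∀ a, SmM U (T a)) (hT' : ∀ a, SmM U (T' a)) (hx : x ∈ U) (m i : Fin 3) :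
    cov3 G (fun a y => T a y - T' a y) m i x = cov3 G T m i x - cov3 G T' m i x := by
  simp only [cov3, dM_sub (hT i) (hT' i) hx, smul_sub, Finset.sum_sub_distrib]
  noncomm_ring

namespace IsMetricOn

variable (hG : IsMetricOn U G)
include hG

/-- Leibniz rule for the contraction of a two-tensor with the last two slots of a three-tensor. -/
theorem cov_contract (hA : SmM U A) (hT : ∀ a, SmM U (T a)) (hx : x ∈ U) (m a : Fin 3) :
    pd m (fun y => ((G y)⁻¹ * A y * (G y)⁻¹ * (T a y)ᵀ).trace) x
      - ∑ p, chr G m a p x * ((G x)⁻¹ * A x * (G x)⁻¹ * (T p x)ᵀ).trace =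
    ((G x)⁻¹ * covM G A m x * (G x)⁻¹ * (T a x)ᵀ).trace
      + ((G x)⁻¹ * A x * (G x)⁻¹ * (cov3 G T m a x)ᵀ).trace := by
  have hn := hG.smooth_inv
  rw [pd_trace (((hn.mul hA).mul hn).mul (hT a).transpose) hx,
    dM_mul ((hn.mul hA).mul hn) (hT a).transpose hx, dM_mul (hn.mul hA) hn hx,
    dM_mul hn hA hx, hG.dM_inv hx, dM_transpose]
  simp only [covM, cov3, Matrix.transpose_sub, Matrix.transpose_mul, Matrix.transpose_transpose,
    Matrix.transpose_sum, Matrix.transpose_smul, mul_sub, sub_mul, add_mul,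
    Matrix.trace_sub, Matrix.trace_add, Finset.mul_sum, Matrix.trace_sum, Matrix.mul_smul,
    Matrix.trace_smul, smul_eq_mul, neg_mul, mul_neg, Matrix.trace_neg, ← mul_assoc]
  have h := Matrix.trace_mul_comm (chrM G m x)ᵀ ((G x)⁻¹ * A x * (G x)⁻¹ * (T a x)ᵀ)
  simp only [← mul_assoc] at h
  linarith

/-- Leibniz rule for the one-form `h(grad u, ·)`. -/
theorem cov_contract_grad (hA : SmM U A) (hu : Sm U u) (hx : x ∈ U) (m a : Fin 3) :
    pd m (fun y => ∑ b, (A y * (G y)⁻¹) a b * pd b u y) x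
      - ∑ p, chr G m a p x * ∑ b, (A x * (G x)⁻¹) p b * pd b u x =
    ∑ b, ((covM G A m x * (G x)⁻¹) a b * pd b u x + (A x * (G x)⁻¹) a b * hessM G u x m b) := by
  have hn := hG.smooth_inv
  have s := hA.mul hn
  have e : ∀ b, pd m (fun y => (A y * (G y)⁻¹) a b) x =
      (dM m A x * (G x)⁻¹ - A x * (G x)⁻¹ * chrM G m x - A x * (chrM G m x)ᵀ * (G x)⁻¹) a b := by
    intro b
    have h := congrFun (congrFun (dM_mul hA hn hx (m := m)) a) b
    rw [hG.dM_inv hx] at h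
    refine h.trans ?_
    rw [mul_sub, mul_neg, ← mul_assoc, ← mul_assoc, sub_eq_add_neg, sub_eq_add_neg, sub_eq_add_neg,
      add_assoc]
  rw [pd_sum (fun b _ => (s a b).mul (hu.pd b)) hx]
  simp only [pd_mul (s a _) (hu.pd _) hx, e, covM, hessM, hess, sub_mul]
  rw [mul_assoc (chrM G m x)]
  generalize A x * (G x)⁻¹ = B
  generalize A x * (chrM G m x)ᵀ * (G x)⁻¹ = C
  generalize dM m A x * (G x)⁻¹ = D
  simp only [Matrix.sub_apply, Matrix.mul_apply, chrM, Fin.sum_univ_three]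
  ring

theorem smooth_bochnerForm (hH : SmM U H) (a : Fin 3) : Sm U (bochnerForm G H a) := by
  have hn := hG.smooth_inv
  have hD := hG.smooth_covM hH
  exact ((((hn.mul hH).mul hn).mul ((hD a).sub (smooth_exch hD a)).transpose).trace).add
    (Sm.sum fun b _ => ((hH.mul hn) a b).mul ((hn.mul hH).trace.pd b))

theorem divForm_bochnerForm (hH : SmM U H) (hx : x ∈ U) : divForm G (bochnerForm G H) x =
    ∑ m, ∑ a, (G x)⁻¹ m a *
      (((G x)⁻¹ * covM G H m x * (G x)⁻¹ * (covM G H a x - exch (covM G H) a x)ᵀ).trace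
      + ((G x)⁻¹ * H x * (G x)⁻¹ *
        (cov3 G (covM G H) m a x - cov3 G (exch (covM G H)) m a x)ᵀ).trace
      + ∑ b, ((covM G H m x * (G x)⁻¹) a b * pd b (fun y => ((G y)⁻¹ * H y).trace) x
        + (H x * (G x)⁻¹) a b * hessM G (fun y => ((G y)⁻¹ * H y).trace) x m b)) := by
  have hn := hG.smooth_inv
  have hD := hG.smooth_covM hH
  have hu := (hn.mul hH).trace
  refine Finset.sum_congr rfl fun m _ => Finset.sum_congr rfl fun a _ => ?_
  congr 1
  have hT : ∀ a, SmM U (fun y => covM G H a y - exch (covM G H) a y) :=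
    fun a => (hD a).sub (smooth_exch hD a)
  have h1 := hG.cov_contract hH hT hx m a
  rw [cov3_sub hD (smooth_exch hD) hx] at h1
  rw [← h1, ← hG.cov_contract_grad hH hu hx m a]
  change pd m (fun y => _ + _) x - _ = _
  rw [pd_add ((((hn.mul hH).mul hn).mul (hT a).transpose).trace)
    (Sm.sum fun b _ => ((hH.mul hn) a b).mul (hu.pd b)) hx]
  simp only [bochnerForm, mul_add, Finset.sum_add_distrib]
  ring

/-- The Hessian of the trace of `h` is the trace of the second covariant derivative of `h`. -/
theorem hessM_trace (hH : SmM U H) (hx : x ∈ U) (m b : Fin 3) :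
    hessM G (fun y => ((G y)⁻¹ * H y).trace) x m b =
      ((G x)⁻¹ * cov3 G (covM G H) m b x).trace := by
  have e : ∀ b, ∀ y ∈ U, pd b (fun y => ((G y)⁻¹ * H y).trace) y =
      ((G y)⁻¹ * covM G H b y).trace := fun b y hy => (hG.trace_covM hH hy b).symm
  rw [hessM, hess, pd_congr hG.isOpen hx (e b), ← hG.trace_covM (hG.smooth_covM hH b) hx]
  have : ∀ k, pd k (fun y => ((G y)⁻¹ * H y).trace) x = ((G x)⁻¹ * covM G H k x).trace :=
    fun k => e k x hx
  simp only [this, cov3, covM, mul_sub, Matrix.trace_sub, Finset.mul_sum, Matrix.trace_sum,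
    Matrix.mul_smul, Matrix.trace_smul, smul_eq_mul]

end IsMetricOn

theorem hat2_mul (F : Mat) (X Y : Fin 3 → ℝ) (a b : Fin 3) :
    hat2 F (fun i j => X i * Y j) a b = (∑ i, F i a * X i) * ∑ j, F j b * Y j := by
  simp only [hat2, Finset.sum_mul, Finset.mul_sum]
  rw [Finset.sum_comm]
  exact Finset.sum_congr rfl fun i _ => Finset.sum_congr rfl fun j _ => by ring

/-- The components of a three-tensor in the frame formed by the columns of `F`. -/
def hat3 (F : Mat) (T : Fin 3 → Mat) (a b c : Fin 3) : ℝ := ∑ i, F i a * hat2 F (T i) b c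

theorem hat3_exch (F : Mat) (T : Fin 3 → E3 → Mat) (x : E3) (a b c : Fin 3) :
    hat3 F (fun i => exch T i x) a b c = hat3 F (fun i => T i x) b a c := by
  simp only [hat3, hat2, exch, Finset.mul_sum]
  rw [Finset.sum_comm]
  exact Finset.sum_congr rfl fun i _ => Finset.sum_congr rfl fun j _ =>
    Finset.sum_congr rfl fun l _ => by ring

theorem IsFrame.trace_mul {G F : Mat} (hF : IsFrame G F) (X Y : Mat) :
    (G⁻¹ * X * G⁻¹ * Yᵀ).trace = ∑ b, ∑ c, hat2 F X b c * hat2 F Y b c := by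
  have h : (G⁻¹ * X * G⁻¹ * Yᵀ).trace = ((Fᵀ * X * F) * (Fᵀ * Y * F)ᵀ).trace := by
    rw [← hF.mul_transpose, Matrix.transpose_mul, Matrix.transpose_mul, Matrix.transpose_transpose]
    rw [show F * Fᵀ * X * (F * Fᵀ) * Yᵀ = F * (Fᵀ * X * F * Fᵀ * Yᵀ) by noncomm_ring,
      Matrix.trace_mul_comm]
    congr 1
    noncomm_ring
  rw [h]
  simp only [hat2_eq_mul]
  generalize Fᵀ * X * F = P
  generalize Fᵀ * Y * F = Q
  simp only [Matrix.trace, Matrix.diag, Matrix.mul_apply, Matrix.transpose_apply]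


theorem cov3_symm (hU : IsOpen U) (hx : x ∈ U) (hT : ∀ a, ∀ y ∈ U, (T a y)ᵀ = T a y)
    (m i j l : Fin 3) : cov3 G T m i x j l = cov3 G T m i x l j := by
  have h : (cov3 G T m i x)ᵀ = cov3 G T m i x := by
    simp only [cov3, Matrix.transpose_sub, Matrix.transpose_mul, Matrix.transpose_transpose,
      Matrix.transpose_sum, Matrix.transpose_smul, ← dM_transpose, hT _ x hx]
    rw [dM_congr hU hx (hT i)]
    abel
  exact congrFun (congrFun h l) j

/-- Ricci identity for symmetric two-tensors on a hyperbolic manifold. -/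
theorem IsHyperbolic.cov3_sub_cov3 (hP : IsHyperbolic U G k) (hG : IsMetricOn U G) (hH : SmM U H)
    (hHs : ∀ y ∈ U, (H y)ᵀ = H y) (hx : x ∈ U) (m i j l : Fin 3) :
    cov3 G (covM G H) m i x j l - cov3 G (covM G H) i m x j l =
      k * (H x m l * G x i j - G x m j * H x i l + H x m j * G x i l - G x m l * H x i j) := by
  have h := congrFun (congrFun (hG.ricci_identity hH hx m i) j) l
  have e : H x * (curvM G m i x)ᵀ = (curvM G m i x * H x)ᵀ := by
    rw [Matrix.transpose_mul, hHs x hx]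
  rw [e] at h
  simp only [Matrix.sub_apply, Matrix.neg_apply, Matrix.transpose_apply,
    hP.curvM_mul hG (H x) hx] at h
  linarith

namespace IsMetricOn

variable (hG : IsMetricOn U G)
include hG

/-- The derivative of the equation `div h = 0`. -/
theorem trace_cov3_eq_zero (hH : SmM U H) (hHs : ∀ y ∈ U, (H y)ᵀ = H y)
    (hdiv : ∀ y ∈ U, ∀ j, ∑ m, ∑ i, (G y)⁻¹ m i * covM G H m y i j = 0) (hx : x ∈ U)
    (m j : Fin 3) : ∑ a, ∑ i, (G x)⁻¹ a i * cov3 G (covM G H) m a x j i = 0 := by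
  have hD := hG.smooth_covM hH
  have e : ∀ y ∈ U, ∀ X : Mat, ((G y)⁻¹ * G y * (G y)⁻¹ * Xᵀ).trace =
      ∑ a, ∑ i, (G y)⁻¹ a i * X a i := by
    intro y hy X
    rw [hG.inv_mul hy, one_mul]
    simp only [Matrix.trace, Matrix.diag, Matrix.mul_apply, Matrix.transpose_apply]
  have hz : ∀ y ∈ U, ∀ j,
      ((G y)⁻¹ * G y * (G y)⁻¹ * (exch (covM G H) j y)ᵀ).trace = 0 := by
    intro y hy j
    rw [e y hy, ← hdiv y hy j]
    exact Finset.sum_congr rfl fun a _ => Finset.sum_congr rfl fun i _ => by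
      rw [exch, covM_symm hG.isOpen hy hHs]
  have h := hG.cov_contract hG.smooth (smooth_exch hD) hx m j
  rw [pd_congr (f₂ := fun _ => 0) hG.isOpen hx (fun y hy => hz y hy j), pd_const, hG.covM_metric hx,
    e x hx] at h
  simp only [hz x hx, mul_zero, Finset.sum_const_zero, sub_zero, zero_mul, Matrix.trace_zero,
    zero_add, cov3_exch] at h
  exact h.symm

end IsMetricOn

/-- The algebra of the Bochner formula, in an orthonormal frame: `h`, `d`, `q` are the components of
an infinitesimal Einstein deformation and of its first and second covariant derivatives. -/
theorem bochner_algebra {h : Fin 3 → Fin 3 → ℝ} {d : Fin 3 → Fin 3 → Fin 3 → ℝ}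
    {q : Fin 3 → Fin 3 → Fin 3 → Fin 3 → ℝ} {δ : Fin 3 → Fin 3 → ℝ}
    (hδ : ∀ a b, δ a b = if a = b then 1 else 0) (hs : ∀ a b, h a b = h b a)
    (qs : ∀ a b c e, q a b c e = q a b e c)
    (qc : ∀ a b c e, q a b c e - q b a c e =
      k * (h a e * δ b c - δ a c * h b e + h a c * δ b e - δ a e * h b c))
    (qd : ∀ b c, ∑ e, q b e c e = 0)
    (qr : ∀ a b, ∑ e, (1 / 2) * (q e a b e + q e b a e - q e e a b - q a b e e) =
      -(2 * k) * h a b) :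
    ∑ e, ∑ b, ∑ c, d e b c * (d e b c - d b e c) + ∑ e, ∑ b, ∑ c, h b c * (q e e b c - q e b e c)
      + ∑ b, ∑ c, h b c * ∑ e, q b c e e =
    (1 / 2) * ∑ a, ∑ b, ∑ c, (d a b c - d b a c) ^ 2 + k * ∑ a, ∑ b, h a b ^ 2
      + k * (∑ a, h a a) ^ 2 := by
  have main : ∀ b c, ∑ e, (q e e b c - q e b e c + q b c e e) =
      k * h b c + k * (∑ e, h e e) * δ b c := by
    have h1 : ∀ b c, ∑ e, q e b c e = k * (∑ e, h e e) * δ b c - 3 * k * h b c := by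
      intro b c
      have e1 : ∀ e, q e b c e = q b e c e +
          k * (h e e * δ b c - δ e c * h b e + h e c * δ b e - δ e e * h b c) := fun e => by
        rw [← qc]; ring
      simp only [e1, Finset.sum_add_distrib, qd, hδ]
      rw [← Finset.mul_sum]
      simp only [Finset.sum_add_distrib, Finset.sum_sub_distrib, ite_mul, mul_ite, one_mul,
        zero_mul, mul_one, mul_zero, Finset.sum_ite_eq, Finset.sum_ite_eq', Finset.mem_univ,
        if_true, Finset.sum_const, Finset.card_univ, Fintype.card_fin, nsmul_eq_mul]
      by_cases hbc : b = c <;> simp [hbc] <;> ring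
    intro b c
    have h2 := qr b c
    rw [← Finset.mul_sum] at h2
    simp only [Finset.sum_add_distrib, Finset.sum_sub_distrib, h1] at h2 ⊢
    have h3 : ∑ e, q e b e c = ∑ e, q e b c e := Finset.sum_congr rfl fun e _ => qs e b e c
    have h4 : δ c b = δ b c := by simp only [hδ, eq_comm]
    rw [h3, h1]
    rw [h4, hs c b] at h2
    linarith
  have e1 : ∑ e, ∑ b, ∑ c, h b c * (q e e b c - q e b e c) + ∑ b, ∑ c, h b c * ∑ e, q b c e e =
      k * ∑ a, ∑ b, h a b ^ 2 + k * (∑ a, h a a) ^ 2 := by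
    have e2 : ∑ b, ∑ c, h b c * (∑ e, (q e e b c - q e b e c + q b c e e)) =
      k * ∑ a, ∑ b, h a b ^ 2 + k * (∑ a, h a a) ^ 2 := by
      simp only [main, hδ]
      simp [Fin.sum_univ_three]
      ring
    rw [← e2, Finset.sum_comm, ← Finset.sum_add_distrib]
    refine Finset.sum_congr rfl fun b _ => ?_
    rw [Finset.sum_comm, ← Finset.sum_add_distrib]
    refine Finset.sum_congr rfl fun c _ => ?_
    rw [Finset.sum_add_distrib, mul_add, Finset.mul_sum, Finset.mul_sum]
  have e3 : ∑ e, ∑ b, ∑ c, d e b c * (d e b c - d b e c) =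
      (1 / 2) * ∑ a, ∑ b, ∑ c, (d a b c - d b a c) ^ 2 := by
    simp only [Fin.sum_univ_three]
    ring
  rw [add_assoc, e1, e3]
  ring

theorem hat4_sub_hat4 (F : Mat) {R : Fin 3 → Fin 3 → Fin 3 → Fin 3 → ℝ} {h g : Fin 3 → Fin 3 → ℝ}
    (hR : ∀ i j l m, R i j l m - R j i l m =
      k * (h i m * g j l - g i l * h j m + h i l * g j m - g i m * h j l)) (a b c e : Fin 3) :
    hat4 F R a b c e - hat4 F R b a c e = k * (hat2 F h a e * hat2 F g b c
      - hat2 F g a c * hat2 F h b e + hat2 F h a c * hat2 F g b e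
      - hat2 F g a e * hat2 F h b c) := by
  have s : ∀ X Y : Fin 3 → Fin 3 → ℝ, hat2 F (fun i j => hat2 F (fun l m => X i m * Y j l) c e) a b =
      hat2 F X a e * hat2 F Y b c := by
    intro X Y
    rw [← hat2_hat2_mul]
    exact congrArg (fun Z => hat2 F Z a b) (funext fun i => funext fun j =>
      hat2_swap F (fun l m => X i l * Y j m) c e)
  rw [hat4, hat4, ← hat2_swap F (fun i j => hat2 F (R i j) c e) a b, ← hat2_sub]
  simp only [← hat2_sub, hR]
  simp only [hat2_mul_left, hat2_sub, hat2_add]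
  rw [s, hat2_hat2_mul, hat2_hat2_mul, s]

/-- On a hyperbolic manifold, the divergence of the Bochner form of a divergence-free infinitesimal
Einstein deformation `h` is, in an orthonormal frame,
`½ |∇_a h_{bc} - ∇_b h_{ac}|² + k |h|² + k (tr h)²`. -/
theorem IsHyperbolic.exists_divForm_bochnerForm (hP : IsHyperbolic U G k) (hG : IsMetricOn U G)
    (hH : SmM U H) (hHs : ∀ y ∈ U, (H y)ᵀ = H y)
    (hdiv : ∀ y ∈ U, ∀ j, ∑ m, ∑ i, (G y)⁻¹ m i * covM G H m y i j = 0) (hx : x ∈ U)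
    (hric : ∀ a b, ∑ i, ∑ l, (G x)⁻¹ i l * ((1 / 2) *
      (cov3 G (covM G H) i a x b l + cov3 G (covM G H) i b x a l
        - cov3 G (covM G H) i l x a b - cov3 G (covM G H) a b x i l)) = -(2 * k) * H x a b) :
    ∃ F, IsFrame (G x) F ∧ ∃ d : Fin 3 → Fin 3 → Fin 3 → ℝ, divForm G (bochnerForm G H) x =
      (1 / 2) * ∑ a, ∑ b, ∑ c, (d a b c - d b a c) ^ 2
        + k * ∑ a, ∑ b, hat2 F (fun i j => H x i j) a b ^ 2
        + k * (∑ a, hat2 F (fun i j => H x i j) a a) ^ 2 := by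
  obtain ⟨F, hF⟩ := exists_isFrame (hG.posDef x hx)
  set d : Fin 3 → Fin 3 → Fin 3 → ℝ := hat3 F (fun i => covM G H i x) with hd
  set R : Fin 3 → Fin 3 → Fin 3 → Fin 3 → ℝ := fun m i j l => cov3 G (covM G H) m i x j l with hR
  refine ⟨F, hF, d, ?_⟩
  have hDs : ∀ a, ∀ y ∈ U, (covM G H a y)ᵀ = covM G H a y := fun a y hy => by
    ext i j
    exact covM_symm hG.isOpen hy hHs a j i
  have hsym : ∀ i j, H x i j = H x j i := fun i j => by
    conv_lhs => rw [← hHs x hx]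
    rfl
  rw [← bochner_algebra (q := hat4 F R) (δ := hat2 F (fun i j => G x i j)) hF.hat2_metric]
  · rw [hG.divForm_bochnerForm hH hx]
    have t1 : ∑ m, ∑ a, (G x)⁻¹ m a * ((G x)⁻¹ * covM G H m x * (G x)⁻¹ *
        (covM G H a x - exch (covM G H) a x)ᵀ).trace =
        ∑ e, ∑ b, ∑ c, d e b c * (d e b c - d b e c) := by
      simp only [hF.trace_mul]
      rw [hF.contract (fun m a => ∑ b, ∑ c, hat2 F (covM G H m x) b c *
        hat2 F (covM G H a x - exch (covM G H) a x) b c)]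
      simp only [hat2_sum, hat2_mul]
      refine Finset.sum_congr rfl fun e _ => Finset.sum_congr rfl fun b _ =>
        Finset.sum_congr rfl fun c _ => ?_
      have hs : ∀ a, hat2 F (covM G H a x - exch (covM G H) a x) b c =
          hat2 F (covM G H a x) b c - hat2 F (exch (covM G H) a x) b c := fun a =>
        hat2_sub F (covM G H a x) (exch (covM G H) a x) b c
      have he := hat3_exch F (covM G H) x e b c
      simp only [hs, mul_sub, Finset.sum_sub_distrib]
      rw [hd, ← he]
      simp only [hat3]
    have t2 : ∑ m, ∑ a, (G x)⁻¹ m a * ((G x)⁻¹ * H x * (G x)⁻¹ *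
        (cov3 G (covM G H) m a x - cov3 G (exch (covM G H)) m a x)ᵀ).trace =
        ∑ e, ∑ b, ∑ c, hat2 F (fun i j => H x i j) b c * (hat4 F R e e b c - hat4 F R e b e c) := by
      simp only [hF.trace_mul]
      rw [hF.contract (fun m a => ∑ b, ∑ c, hat2 F (H x) b c *
        hat2 F (cov3 G (covM G H) m a x - cov3 G (exch (covM G H)) m a x) b c)]
      simp only [hat2_sum, hat2_mul_left]
      refine Finset.sum_congr rfl fun e _ => Finset.sum_congr rfl fun b _ =>
        Finset.sum_congr rfl fun c _ => ?_
      congr 1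
      have hs : ∀ m a, hat2 F (cov3 G (covM G H) m a x - cov3 G (exch (covM G H)) m a x) b c =
          hat2 F (R m a) b c - hat2 F (fun i j => R m i a j) b c := fun m a => by
        rw [← hat2_sub]
        refine congrArg (fun X => hat2 F X b c) (funext fun i => funext fun j => ?_)
        rw [Matrix.sub_apply, cov3_exch]
      simp only [hs, hat2_sub]
      rw [hat4, hat4, hat2_hat2_comm]
    have t3 : ∑ m, ∑ a, (G x)⁻¹ m a * ∑ b, (covM G H m x * (G x)⁻¹) a b *
        pd b (fun y => ((G y)⁻¹ * H y).trace) x = 0 := by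
      generalize (fun y => ((G y)⁻¹ * H y).trace) = u
      have h : ∀ b, ∑ m, ∑ a, (G x)⁻¹ m a * (covM G H m x * (G x)⁻¹) a b = 0 := by
        intro b
        simp only [Matrix.mul_apply, Finset.mul_sum, ← mul_assoc]
        calc _ = ∑ m, ∑ j, ∑ a, (G x)⁻¹ m a * covM G H m x a j * (G x)⁻¹ j b :=
              Finset.sum_congr rfl fun m _ => Finset.sum_comm
          _ = ∑ j, (∑ m, ∑ a, (G x)⁻¹ m a * covM G H m x a j) * (G x)⁻¹ j b := by
              rw [Finset.sum_comm]
              simp only [Finset.sum_mul]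
          _ = 0 := by simp only [hdiv x hx, zero_mul, Finset.sum_const_zero]
      calc _ = ∑ b, (∑ m, ∑ a, (G x)⁻¹ m a * (covM G H m x * (G x)⁻¹) a b) * pd b u x := by
            simp only [Fin.sum_univ_three]
            ring
        _ = 0 := by simp only [h, zero_mul, Finset.sum_const_zero]
    have t4 : ∑ m, ∑ a, (G x)⁻¹ m a * ∑ b, (H x * (G x)⁻¹) a b *
        hessM G (fun y => ((G y)⁻¹ * H y).trace) x m b =
        ∑ b, ∑ c, hat2 F (fun i j => H x i j) b c * ∑ e, hat4 F R b c e e := by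
      have h : ∀ b c, hat2 F (hessM G (fun y => ((G y)⁻¹ * H y).trace) x) b c =
          ∑ e, hat4 F R b c e e := by
        intro b c
        simp only [hat4, ← hat2_sum]
        congr; ext m i
        rw [hG.hessM_trace hH hx, ← contract_eq_trace _ (cov3 G (covM G H) m i x)
          (hG.inv_transpose hx)]
        exact hF.contract (R m i)
      simp only [← h]
      rw [← hF.trace_mul (H x) (hessM G (fun y => ((G y)⁻¹ * H y).trace) x), mul_assoc, mul_assoc,
        ← mul_assoc (H x)]
      generalize hessM G (fun y => ((G y)⁻¹ * H y).trace) x = Z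
      generalize H x * (G x)⁻¹ = K
      simp only [Matrix.trace, Matrix.diag, Matrix.mul_apply, Matrix.transpose_apply]
    simp only [mul_add, Finset.sum_add_distrib] at t1 t2 t3 t4 ⊢
    rw [t1, t2, t3, t4]
    ring
  · intro a b
    rw [← hat2_swap]
    simp only [hsym]
  · intro a b c e
    simp only [hat4]
    congr; ext i j
    rw [← hat2_swap]
    congr; ext l m
    exact cov3_symm hG.isOpen hx hDs i j m l
  · exact hat4_sub_hat4 F fun i j l m => hP.cov3_sub_cov3 hG hH hHs hx i j l m
  · intro b c
    simp only [hat4]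
    rw [Finset.sum_congr rfl fun e _ => hat2_hat2_comm F R b e c e, ← hat2_sum]
    simp only [← hF.contract, hR, hG.trace_cov3_eq_zero hH hHs hdiv hx]
    simp [hat2]
  · intro c d
    rw [← hat2_mul_left]
    simp only [← hric]
    have e : ∀ a b, ∑ i, ∑ l, (G x)⁻¹ i l * ((1 / 2) * (R i a b l + R i b a l - R i l a b
        - R a b i l)) = ∑ e, (1 / 2) * (hat2 F (fun i l => R i a b l) e e
          + hat2 F (fun i l => R i b a l) e e - hat2 F (fun i l => R i l a b) e e
          - hat2 F (fun i l => R a b i l) e e) := by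
      intro a b
      rw [hF.contract (fun i l => (1 / 2) * (R i a b l + R i b a l - R i l a b - R a b i l))]
      simp only [hat2_mul_left, hat2_sub, hat2_add]
    simp only [hR] at e
    simp only [e, hat2_sum, hat2_mul_left, hat2_sub, hat2_add]
    refine Finset.sum_congr rfl fun e _ => ?_
    congr 1
    have h1 : ∀ c d, hat2 F (fun a b => hat2 F (fun i l => R i a b l) e e) c d =
        hat4 F R e c d e := by
      intro c d
      rw [hat4, hat2_hat2_comm, ← hat2_swap]
    rw [← h1 c d, ← h1 d c, ← hat2_swap F _ c d]
    have h3 : hat2 F (fun a b => hat2 F (fun i l => R i l a b) e e) c d = hat4 F R e e c d :=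
      hat2_hat2_comm' F (fun a b i l => R i l a b) c d e e
    rw [← h3]
    rfl

end HeteroticSoliton

end

noncomputable section

namespace HeteroticSoliton

open scoped Topology Matrix

/-! ### The divergence as a total derivative -/

variable {U U' : Set E3} {x : E3} {G G' H H' A A' : E3 → Mat} {k : ℝ} {f : E3 → ℝ}

/-- The density of the Riemannian volume. -/
def volDensity (G : E3 → Mat) (x : E3) : ℝ := √(G x).det

/-- The vector density `√(det g) g^{ma} w_a`. -/
def fluxDensity (G : E3 → Mat) (w : Fin 3 → E3 → ℝ) (m : Fin 3) (x : E3) : ℝ :=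
  volDensity G x * ∑ a, (G x)⁻¹ m a * w a x

namespace IsMetricOn

variable (hG : IsMetricOn U G)
include hG

theorem volDensity_pos (hx : x ∈ U) : 0 < volDensity G x :=
  Real.sqrt_pos.2 (hG.posDef x hx).det_pos

theorem smooth_volDensity : Sm U (volDensity G) :=
  fun x hx => (hG.smooth.det x hx).sqrt (hG.det_ne hx)

theorem smooth_fluxDensity {w : Fin 3 → E3 → ℝ} (hw : ∀ a, Sm U (w a)) (m : Fin 3) :
    Sm U (fluxDensity G w m) :=
  hG.smooth_volDensity.mul (Sm.sum fun a _ => (hG.smooth_inv m a).mul (hw a))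

theorem smooth_divForm {w : Fin 3 → E3 → ℝ} (hw : ∀ a, Sm U (w a)) : Sm U (divForm G w) :=
  Sm.sum fun m _ => Sm.sum fun a _ => (hG.smooth_inv m a).mul
    (((hw a).pd m).sub (Sm.sum fun p _ => (hG.smooth_chr m a p).mul (hw p)))

theorem pd_det (hx : x ∈ U) (m : Fin 3) :
    pd m (fun y => (G y).det) x = 2 * (chrM G m x).trace * (G x).det := by
  have s := hG.smooth
  have e : ∀ i j, pd m (fun y => G y i j) x =
      (chrM G m x * G x + G x * (chrM G m x)ᵀ) i j := fun i j => by
    rw [← hG.dM_metric hx]; rfl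
  have hc : ∀ i j l i' j' l', pd m (fun y => G y i i' * G y j j' * G y l l') x =
      pd m (fun y => G y i i') x * G x j j' * G x l l' +
        G x i i' * pd m (fun y => G y j j') x * G x l l' +
        G x i i' * G x j j' * pd m (fun y => G y l l') x := by
    intro i j l i' j' l'
    rw [pd_mul ((s i i').mul (s j j')) (s l l') hx, pd_mul (s i i') (s j j') hx]
    ring
  have t := fun i j l i' j' l' => ((s i i').mul (s j j')).mul (s l l')
  simp only [Matrix.det_fin_three]
  rw [pd_sub (((((t 0 1 2 0 1 2).sub (t 0 1 2 0 2 1)).sub (t 0 1 2 1 0 2)).add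
      (t 0 1 2 1 2 0)).add (t 0 1 2 2 0 1)) (t 0 1 2 2 1 0) hx,
    pd_add ((((t 0 1 2 0 1 2).sub (t 0 1 2 0 2 1)).sub (t 0 1 2 1 0 2)).add
      (t 0 1 2 1 2 0)) (t 0 1 2 2 0 1) hx,
    pd_add (((t 0 1 2 0 1 2).sub (t 0 1 2 0 2 1)).sub (t 0 1 2 1 0 2)) (t 0 1 2 1 2 0) hx,
    pd_sub ((t 0 1 2 0 1 2).sub (t 0 1 2 0 2 1)) (t 0 1 2 1 0 2) hx,
    pd_sub (t 0 1 2 0 1 2) (t 0 1 2 0 2 1) hx]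
  simp only [hc, e]
  generalize chrM G m x = C
  simp only [Matrix.add_apply, Matrix.mul_apply, Matrix.transpose_apply, Fin.sum_univ_three,
    Matrix.trace, Matrix.diag]
  ring

theorem pd_volDensity (hx : x ∈ U) (m : Fin 3) :
    pd m (volDensity G) x = (chrM G m x).trace * volDensity G x := by
  have hpos := hG.volDensity_pos hx
  have h1 : pd m (fun y => volDensity G y * volDensity G y) x =
      2 * (chrM G m x).trace * (G x).det := by
    rw [← hG.pd_det hx]
    exact pd_congr hG.isOpen hx
      (fun y hy => Real.mul_self_sqrt (hG.posDef y hy).det_pos.le) m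
  rw [pd_mul hG.smooth_volDensity hG.smooth_volDensity hx] at h1
  have h2 : (G x).det = volDensity G x * volDensity G x :=
    (Real.mul_self_sqrt (hG.posDef x hx).det_pos.le).symm
  rw [h2] at h1
  have h3 : (2 * volDensity G x) *
      (pd m (volDensity G) x - (chrM G m x).trace * volDensity G x) = 0 := by
    linear_combination h1
  have := (mul_eq_zero.1 h3).resolve_left (by positivity)
  linarith

/-- The divergence of a one-form, multiplied by the volume density, is a sum of partial
derivatives. -/
theorem sum_pd_fluxDensity {w : Fin 3 → E3 → ℝ} (hw : ∀ a, Sm U (w a)) (hx : x ∈ U) :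
    ∑ m, pd m (fluxDensity G w m) x = volDensity G x * divForm G w x := by
  have hn := hG.smooth_inv
  have e : ∀ m a, pd m (fun y => (G y)⁻¹ m a) x =
      (-((G x)⁻¹ * chrM G m x) - (chrM G m x)ᵀ * (G x)⁻¹) m a := fun m a => by
    rw [← hG.dM_inv hx]; rfl
  have h1 : ∀ m, pd m (fluxDensity G w m) x = (chrM G m x).trace * volDensity G x *
      (∑ a, (G x)⁻¹ m a * w a x) + volDensity G x * ∑ a,
        ((-((G x)⁻¹ * chrM G m x) - (chrM G m x)ᵀ * (G x)⁻¹) m a * w a x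
          + (G x)⁻¹ m a * pd m (w a) x) := by
    intro m
    have s : ∀ a ∈ Finset.univ, Sm U (fun y => (G y)⁻¹ m a * w a y) :=
      fun a _ => (hn m a).mul (hw a)
    change pd m (fun y => volDensity G y * ∑ a, (G y)⁻¹ m a * w a y) x = _
    rw [pd_mul hG.smooth_volDensity (Sm.sum s) hx, hG.pd_volDensity hx, pd_sum s hx]
    simp only [pd_mul (hn m _) (hw _) hx, e]
  simp only [h1, divForm, Matrix.sub_apply, Matrix.neg_apply, Matrix.mul_apply,
    Matrix.transpose_apply, chrM, Matrix.trace, Matrix.diag, Fin.sum_univ_three]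
  rw [hG.chr_symm hx 1 0, hG.chr_symm hx 1 0, hG.chr_symm hx 1 0, hG.chr_symm hx 2 0,
    hG.chr_symm hx 2 0, hG.chr_symm hx 2 0, hG.chr_symm hx 2 1, hG.chr_symm hx 2 1,
    hG.chr_symm hx 2 1]
  ring

end IsMetricOn

/-! ### Changes of coordinates -/

variable {τ : E3 → E3}

theorem sum_mul_sum_mul (A B : Mat) (v : Fin 3 → ℝ) (a : Fin 3) :
    ∑ b, A a b * ∑ c, B b c * v c = ∑ c, (A * B) a c * v c := by
  simp only [Matrix.mul_apply, Finset.mul_sum, Finset.sum_mul]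
  rw [Finset.sum_comm]
  exact Finset.sum_congr rfl fun c _ => Finset.sum_congr rfl fun b _ => by ring

theorem sum_smul_mul (r : Fin 3 → ℝ) (B : Mat) (X : Fin 3 → Mat) :
    ∑ c, r c • (X c * B) = (∑ c, r c • X c) * B := by
  simp [Finset.sum_mul]

theorem sum_smul_mul_transpose (r : Fin 3 → ℝ) (B : Mat) (X : Fin 3 → Mat) :
    ∑ c, r c • (B * (X c)ᵀ) = B * (∑ c, r c • X c)ᵀ := by
  simp [Finset.mul_sum, Matrix.transpose_sum]

/-- The Jacobian matrix of `τ`, with row index the derivative. -/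
def jac (τ : E3 → E3) (x : E3) : Mat := fun i c => pd i (fun y => τ y c) x

theorem sm_coord (hτ : ∀ y ∈ U, ContDiffAt ℝ ∞ τ y) (c : Fin 3) : Sm U (fun y => τ y c) :=
  fun y hy => contDiffAt_euclidean.1 (hτ y hy) c

theorem smooth_jac (hτ : ∀ y ∈ U, ContDiffAt ℝ ∞ τ y) : SmM U (jac τ) :=
  fun i c => (sm_coord hτ c).pd i

theorem fderiv_single (hτ : DifferentiableAt ℝ τ x) (i : Fin 3) :
    fderiv ℝ τ x (EuclideanSpace.single i 1) =
      ∑ c, jac τ x i c • EuclideanSpace.single c (1 : ℝ) := by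
  have h : ∀ c, fderiv ℝ (fun y => τ y c) x = (EuclideanSpace.proj c : E3 →L[ℝ] ℝ) ∘L fderiv ℝ τ x :=
    fun c => (((EuclideanSpace.proj c : E3 →L[ℝ] ℝ).hasFDerivAt).comp x hτ.hasFDerivAt).fderiv
  ext c
  fin_cases c <;> simp [jac, pd, h, Fin.sum_univ_three]

theorem pd_comp (hτ : DifferentiableAt ℝ τ x) (hf : DifferentiableAt ℝ f (τ x)) (i : Fin 3) :
    pd i (fun y => f (τ y)) x = ∑ c, jac τ x i c * pd c f (τ x) := by
  have h : fderiv ℝ (fun y => f (τ y)) x = (fderiv ℝ f (τ x)) ∘L fderiv ℝ τ x :=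
    (hf.hasFDerivAt.comp x hτ.hasFDerivAt).fderiv
  rw [pd, h, ContinuousLinearMap.comp_apply, fderiv_single hτ, map_sum]
  simp only [map_smul, smul_eq_mul, pd]

theorem det_fderiv (hτ : DifferentiableAt ℝ τ x) : (fderiv ℝ τ x).det = (jac τ x).det := by
  have h : LinearMap.toMatrix (EuclideanSpace.basisFun (Fin 3) ℝ).toBasis
      (EuclideanSpace.basisFun (Fin 3) ℝ).toBasis (fderiv ℝ τ x : E3 →ₗ[ℝ] E3) = (jac τ x)ᵀ := by
    ext c i
    rw [LinearMap.toMatrix_apply]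
    simp [fderiv_single hτ]
  rw [ContinuousLinearMap.det, ← LinearMap.det_toMatrix (EuclideanSpace.basisFun (Fin 3) ℝ).toBasis,
    h, Matrix.det_transpose]

/-- `τ` is a change of coordinates that transforms the metric `G'` into the metric `G`. -/
structure IsIsometricTransition (U : Set E3) (G : E3 → Mat) (U' : Set E3) (G' : E3 → Mat)
    (τ : E3 → E3) : Prop where
  source : IsMetricOn U G
  target : IsMetricOn U' G'
  mapsTo : ∀ y ∈ U, τ y ∈ U'
  smooth : ∀ y ∈ U, ContDiffAt ℝ ∞ τ y
  metric : ∀ y ∈ U, G y = jac τ y * G' (τ y) * (jac τ y)ᵀ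

namespace IsIsometricTransition

variable (hτ : IsIsometricTransition U G U' G' τ)
include hτ

theorem differentiableAt (hx : x ∈ U) : DifferentiableAt ℝ τ x :=
  (hτ.smooth x hx).differentiableAt (by simp)

theorem sm_comp (hf : Sm U' f) : Sm U (fun y => f (τ y)) :=
  fun y hy => (hf _ (hτ.mapsTo y hy)).comp y (hτ.smooth y hy)

theorem pd_comp (hf : Sm U' f) (hx : x ∈ U) (i : Fin 3) :
    pd i (fun y => f (τ y)) x = ∑ c, jac τ x i c * pd c f (τ x) :=
  HeteroticSoliton.pd_comp (hτ.differentiableAt hx)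
    (hf.differentiableAt (hτ.mapsTo x hx)) i

theorem dM_comp (hA : SmM U' A) (hx : x ∈ U) (i : Fin 3) :
    dM i (fun y => A (τ y)) x = ∑ c, jac τ x i c • dM c A (τ x) := by
  ext a b
  simp only [Matrix.sum_apply, Matrix.smul_apply, smul_eq_mul, dM]
  exact hτ.pd_comp (hA a b) hx i

theorem isUnit_det (hx : x ∈ U) : IsUnit (jac τ x).det := by
  refine isUnit_iff_ne_zero.2 fun h => hτ.source.det_ne hx ?_
  rw [hτ.metric x hx, Matrix.det_mul, Matrix.det_mul, h, zero_mul, zero_mul]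

theorem inv_eq (hx : x ∈ U) :
    (G x)⁻¹ = ((jac τ x)⁻¹)ᵀ * (G' (τ x))⁻¹ * (jac τ x)⁻¹ := by
  rw [hτ.metric x hx, Matrix.mul_inv_rev, Matrix.mul_inv_rev, Matrix.transpose_nonsing_inv,
    mul_assoc]

theorem volDensity_eq (hx : x ∈ U) :
    volDensity G x = |(jac τ x).det| * volDensity G' (τ x) := by
  rw [volDensity, hτ.metric x hx, Matrix.det_mul, Matrix.det_mul, Matrix.det_transpose,
    show (jac τ x).det * (G' (τ x)).det * (jac τ x).det =
      (jac τ x).det ^ 2 * (G' (τ x)).det by ring, Real.sqrt_mul (sq_nonneg _), Real.sqrt_sq_eq_abs]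
  rfl

theorem smM_comp (hA : SmM U' A) : SmM U (fun y => A (τ y)) := fun i j => hτ.sm_comp (hA i j)

theorem dM_conj (hA : SmM U' A') (hAA : ∀ y ∈ U, A y = jac τ y * A' (τ y) * (jac τ y)ᵀ)
    (hx : x ∈ U) (i : Fin 3) : dM i A x = dM i (jac τ) x * A' (τ x) * (jac τ x)ᵀ
      + jac τ x * (∑ c, jac τ x i c • dM c A' (τ x)) * (jac τ x)ᵀ
      + jac τ x * A' (τ x) * (dM i (jac τ) x)ᵀ := by
  have hN := smooth_jac hτ.smooth
  rw [dM_congr hτ.source.isOpen hx hAA, dM_mul (hN.mul (hτ.smM_comp hA)) hN.transpose hx,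
    dM_mul hN (hτ.smM_comp hA) hx, hτ.dM_comp hA hx, dM_transpose]
  noncomm_ring

/-- The transformation law of the Christoffel symbols: the right-hand side defines a torsion-free
metric connection, which is unique. -/
theorem chrM_mul_jac (hx : x ∈ U) (i : Fin 3) : chrM G i x * jac τ x =
    dM i (jac τ) x + jac τ x * ∑ c, jac τ x i c • chrM G' c (τ x) := by
  have hu := hτ.isUnit_det hx
  have hx' := hτ.mapsTo x hx
  have h := hτ.source.chrM_unique hx (fun i => (dM i (jac τ) x + jac τ x *
    ∑ c, jac τ x i c • chrM G' c (τ x)) * (jac τ x)⁻¹) ?_ ?_ i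
  · rw [← h, mul_assoc, Matrix.nonsing_inv_mul _ hu, mul_one]
  · intro i j l
    have s : ∀ c, (dM i (jac τ) x + jac τ x * ∑ c, jac τ x i c • chrM G' c (τ x)) j c =
        (dM j (jac τ) x + jac τ x * ∑ c, jac τ x j c • chrM G' c (τ x)) i c := by
      intro c
      have h1 : dM i (jac τ) x j c = dM j (jac τ) x i c := pd_comm (sm_coord hτ.smooth c) hx i j
      simp only [Matrix.add_apply, h1, Matrix.mul_apply, Matrix.smul_apply,
        smul_eq_mul, chrM, Fin.sum_univ_three]
      rw [hτ.target.chr_symm hx' 1 0, hτ.target.chr_symm hx' 2 0, hτ.target.chr_symm hx' 2 1]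
      ring
    rw [Matrix.mul_apply, Matrix.mul_apply]
    exact Finset.sum_congr rfl fun c _ => by rw [s]
  · intro m
    have e : (G x) = jac τ x * G' (τ x) * (jac τ x)ᵀ := hτ.metric x hx
    have e1 : ∀ X : Mat, X * (jac τ x)⁻¹ * G x = X * G' (τ x) * (jac τ x)ᵀ := by
      intro X
      rw [e, mul_assoc X, ← mul_assoc (jac τ x)⁻¹, ← mul_assoc (jac τ x)⁻¹,
        Matrix.nonsing_inv_mul _ hu, one_mul, mul_assoc X]
    have e2 : ∀ X : Mat, G x * (X * (jac τ x)⁻¹)ᵀ = jac τ x * G' (τ x) * Xᵀ := by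
      intro X
      have := congrArg Matrix.transpose (e1 X)
      simpa only [Matrix.transpose_mul, hτ.source.transpose_eq hx, Matrix.transpose_transpose,
        hτ.target.transpose_eq hx', mul_assoc] using this
    rw [e1, e2, hτ.dM_conj hτ.target.smooth hτ.metric hx]
    simp only [hτ.target.dM_metric hx', smul_add, Finset.sum_add_distrib, sum_smul_mul,
      sum_smul_mul_transpose, Matrix.transpose_add, Matrix.transpose_mul]
    noncomm_ring

theorem covM_conj (hA : SmM U' A') (hAA : ∀ y ∈ U, A y = jac τ y * A' (τ y) * (jac τ y)ᵀ)
    (hx : x ∈ U) (i : Fin 3) : covM G A i x =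
      jac τ x * (∑ c, jac τ x i c • covM G' A' c (τ x)) * (jac τ x)ᵀ := by
  have h := hτ.chrM_mul_jac hx i
  have e1 : chrM G i x * A x = (dM i (jac τ) x + jac τ x *
      ∑ c, jac τ x i c • chrM G' c (τ x)) * A' (τ x) * (jac τ x)ᵀ := by
    rw [← h, hAA x hx]; noncomm_ring
  have e2 : A x * (chrM G i x)ᵀ = jac τ x * A' (τ x) * (dM i (jac τ) x + jac τ x *
      ∑ c, jac τ x i c • chrM G' c (τ x))ᵀ := by
    rw [← h, hAA x hx, Matrix.transpose_mul]; noncomm_ring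
  rw [covM, e1, e2, hτ.dM_conj hA hAA hx]
  simp only [covM, smul_sub, Finset.sum_sub_distrib, sum_smul_mul,
    sum_smul_mul_transpose, Matrix.transpose_add, Matrix.transpose_mul]
  noncomm_ring

/-- The transformation law of the one-form `bochnerForm`. -/
theorem bochnerForm_eq (hH : SmM U' H') (hHH : ∀ y ∈ U, H y = jac τ y * H' (τ y) * (jac τ y)ᵀ)
    (hx : x ∈ U) (a : Fin 3) :
    bochnerForm G H a x = ∑ c, jac τ x a c * bochnerForm G' H' c (τ x) := by
  have hu := hτ.isUnit_det hx
  have hx' := hτ.mapsTo x hx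
  have hD := hτ.covM_conj hH hHH hx
  set N := jac τ x with hN
  set D' : Fin 3 → Mat := fun c => covM G' H' c (τ x) with hD'
  have hNN : N⁻¹ * N = 1 := Matrix.nonsing_inv_mul _ hu
  have hE : exch (covM G H) a x = N * (∑ c, N a c • exch (covM G' H') c (τ x)) * Nᵀ := by
    ext b c
    have e : exch (covM G H) a x b c = (N * (∑ d, N b d • D' d) * Nᵀ) a c := by
      rw [← hD]; rfl
    rw [e]
    simp only [Matrix.mul_apply, Matrix.smul_apply, Matrix.transpose_apply,
      exch, hD', smul_eq_mul, Fin.sum_univ_three, Matrix.add_apply]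
    ring
  have hu' : ∀ b, pd b (fun y => ((G y)⁻¹ * H y).trace) x =
      ∑ c, N b c * pd c (fun y => ((G' y)⁻¹ * H' y).trace) (τ x) := by
    intro b
    rw [← hτ.pd_comp (hτ.target.smooth_inv.mul hH).trace hx]
    refine pd_congr hτ.source.isOpen hx (fun y hy => ?_) b
    have hNN : (jac τ y)⁻¹ * jac τ y = 1 := Matrix.nonsing_inv_mul _ (hτ.isUnit_det hy)
    rw [hτ.inv_eq hy, hHH y hy]
    have : ((jac τ y)⁻¹)ᵀ * (G' (τ y))⁻¹ * (jac τ y)⁻¹ * (jac τ y * H' (τ y) * (jac τ y)ᵀ) =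
        ((jac τ y)⁻¹)ᵀ * ((G' (τ y))⁻¹ * ((jac τ y)⁻¹ * jac τ y) * H' (τ y) * (jac τ y)ᵀ) := by
      noncomm_ring
    rw [this, Matrix.trace_mul_comm, hNN, mul_one, mul_assoc _ _ ((jac τ y)⁻¹)ᵀ,
      ← Matrix.transpose_mul, hNN, Matrix.transpose_one, mul_one]
  have h1 : ((G x)⁻¹ * H x * (G x)⁻¹ * (covM G H a x - exch (covM G H) a x)ᵀ).trace =
      ∑ c, N a c * ((G' (τ x))⁻¹ * H' (τ x) * (G' (τ x))⁻¹ *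
        (covM G' H' c (τ x) - exch (covM G' H') c (τ x))ᵀ).trace := by
    have e : covM G H a x - exch (covM G H) a x =
        N * (∑ c, N a c • (covM G' H' c (τ x) - exch (covM G' H') c (τ x))) * Nᵀ := by
      rw [hD, hE]
      simp only [smul_sub, Finset.sum_sub_distrib, mul_sub, sub_mul]
    rw [e, hτ.inv_eq hx, hHH x hx, ← hN]
    generalize hX : (∑ c, N a c • (covM G' H' c (τ x) - exch (covM G' H') c (τ x))) = X
    have e2 : (N⁻¹)ᵀ * (G' (τ x))⁻¹ * N⁻¹ * (N * H' (τ x) * Nᵀ) * ((N⁻¹)ᵀ * (G' (τ x))⁻¹ * N⁻¹) *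
        (N * X * Nᵀ)ᵀ = (N⁻¹)ᵀ * ((G' (τ x))⁻¹ * (N⁻¹ * N) * H' (τ x) * (N⁻¹ * N)ᵀ *
          (G' (τ x))⁻¹ * (N⁻¹ * N) * Xᵀ * Nᵀ) := by
      simp only [Matrix.transpose_mul, Matrix.transpose_transpose]
      noncomm_ring
    rw [e2, Matrix.trace_mul_comm, mul_assoc _ Nᵀ, ← Matrix.transpose_mul, hNN,
      Matrix.transpose_one, mul_one, mul_one, mul_one, mul_one, ← hX]
    simp only [Matrix.transpose_sum, Matrix.transpose_smul, Finset.mul_sum, Matrix.trace_sum,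
      Matrix.mul_smul, Matrix.trace_smul, smul_eq_mul]
  have h2 : ∑ b, (H x * (G x)⁻¹) a b * pd b (fun y => ((G y)⁻¹ * H y).trace) x =
      ∑ c, N a c * ∑ b, (H' (τ x) * (G' (τ x))⁻¹) c b *
        pd b (fun y => ((G' y)⁻¹ * H' y).trace) (τ x) := by
    simp only [hu']
    have e : H x * (G x)⁻¹ * N = N * (H' (τ x) * (G' (τ x))⁻¹) := by
      rw [hτ.inv_eq hx, hHH x hx, ← hN]
      have : N * H' (τ x) * Nᵀ * ((N⁻¹)ᵀ * (G' (τ x))⁻¹ * N⁻¹) * N =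
          N * (H' (τ x) * (N⁻¹ * N)ᵀ * (G' (τ x))⁻¹) * (N⁻¹ * N) := by
        rw [Matrix.transpose_mul]
        noncomm_ring
      rw [this, hNN, Matrix.transpose_one, mul_one, mul_one]
    rw [sum_mul_sum_mul, sum_mul_sum_mul, e]
  simp only [bochnerForm, mul_add, Finset.sum_add_distrib]
  rw [h1, h2]

theorem sum_fluxDensity_mul_pd (hH : SmM U' H')
    (hHH : ∀ y ∈ U, H y = jac τ y * H' (τ y) * (jac τ y)ᵀ) (hf : Sm U' f) (hx : x ∈ U) :
    ∑ m, fluxDensity G (bochnerForm G H) m x * pd m (fun y => f (τ y)) x =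
      |(jac τ x).det| * ∑ m, fluxDensity G' (bochnerForm G' H') m (τ x) * pd m f (τ x) := by
  have hu := hτ.isUnit_det hx
  have hNN : (jac τ x)⁻¹ * jac τ x = 1 := Matrix.nonsing_inv_mul _ hu
  have e : (jac τ x)ᵀ * ((G x)⁻¹ * jac τ x) = (G' (τ x))⁻¹ := by
    have : (jac τ x)ᵀ * (((jac τ x)⁻¹)ᵀ * (G' (τ x))⁻¹ * (jac τ x)⁻¹ * jac τ x) =
        ((jac τ x)⁻¹ * jac τ x)ᵀ * (G' (τ x))⁻¹ * ((jac τ x)⁻¹ * jac τ x) := by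
      rw [Matrix.transpose_mul]
      noncomm_ring
    rw [hτ.inv_eq hx, this, hNN, Matrix.transpose_one, mul_one, one_mul]
  set w' : Fin 3 → ℝ := fun c => bochnerForm G' H' c (τ x) with hw'
  have h1 : ∀ c, ∑ m, (jac τ x)ᵀ c m * ∑ a, (G x)⁻¹ m a * bochnerForm G H a x =
      ∑ a, (G' (τ x))⁻¹ c a * w' a := by
    intro c
    simp only [hτ.bochnerForm_eq hH hHH hx]
    have h : ∀ m, ∑ a, (G x)⁻¹ m a * ∑ c, jac τ x a c * bochnerForm G' H' c (τ x) =
        ∑ a, ((G x)⁻¹ * jac τ x) m a * w' a := fun m => sum_mul_sum_mul _ _ w' m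
    simp only [h]
    rw [sum_mul_sum_mul, e]
  simp only [hτ.pd_comp hf hx, fluxDensity, hτ.volDensity_eq hx]
  have h2 : ∑ m, (∑ a, (G x)⁻¹ m a * bochnerForm G H a x) * ∑ c, jac τ x m c * pd c f (τ x) =
      ∑ c, (∑ a, (G' (τ x))⁻¹ c a * w' a) * pd c f (τ x) := by
    simp only [← h1]
    generalize bochnerForm G H = w
    simp only [Matrix.transpose_apply, Fin.sum_univ_three]
    ring
  simp only [mul_assoc, ← Finset.mul_sum]
  rw [h2]

end IsIsometricTransition

end HeteroticSoliton

end

noncomputable section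

namespace HeteroticSoliton

open scoped Topology Matrix

/-! ### Tensor fields in the charts of a manifold -/

variable {M : Type*} [TopologicalSpace M] [ChartedSpace E3 M] {e e' : OpenPartialHomeomorph M E3}
  {x : E3}

theorem bilin_apply {F : Type*} [NormedAddCommGroup F] [NormedSpace ℝ F] (b : F →L[ℝ] F →L[ℝ] ℝ)
    (L : E3 →L[ℝ] F) (v w : E3) : b (L v) (L w) = ∑ i, ∑ j, v i * w j *
      b (L (EuclideanSpace.single i 1)) (L (EuclideanSpace.single j 1)) := by
  have h : ∀ v : E3, v = ∑ i, v i • EuclideanSpace.single i (1 : ℝ) := by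
    intro v
    ext c
    fin_cases c <;> simp [Fin.sum_univ_three]
  conv_lhs => rw [h v, h w]
  simp only [map_sum, map_smul, sum_apply, smul_apply, smul_eq_mul, Finset.mul_sum, mul_assoc]
  rw [Finset.sum_comm]
  exact Finset.sum_congr rfl fun i _ => Finset.sum_congr rfl fun j _ => by ring

theorem inCoord_apply (B : BilinField M) (e : OpenPartialHomeomorph M E3) (x v w : E3) :
    B (e.symm x) (mfderiv (𝓡 3) (𝓡 3) e.symm x v) (mfderiv (𝓡 3) (𝓡 3) e.symm x w) =
      ∑ i, ∑ j, v i * w j * inCoord B e x i j :=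
  bilin_apply (F := E3) (B (e.symm x)) (mfderiv (𝓡 3) (𝓡 3) e.symm x) v w

theorem inCoord_transpose {B : BilinField M} (hB : ∀ p v w, B p v w = B p w v)
    (e : OpenPartialHomeomorph M E3) (x : E3) : (inCoord B e x)ᵀ = inCoord B e x := by
  ext i j
  exact hB _ _ _

section Chart

variable (he : e ∈ IsManifold.maximalAtlas (𝓡 3) ∞ M)
include he

theorem mdifferentiable_of_mem_maximalAtlas : e.MDifferentiable (𝓡 3) (𝓡 3) :=
  ⟨(contMDiffOn_of_mem_maximalAtlas he).mdifferentiableOn (by simp),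
    (contMDiffOn_symm_of_mem_maximalAtlas he).mdifferentiableOn (by simp)⟩

omit he in
/-- The components of a bilinear form determine it. -/
theorem eq_zero_of_inCoord_eq_zero (hd : e.MDifferentiable (𝓡 3) (𝓡 3)) {B : BilinField M}
    (hx : x ∈ e.target) (h : inCoord B e x = 0) : B (e.symm x) = 0 := by
  have hs := hd.symm.mfderiv_surjective hx
  ext v w
  obtain ⟨v', rfl⟩ := hs v
  obtain ⟨w', rfl⟩ := hs w
  refine (inCoord_apply B e x v' w').trans ?_
  simp [h]

variable [IsManifold (𝓡 3) ∞ M]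

theorem contMDiffAt_coordVec (v : E3) (hx : x ∈ e.target) :
    ContMDiffAt (𝓡 3) (𝓡 3).tangent ∞
      (fun y => (⟨e.symm y, mfderiv (𝓡 3) (𝓡 3) e.symm y v⟩ : TangentBundle (𝓡 3) M)) x := by
  have h1 : ContMDiffOn (𝓡 3).tangent (𝓡 3).tangent ∞ (tangentMapWithin (𝓡 3) (𝓡 3) e.symm e.target)
      (Bundle.TotalSpace.proj ⁻¹' e.target) :=
    (contMDiffOn_symm_of_mem_maximalAtlas he).contMDiffOn_tangentMapWithin le_rfl
      e.open_target.uniqueMDiffOn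
  have h2 : ContMDiffAt (𝓡 3) (𝓡 3).tangent ∞
      (fun y : E3 => (⟨y, v⟩ : TangentBundle (𝓡 3) E3)) x :=
    contMDiffAt_vectorSpace_iff_contDiffAt.2 contDiffAt_const
  have h3 := ContMDiffAt.comp_of_eq (x := x) (y := (⟨x, v⟩ : TangentBundle (𝓡 3) E3))
    ((h1 ⟨x, v⟩ hx).contMDiffAt ((e.open_target.preimage
      (FiberBundle.continuous_proj E3 (TangentSpace (𝓡 3)))).mem_nhds hx)) h2 rfl
  refine h3.congr_of_eventuallyEq (Filter.eventually_of_mem (e.open_target.mem_nhds hx)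
    fun y hy => ?_)
  simp only [Function.comp, tangentMapWithin, mfderivWithin_of_isOpen e.open_target hy]

theorem smooth_inCoord {B : BilinField M}
    (hB : ContMDiff (𝓡 3) ((𝓡 3).prod 𝓘(ℝ, E3 →L[ℝ] E3 →L[ℝ] ℝ)) ∞ (fun p =>
      Bundle.TotalSpace.mk' (E3 →L[ℝ] E3 →L[ℝ] ℝ)
        (E := fun p : M => TangentSpace (𝓡 3) p →L[ℝ] TangentSpace (𝓡 3) p →L[ℝ] ℝ) p (B p))) :
    SmM e.target (inCoord B e) := by
  intro i j x hx
  have hs : ContMDiffAt (𝓡 3) (𝓡 3) ∞ e.symm x := contMDiffAt_symm_of_mem_maximalAtlas he hx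
  have h : ContMDiffAt (𝓡 3) ((𝓡 3).prod 𝓘(ℝ)) ∞ (fun y =>
      Bundle.TotalSpace.mk' ℝ (E := Bundle.Trivial M ℝ) (e.symm y) (B (e.symm y)
        (mfderiv (𝓡 3) (𝓡 3) e.symm y (EuclideanSpace.single i (1 : ℝ)))
        (mfderiv (𝓡 3) (𝓡 3) e.symm y (EuclideanSpace.single j (1 : ℝ))))) x := by
    apply ContMDiffAt.clm_bundle_apply₂ (F₁ := E3) (F₂ := E3)
    · exact ContMDiffAt.comp x hB.contMDiffAt hs
    · exact contMDiffAt_coordVec he _ hx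
    · exact contMDiffAt_coordVec he _ hx
  rw [Bundle.contMDiffAt_totalSpace] at h
  exact h.2.contDiffAt

theorem isMetricOn_inCoord (g : Metric M) : IsMetricOn e.target (inCoord g.inner e) where
  isOpen := e.open_target
  smooth := smooth_inCoord he g.contMDiff
  posDef x hx := by
    refine Matrix.PosDef.of_dotProduct_mulVec_pos (inCoord_transpose g.symm e x) fun v hv => ?_
    have hinj := (mdifferentiable_of_mem_maximalAtlas he).symm.mfderiv_injective hx
    have hne : mfderiv (𝓡 3) (𝓡 3) e.symm x (WithLp.toLp 2 v : E3) ≠ 0 := by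
      intro h0
      have h1 := hinj (h0.trans (map_zero _).symm)
      exact hv (congrArg WithLp.ofLp h1)
    have h := g.pos _ _ hne
    rw [inCoord_apply] at h
    refine h.trans_eq ?_
    simp only [dotProduct, Matrix.mulVec, Finset.mul_sum, star_trivial]
    exact Finset.sum_congr rfl fun i _ => Finset.sum_congr rfl fun j _ => by ring

end Chart

theorem IsMetricOn.mono {U V : Set E3} {G : E3 → Mat} (hG : IsMetricOn U G) (hV : IsOpen V)
    (h : V ⊆ U) : IsMetricOn V G :=
  ⟨hV, fun i j x hx => hG.smooth i j x (h hx), fun x hx => hG.posDef x (h hx)⟩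

theorem contDiffAt_transition (he : e ∈ IsManifold.maximalAtlas (𝓡 3) ∞ M)
    (he' : e' ∈ IsManifold.maximalAtlas (𝓡 3) ∞ M) (hx : x ∈ (e.symm.trans e').source) :
    ContDiffAt ℝ ∞ (e' ∘ e.symm) x := by
  rw [OpenPartialHomeomorph.trans_source] at hx
  exact ((contMDiffAt_of_mem_maximalAtlas he' hx.2).comp x
    (contMDiffAt_symm_of_mem_maximalAtlas he hx.1)).contDiffAt

/-- The transformation law of bilinear forms. -/
theorem inCoord_eq (he : e ∈ IsManifold.maximalAtlas (𝓡 3) ∞ M)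
    (he' : e' ∈ IsManifold.maximalAtlas (𝓡 3) ∞ M) (B : BilinField M)
    (hx : x ∈ (e.symm.trans e').source) :
    inCoord B e x = jac (e' ∘ e.symm) x * inCoord B e' (e' (e.symm x)) *
      (jac (e' ∘ e.symm) x)ᵀ := by
  have hτ : DifferentiableAt ℝ (e' ∘ e.symm) x :=
    (contDiffAt_transition he he' hx).differentiableAt (by simp)
  have hx2 := hx
  rw [OpenPartialHomeomorph.trans_source] at hx2
  have hev : e.symm =ᶠ[𝓝 x] e'.symm ∘ (e' ∘ e.symm) := by
    refine Filter.eventually_of_mem ((e.symm.trans e').open_source.mem_nhds hx) fun y hy => ?_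
    rw [OpenPartialHomeomorph.trans_source] at hy
    exact (e'.left_inv hy.2).symm
  have h0 : HasMFDerivAt (𝓡 3) (𝓡 3) (e'.symm ∘ (e' ∘ e.symm)) x
      ((mfderiv (𝓡 3) (𝓡 3) e'.symm (e' (e.symm x))).comp (fderiv ℝ (e' ∘ e.symm) x)) :=
    ((mdifferentiable_of_mem_maximalAtlas he').symm.mdifferentiableAt
      (e'.map_source hx2.2)).hasMFDerivAt.comp x hτ.hasFDerivAt.hasMFDerivAt
  have hd : ∀ v : E3, (mfderiv (𝓡 3) (𝓡 3) e.symm x v : E3) =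
      mfderiv (𝓡 3) (𝓡 3) e'.symm (e' (e.symm x)) (fderiv ℝ (e' ∘ e.symm) x v) := fun v =>
    congrArg (fun L : E3 →L[ℝ] E3 => L v) (h0.congr_of_eventuallyEq hev).mfderiv
  have hB : ∀ p q : M, p = q → ∀ v w : E3, B p v w = B q v w := by
    rintro p q rfl v w; rfl
  ext i j
  have h1 : inCoord B e x i j = B (e'.symm (e' (e.symm x)))
      (mfderiv (𝓡 3) (𝓡 3) e'.symm (e' (e.symm x))
        (fderiv ℝ (e' ∘ e.symm) x (EuclideanSpace.single i (1 : ℝ))))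
      (mfderiv (𝓡 3) (𝓡 3) e'.symm (e' (e.symm x))
        (fderiv ℝ (e' ∘ e.symm) x (EuclideanSpace.single j (1 : ℝ)))) :=
    (congrArg₂ (fun v w : E3 => B (e.symm x) v w) (hd _) (hd _)).trans
      (hB _ _ (e'.left_inv hx2.2).symm _ _)
  rw [h1, inCoord_apply, fderiv_single hτ, fderiv_single hτ]
  generalize inCoord B e' (e' (e.symm x)) = X
  generalize jac (e' ∘ e.symm) x = N
  simp [Matrix.mul_apply, Fin.sum_univ_three]
  ring

/-- The transition map of two charts as a change of coordinates for a metric. -/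
theorem isIsometricTransition [IsManifold (𝓡 3) ∞ M] (he : e ∈ IsManifold.maximalAtlas (𝓡 3) ∞ M)
    (he' : e' ∈ IsManifold.maximalAtlas (𝓡 3) ∞ M) (g : Metric M) :
    IsIsometricTransition (e.symm.trans e').source (inCoord g.inner e) e'.target
      (inCoord g.inner e') (e' ∘ e.symm) where
  source := (isMetricOn_inCoord he g).mono (e.symm.trans e').open_source
    fun y hy => by rw [OpenPartialHomeomorph.trans_source] at hy; exact hy.1
  target := isMetricOn_inCoord he' g
  mapsTo y hy := by
    rw [OpenPartialHomeomorph.trans_source] at hy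
    exact e'.map_source hy.2
  smooth y hy := contDiffAt_transition he he' hy
  metric y hy := inCoord_eq he he' _ hy

end HeteroticSoliton

end

noncomputable section

namespace HeteroticSoliton

open scoped Topology Matrix
open MeasureTheory

/-! ### The divergence theorem on a closed manifold -/

section Euclidean

variable {U K : Set E3} {f : E3 → ℝ}

theorem Sm.continuousOn (hf : Sm U f) : ContinuousOn f U :=
  fun x hx => (hf x hx).continuousAt.continuousWithinAt

theorem Sm.integrableOn (hf : Sm U f) (hU : IsOpen U) (hK : IsCompact K) (hKU : K ⊆ U)
    (h0 : ∀ x ∈ U, x ∉ K → f x = 0) : IntegrableOn f U :=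
  ((hf.continuousOn.mono hKU).integrableOn_compact hK).of_forall_sdiff_eq_zero hU.measurableSet
    fun x hx => h0 x hx.1 hx.2

/-- The integral of a partial derivative of a function with compact support vanishes. -/
theorem integral_pd_eq_zero (hf : Sm U f) (hU : IsOpen U) (hK : IsCompact K) (hKU : K ⊆ U)
    (h0 : ∀ x ∈ U, x ∉ K → f x = 0) (m : Fin 3) : ∫ x in U, pd m f x = 0 := by
  classical
  set F : E3 → ℝ := U.indicator f with hF
  have hz : ∀ x, x ∉ K → F x = 0 := by
    intro x hx
    by_cases hxU : x ∈ U
    · rw [hF, Set.indicator_of_mem hxU, h0 x hxU hx]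
    · rw [hF, Set.indicator_of_notMem hxU]
  have hev : ∀ x, x ∉ K → F =ᶠ[𝓝 x] fun _ => 0 := fun x hx =>
    Filter.eventually_of_mem (hK.isClosed.isOpen_compl.mem_nhds hx) hz
  have hs : ContDiff ℝ ∞ F := by
    rw [contDiff_iff_contDiffAt]
    intro x
    by_cases hx : x ∈ K
    · exact (hf x (hKU hx)).congr_of_eventuallyEq (Filter.eventually_of_mem
        (hU.mem_nhds (hKU hx)) fun y hy => Set.indicator_of_mem hy f)
    · exact contDiffAt_const.congr_of_eventuallyEq (hev x hx)
  have hc : HasCompactSupport F := HasCompactSupport.intro hK hz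
  have hi : Integrable F := hs.continuous.integrable_of_hasCompactSupport hc
  have hi' : Integrable (fun x => fderiv ℝ F x (EuclideanSpace.single m 1)) := by
    refine Continuous.integrable_of_hasCompactSupport
      ((hs.continuous_fderiv (by simp)).clm_apply continuous_const) ?_
    refine HasCompactSupport.intro hK fun x hx => ?_
    rw [(hev x hx).fderiv_eq]
    simp
  have h1 : ∫ x, fderiv ℝ F x (EuclideanSpace.single m 1) = 0 := by
    have h := integral_mul_fderiv_eq_neg_fderiv_mul_of_integrable (μ := volume)
      (f := fun _ : E3 => (1 : ℝ)) (g := F) (v := EuclideanSpace.single m 1)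
      (by simp) (by simpa using hi') (by simpa using hi)
      (fun x _ => differentiableAt_const _) (fun x _ => (hs.differentiable (by simp)) x)
    simpa using h
  calc ∫ x in U, pd m f x = ∫ x in U, pd m F x :=
        setIntegral_congr_fun hU.measurableSet fun x hx =>
          pd_congr hU hx (fun y hy => (Set.indicator_of_mem hy f).symm) m
    _ = ∫ x, pd m F x := by
        refine setIntegral_eq_integral_of_forall_compl_eq_zero fun x hx => ?_
        rw [pd, (hev x fun h => hx (hKU h)).fderiv_eq]
        simp
    _ = 0 := h1

end Euclidean

variable {M : Type*} [TopologicalSpace M]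

section Chart

variable {e : OpenPartialHomeomorph M E3} {α : M → ℝ} {x : E3}

theorem notMem_tsupport (hx : x ∈ e.target) (h : x ∉ e '' tsupport α) :
    e.symm x ∉ tsupport α := fun h' => h ⟨e.symm x, h', e.right_inv hx⟩

theorem pd_eq_zero_of_notMem (hx : x ∈ e.target) (h : e.symm x ∉ tsupport α) (m : Fin 3) :
    pd m (fun y => α (e.symm y)) x = 0 := by
  have ho : IsOpen (e.target ∩ e.symm ⁻¹' (tsupport α)ᶜ) :=
    e.isOpen_inter_preimage_symm (isClosed_tsupport α).isOpen_compl
  rw [pd_congr (f₂ := fun _ => 0) ho ⟨hx, h⟩ (fun y hy => image_eq_zero_of_notMem_tsupport hy.2),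
    pd_const]

theorem isCompact_image_tsupport [CompactSpace M] (hα : tsupport α ⊆ e.source) :
    IsCompact (e '' tsupport α) :=
  (isClosed_tsupport α).isCompact.image_of_continuousOn (e.continuousOn.mono hα)

theorem image_tsupport_subset (hα : tsupport α ⊆ e.source) : e '' tsupport α ⊆ e.target := by
  rintro _ ⟨p, hp, rfl⟩
  exact e.map_source (hα hp)

variable [ChartedSpace E3 M]

theorem sm_comp_symm (he : e ∈ IsManifold.maximalAtlas (𝓡 3) ∞ M)
    (hα : ContMDiff (𝓡 3) 𝓘(ℝ) ∞ α) : Sm e.target (fun y => α (e.symm y)) := fun _ hx =>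
  (hα.contMDiffAt.comp _ (contMDiffAt_symm_of_mem_maximalAtlas he hx)).contDiffAt

end Chart

/-- The divergence theorem: if vector densities `V i` in the charts `e i` correspond to each other
under the changes of coordinates, then their divergence has integral zero. -/
theorem sum_integral_div_eq_zero [ChartedSpace E3 M] [CompactSpace M] {ι : Type*} [Fintype ι]
    {e : ι → OpenPartialHomeomorph M E3} (he : ∀ i, e i ∈ IsManifold.maximalAtlas (𝓡 3) ∞ M)
    {ρ : ι → M → ℝ} (hρ : ∀ i, ContMDiff (𝓡 3) 𝓘(ℝ) ∞ (ρ i))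
    (hsupp : ∀ i, tsupport (ρ i) ⊆ (e i).source) (hsum : ∀ p, ∑ i, ρ i p = 1)
    {V : ι → Fin 3 → E3 → ℝ} (hV : ∀ i m, Sm (e i).target (V i m))
    (htrans : ∀ i j, ∀ f : E3 → ℝ, Sm (e j).target f → ∀ x ∈ ((e i).symm.trans (e j)).source,
      ∑ m, V i m x * pd m (fun y => f ((e j ∘ (e i).symm) y)) x =
        |(jac (e j ∘ (e i).symm) x).det| *
          ∑ m, V j m ((e j ∘ (e i).symm) x) * pd m f ((e j ∘ (e i).symm) x)) :
    ∑ i, ∫ x in (e i).target, ρ i ((e i).symm x) * ∑ m, pd m (V i m) x = 0 := by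
  classical
  set r : ι → ι → E3 → ℝ := fun i j x => ρ j ((e i).symm x) with hr
  have hrs : ∀ i j, Sm (e i).target (r i j) := fun i j => sm_comp_symm (he i) (hρ j)
  set Q : ι → ι → ι → E3 → ℝ := fun i j k x => r i j x * ∑ m, V i m x * pd m (r i k) x with hQ
  have hQs : ∀ i j k, Sm (e i).target (Q i j k) := fun i j k =>
    (hrs i j).mul (Sm.sum fun m _ => (hV i m).mul ((hrs i k).pd m))
  have ho : ∀ i, IsOpen (e i).target := fun i => (e i).open_target
  have hK : ∀ i, IsCompact (e i '' tsupport (ρ i)) := fun i => isCompact_image_tsupport (hsupp i)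
  have hKU : ∀ i, e i '' tsupport (ρ i) ⊆ (e i).target := fun i => image_tsupport_subset (hsupp i)
  have hr0 : ∀ i, ∀ x ∈ (e i).target, x ∉ e i '' tsupport (ρ i) → r i i x = 0 :=
    fun i x hx h => image_eq_zero_of_notMem_tsupport (f := ρ i) (notMem_tsupport hx h)
  have hpd0 : ∀ i, ∀ x ∈ (e i).target, x ∉ e i '' tsupport (ρ i) → ∀ m, pd m (r i i) x = 0 :=
    fun i x hx h m => pd_eq_zero_of_notMem hx (notMem_tsupport hx h) m
  have int1 : ∀ j k, IntegrableOn (Q j j k) (e j).target := fun j k =>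
    (hQs j j k).integrableOn (ho j) (hK j) (hKU j) fun x hx h => by simp [hQ, hr0 j x hx h]
  have int2 : ∀ i j, IntegrableOn (Q i j i) (e i).target := fun i j =>
    (hQs i j i).integrableOn (ho i) (hK i) (hKU i) fun x hx h => by simp [hQ, hpd0 i x hx h]
  -- Integration by parts in each chart.
  have h1 : ∀ i, ∫ x in (e i).target, r i i x * ∑ m, pd m (V i m) x =
      -∑ j, ∫ x in (e i).target, Q i j i x := by
    intro i
    have hp : ∀ m, Sm (e i).target (fun x => r i i x * V i m x) := fun m => (hrs i i).mul (hV i m)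
    have hz : ∀ m, ∫ x in (e i).target, pd m (fun x => r i i x * V i m x) x = 0 := fun m =>
      integral_pd_eq_zero (hp m) (ho i) (hK i) (hKU i) (fun x hx h => by rw [hr0 i x hx h, zero_mul]) m
    have hpi : ∀ m, IntegrableOn (pd m (fun x => r i i x * V i m x)) (e i).target := fun m =>
      ((hp m).pd m).integrableOn (ho i) (hK i) (hKU i) fun x hx h => by
        rw [pd_mul (hrs i i) (hV i m) hx, hpd0 i x hx h, hr0 i x hx h]; ring
    have hz' : ∫ x in (e i).target, ∑ m, pd m (fun x => r i i x * V i m x) x = 0 := by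
      rw [integral_finsetSum _ fun m _ => hpi m]
      simp [hz]
    rw [← integral_finsetSum _ fun j _ => int2 i j, eq_neg_iff_add_eq_zero, ← hz',
      ← integral_add]
    · refine setIntegral_congr_fun (ho i).measurableSet fun x hx => ?_
      have hs : ∑ j, r i j x = 1 := hsum _
      simp only [pd_mul (hrs i i) (hV i _) hx, hQ, ← Finset.sum_mul, hs, Finset.sum_add_distrib,
        ← Finset.mul_sum, one_mul]
      rw [add_comm]
      congr 1
      exact Finset.sum_congr rfl fun m _ => mul_comm _ _
    · exact ((hrs i i).mul (Sm.sum fun m _ => (hV i m).pd m)).integrableOn (ho i) (hK i) (hKU i)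
        fun x hx h => by rw [hr0 i x hx h, zero_mul]
    · exact integrable_finsetSum _ fun j _ => int2 i j
  -- Invariance under the changes of coordinates.
  have h2 : ∀ i j, ∫ x in (e i).target, Q i j i x = ∫ x in (e j).target, Q j j i x := by
    intro i j
    set W := ((e i).symm.trans (e j)).source with hW
    have hWo : IsOpen W := ((e i).symm.trans (e j)).open_source
    have hmem : ∀ x, x ∈ W ↔ x ∈ (e i).target ∧ (e i).symm x ∈ (e j).source := by
      intro x
      rw [hW, OpenPartialHomeomorph.trans_source]; rfl
    have hmem' : ∀ y, y ∈ ((e i).symm.trans (e j)).target ↔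
        y ∈ (e j).target ∧ (e j).symm y ∈ (e i).source := by
      intro x
      rw [OpenPartialHomeomorph.trans_target]; rfl
    have himg : (e j ∘ (e i).symm) '' W = ((e i).symm.trans (e j)).target :=
      ((e i).symm.trans (e j)).image_source_eq_target
    have hd : ∀ x ∈ W, DifferentiableAt ℝ (e j ∘ (e i).symm) x := fun x hx =>
      (contDiffAt_transition (he i) (he j) hx).differentiableAt (by simp)
    rw [setIntegral_eq_of_subset_of_forall_sdiff_eq_zero (ho i).measurableSet
        (s := W) (fun x hx => ((hmem x).1 hx).1) ?_,
      setIntegral_eq_of_subset_of_forall_sdiff_eq_zero (ho j).measurableSet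
        (s := ((e i).symm.trans (e j)).target) (fun x hx => ((hmem' x).1 hx).1) ?_, ← himg,
      integral_image_eq_integral_abs_det_fderiv_smul volume hWo.measurableSet
        (fun x hx => (hd x hx).hasFDerivAt.hasFDerivWithinAt)
        ((e i).symm.trans (e j)).injOn]
    · refine setIntegral_congr_fun hWo.measurableSet fun x hx => ?_
      have hxx := (hmem x).1 hx
      have e1 : r i j x = r j j ((e j ∘ (e i).symm) x) :=
        congrArg (ρ j) ((e j).left_inv hxx.2).symm
      have e2 : ∀ m, pd m (r i i) x = pd m (fun y => r j i ((e j ∘ (e i).symm) y)) x := fun m =>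
        pd_congr hWo hx (fun y hy => congrArg (ρ i) ((e j).left_inv ((hmem y).1 hy).2).symm) m
      simp only [hQ, e1, e2, htrans i j (r j i) (hrs j i) x hx, det_fderiv (hd x hx), smul_eq_mul]
      ring
    · intro y hy
      have h : (e j).symm y ∉ tsupport (ρ i) := fun h =>
        hy.2 ((hmem' y).2 ⟨hy.1, hsupp i h⟩)
      have h0 : ∀ m, pd m (r j i) y = 0 := pd_eq_zero_of_notMem hy.1 h
      simp [hQ, h0]
    · intro x hx
      have h : (e i).symm x ∉ tsupport (ρ j) := fun h =>
        hx.2 ((hmem x).2 ⟨hx.1, hsupp j h⟩)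
      have h0 : r i j x = 0 := image_eq_zero_of_notMem_tsupport (f := ρ j) h
      simp [hQ, h0]
  -- The derivatives of the partition of unity add up to zero.
  have h3 : ∀ j, ∑ i, ∫ x in (e j).target, Q j j i x = 0 := by
    intro j
    rw [← integral_finsetSum _ fun i _ => int1 j i]
    refine setIntegral_eq_zero_of_forall_eq_zero fun x hx => ?_
    have hs : ∀ m, ∑ i, pd m (r j i) x = 0 := by
      intro m
      rw [← pd_sum (fun i _ => hrs j i) hx]
      have : (fun y => ∑ i, r j i y) = fun _ => 1 := funext fun y => hsum _
      rw [this, pd_const]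
    simp only [hQ, ← Finset.mul_sum]
    rw [Finset.sum_comm]
    simp only [← Finset.mul_sum, hs, mul_zero, Finset.sum_const_zero]
  change ∑ i, ∫ x in (e i).target, r i i x * ∑ m, pd m (V i m) x = 0
  rw [Finset.sum_congr rfl fun i _ => h1 i, Finset.sum_neg_distrib, Finset.sum_congr rfl fun i _ =>
    Finset.sum_congr rfl fun j _ => h2 i j, Finset.sum_comm, Finset.sum_congr rfl fun j _ => h3 j]
  simp

end HeteroticSoliton

end

noncomputable section

namespace HeteroticSoliton

open scoped Topology Matrix
open MeasureTheory

/-! ### Essential deformations -/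

section Local

variable {U V : Set E3} {G H : E3 → Mat} {x : E3} {ξ : E3 → ℝ} {κ c k : ℝ}

theorem Sm.mono {f : E3 → ℝ} (hf : Sm U f) (h : V ⊆ U) : Sm V f := fun x hx => hf x (h hx)

theorem IsConstSoliton.mono (hS : IsConstSoliton U G κ c) (h : V ⊆ U) : IsConstSoliton V G κ c :=
  ⟨fun x hx => hS.einstein x (h hx), fun x hx => hS.yangMills x (h hx),
    fun x hx => hS.dilaton x (h hx)⟩

theorem IsLocalDeformation.mono (hd : IsLocalDeformation U G H κ c ξ) (h : V ⊆ U) :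
    IsLocalDeformation V G H κ c ξ :=
  ⟨fun x hx => hd.einstein x (h hx), fun x hx => hd.yangMills x (h hx),
    fun x hx => hd.dilaton x (h hx)⟩

theorem IsHyperbolic.mono (hP : IsHyperbolic U G k) (h : V ⊆ U) : IsHyperbolic V G k :=
  ⟨hP.pos, fun x hx => hP.ric_eq x (h hx)⟩

/-- The local part of the argument: the dilaton variation vanishes, the divergence of the Bochner
form is nonnegative, and the metric variation vanishes where this divergence does. -/
theorem IsLocalDeformation.rigidity (hd : IsLocalDeformation U G H κ c ξ) (hG : IsMetricOn U G)
    (hS : IsConstSoliton U G κ c) (hH : SmM U H) (hHs : ∀ y ∈ U, (H y)ᵀ = H y) (hξ : Sm U ξ)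
    (hdiv : ∀ y ∈ U, ∀ j, divBilin G H j y = 0) (hx : x ∈ U) :
    ξ x = 0 ∧ 0 ≤ divForm G (bochnerForm G H) x ∧
      (divForm G (bochnerForm G H) x = 0 → H x = 0) := by
  obtain ⟨T, V, hVU, hxV, hv⟩ := exists_isVariation hG hH hHs hx
  have hκ := hS.kappa_pos hG hx
  have hP := hS.isHyperbolic hG ⟨x, hx⟩
  have hk : κ * (4 / κ) = 4 := by field_simp
  have hξ0 := hv.dilaton_eq_zero (hP.mono hVU) (hξ.mono hVU) (hS.mono hVU) (hd.mono hVU) hk hxV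
  have hr := hv.dotM_ricM_eq (hP.mono hVU) (hξ.mono hVU) (hS.mono hVU) (hd.mono hVU) hk hxV
  have hdiv' : ∀ y ∈ U, ∀ j, ∑ m, ∑ i, (G y)⁻¹ m i * covM G H m y i j = 0 := by
    intro y hy j
    have h := neg_eq_zero.1 (hdiv y hy j)
    simp only [covBilin_eq] at h
    exact h
  obtain ⟨F, hF, d, h⟩ := hP.exists_divForm_bochnerForm hG hH hHs hdiv' hx fun a b => by
    rw [← hv.dotM_ricM hxV a b, hr]; rfl
  have hpos := hP.pos
  set k := 4 / κ
  have h1 : 0 ≤ (1 / 2) * ∑ a, ∑ b, ∑ c, (d a b c - d b a c) ^ 2 := by positivity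
  have h2 : 0 ≤ k * ∑ a, ∑ b, hat2 F (fun i j => H x i j) a b ^ 2 := by positivity
  have h3 : 0 ≤ k * (∑ a, hat2 F (fun i j => H x i j) a a) ^ 2 := by positivity
  refine ⟨hξ0, by rw [h]; positivity, fun h0 => ?_⟩
  have h4 : ∑ a, ∑ b, hat2 F (fun i j => H x i j) a b ^ 2 = 0 :=
    (mul_eq_zero.1 (by linarith : k * ∑ a, ∑ b, hat2 F (fun i j => H x i j) a b ^ 2 = 0)).resolve_left
      hpos.ne'
  ext i j
  refine hF.hat2_injective (X := fun i j => H x i j) (Y := fun _ _ => 0) (fun a b => ?_) i j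
  have h5 := (Finset.sum_eq_zero_iff_of_nonneg fun a _ => Finset.sum_nonneg fun b _ =>
    sq_nonneg _).1 h4 a (Finset.mem_univ _)
  have h6 := (Finset.sum_eq_zero_iff_of_nonneg fun b _ => sq_nonneg _).1 h5 b (Finset.mem_univ _)
  rw [pow_eq_zero_iff two_ne_zero] at h6
  rw [h6]
  simp [hat2]

end Local

variable {M : Type*} [TopologicalSpace M] [T2Space M] [CompactSpace M] [ChartedSpace E3 M]
  [IsManifold (𝓡 3) ∞ M] {κ : ℝ} {g : Metric M} {φ : C^∞⟮𝓡 3, M; 𝓘(ℝ), ℝ⟯} {d : TangentConf M}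

omit [T2Space M] [CompactSpace M] in
theorem inCoord_metricLine (g : Metric M) (h : SymTensor M) (t : ℝ)
    (e : OpenPartialHomeomorph M E3) : inCoord (metricLine g h t) e =
      line (inCoord g.inner e) (inCoord (h : TwoTensor M) e) t := rfl

omit [T2Space M] [CompactSpace M] in
/-- The local rigidity statement in a chart. -/
theorem rigidity_inCoord (hsol : IsTorsionlessSoliton κ g φ) {c : ℝ} (hc : ∀ p, φ p = c)
    (hd : d ∈ essentialDeformations κ g φ) {e : OpenPartialHomeomorph M E3}
    (he : e ∈ IsManifold.maximalAtlas (𝓡 3) ∞ M) {x : E3} (hx : x ∈ e.target) :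
    d.2 (e.symm x) = 0 ∧
      0 ≤ divForm (inCoord g.inner e)
        (bochnerForm (inCoord g.inner e) (inCoord (d.1 : TwoTensor M) e)) x ∧
      (divForm (inCoord g.inner e)
        (bochnerForm (inCoord g.inner e) (inCoord (d.1 : TwoTensor M) e)) x = 0 →
          inCoord (d.1 : TwoTensor M) e x = 0) := by
  have hφ : φ ∘ e.symm = fun _ => c := funext fun _ => hc _
  have hl : ∀ t, dilatonLine φ d.2 t ∘ e.symm = fun y => c + t * d.2 (e.symm y) := fun t =>
    funext fun y => by simp [dilatonLine, hc]
  obtain ⟨⟨h1, h2, h3⟩, ho⟩ := hd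
  have hS : IsConstSoliton e.target (inCoord g.inner e) κ c := by
    refine ⟨fun x hx => ?_, fun x hx => ?_, fun x hx => ?_⟩ <;> rw [← hφ]
    exacts [hsol.einstein e he x hx, hsol.yangMills e he x hx, hsol.dilaton e he x hx]
  have hD : IsLocalDeformation e.target (inCoord g.inner e) (inCoord (d.1 : TwoTensor M) e) κ c
      (fun y => d.2 (e.symm y)) := by
    refine ⟨fun x hx => ?_, fun x hx => ?_, fun x hx => ?_⟩
    · simpa only [inCoord_metricLine, hl] using h1 e he x hx
    · simpa only [inCoord_metricLine, hl] using h2 e he x hx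
    · simpa only [inCoord_metricLine, hl] using h3 e he x hx
  refine hD.rigidity (isMetricOn_inCoord he g) hS
    (smooth_inCoord he (d.1 : TwoTensor M).contMDiff)
    (fun y _ => inCoord_transpose d.1.2 e y) (sm_comp_symm he d.2.contMDiff)
    (fun y hy j => ?_) hx
  have h := ho e he y hy j
  rw [hφ, pd_const, mul_zero, add_zero] at h
  exact (mul_eq_zero.1 h).resolve_left two_ne_zero

/-- The integration argument: an essential deformation has vanishing metric variation. -/
theorem metricVariation_eq_zero (hsol : IsTorsionlessSoliton κ g φ) {c : ℝ} (hc : ∀ p, φ p = c)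
    (hd : d ∈ essentialDeformations κ g φ) (p : M) : (d.1 : TwoTensor M) p = 0 := by
  classical
  obtain ⟨t, ht⟩ := isCompact_univ.elim_finite_subcover (fun q : M => (chartAt E3 q).source)
    (fun q => (chartAt E3 q).open_source) fun q _ => Set.mem_iUnion.2 ⟨q, mem_chart_source E3 q⟩
  obtain ⟨ρ, hρ⟩ := SmoothPartitionOfUnity.exists_isSubordinate (𝓡 3) isClosed_univ
    (fun i : t => (chartAt E3 (i : M)).source) (fun i => (chartAt E3 (i : M)).open_source)
    fun q hq => by
      obtain ⟨i, hi, hqi⟩ := Set.mem_iUnion₂.1 (ht hq)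
      exact Set.mem_iUnion.2 ⟨⟨i, hi⟩, hqi⟩
  set e : t → OpenPartialHomeomorph M E3 := fun i => chartAt E3 (i : M) with he_def
  have he : ∀ i, e i ∈ IsManifold.maximalAtlas (𝓡 3) ∞ M := fun i =>
    IsManifold.chart_mem_maximalAtlas _
  have hsum : ∀ q, ∑ i, ρ i q = 1 := fun q => by
    rw [← finsum_eq_sum_of_fintype]; exact ρ.sum_eq_one (Set.mem_univ q)
  set G : t → E3 → Mat := fun i => inCoord g.inner (e i) with hG_def
  set H : t → E3 → Mat := fun i => inCoord (d.1 : TwoTensor M) (e i) with hH_def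
  have hG : ∀ i, IsMetricOn (e i).target (G i) := fun i => isMetricOn_inCoord (he i) g
  have hH : ∀ i, SmM (e i).target (H i) := fun i =>
    smooth_inCoord (he i) (d.1 : TwoTensor M).contMDiff
  have hw : ∀ i a, Sm (e i).target (bochnerForm (G i) (H i) a) := fun i a =>
    (hG i).smooth_bochnerForm (hH i) a
  have hloc : ∀ i, ∀ x ∈ (e i).target, 0 ≤ divForm (G i) (bochnerForm (G i) (H i)) x ∧
      (divForm (G i) (bochnerForm (G i) (H i)) x = 0 → H i x = 0) := fun i x hx =>
    (rigidity_inCoord hsol hc hd (he i) hx).2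
  have hint := sum_integral_div_eq_zero he (ρ := fun i => ρ i) (fun i => (ρ i).contMDiff) hρ hsum
    (V := fun i => fluxDensity (G i) (bochnerForm (G i) (H i)))
    (fun i m => (hG i).smooth_fluxDensity (hw i) m)
    (fun i j f hf x hx => (isIsometricTransition (he i) (he j) g).sum_fluxDensity_mul_pd (hH j)
      (fun y hy => inCoord_eq (he i) (he j) _ hy) hf hx)
  set f : t → E3 → ℝ := fun i x => ρ i ((e i).symm x) *
    (volDensity (G i) x * divForm (G i) (bochnerForm (G i) (H i)) x) with hf_def
  have hfs : ∀ i, Sm (e i).target (f i) := fun i => (sm_comp_symm (he i) (ρ i).contMDiff).mul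
    ((hG i).smooth_volDensity.mul ((hG i).smooth_divForm (hw i)))
  have hf0 : ∀ i, ∀ x ∈ (e i).target, 0 ≤ f i x := fun i x hx =>
    mul_nonneg (ρ.nonneg i _) (mul_nonneg ((hG i).volDensity_pos hx).le (hloc i x hx).1)
  have hfi : ∀ i, ∫ x in (e i).target, f i x = 0 := by
    have h : ∑ i, ∫ x in (e i).target, f i x = 0 := by
      rw [← hint]
      refine Finset.sum_congr rfl fun i _ => setIntegral_congr_fun
        (e i).open_target.measurableSet fun x hx => ?_
      simp only [hf_def]
      rw [(hG i).sum_pd_fluxDensity (hw i) hx]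
    intro i
    exact (Finset.sum_eq_zero_iff_of_nonneg fun i _ => setIntegral_nonneg
      (e i).open_target.measurableSet (hf0 i)).1 h i (Finset.mem_univ i)
  have hfz : ∀ i, ∀ x ∈ (e i).target, f i x = 0 := by
    intro i
    have ho := (e i).open_target
    have hi : IntegrableOn (f i) (e i).target := (hfs i).integrableOn ho
      (isCompact_image_tsupport (hρ i)) (image_tsupport_subset (hρ i)) fun x hx h => by
        have : ρ i ((e i).symm x) = 0 :=
          image_eq_zero_of_notMem_tsupport (f := ρ i) (notMem_tsupport hx h)
        simp only [hf_def, this, zero_mul]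
    have hae := (setIntegral_eq_zero_iff_of_nonneg_ae
      (ae_restrict_of_forall_mem ho.measurableSet (hf0 i)) hi).1 (hfi i)
    exact Measure.eqOn_open_of_ae_eq hae ho (hfs i).continuousOn continuousOn_const
  obtain ⟨i, hi⟩ : ∃ i, ρ i p ≠ 0 := by
    by_contra! h
    have := hsum p
    simp [h] at this
  have hp : p ∈ (e i).source := hρ i (subset_tsupport _ hi)
  have hx := (e i).map_source hp
  have h := hfz i _ hx
  simp only [hf_def, (e i).left_inv hp] at h
  have h1 := ((mul_eq_zero.1 h).resolve_left hi)
  have h2 := (mul_eq_zero.1 h1).resolve_left ((hG i).volDensity_pos hx).ne'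
  have h3 := eq_zero_of_inCoord_eq_zero (mdifferentiable_of_mem_maximalAtlas (he i)) hx
    ((hloc i _ hx).2 h2)
  rwa [(e i).left_inv hp] at h3

omit [T2Space M] [CompactSpace M] in
theorem zero_mem_essentialDeformations (κ : ℝ) (g : Metric M) (φ : C^∞⟮𝓡 3, M; 𝓘(ℝ), ℝ⟯) :
    (0 : TangentConf M) ∈ essentialDeformations κ g φ := by
  have h1 : ∀ t, metricLine g (0 : TangentConf M).1 t = g.inner := fun t => by
    funext p
    ext v w
    change g.inner p v w + t * 0 = g.inner p v w
    ring
  have h2 : ∀ t, dilatonLine φ (0 : TangentConf M).2 t = φ := fun t => by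
    funext p; simp [dilatonLine]
  refine ⟨⟨fun e he x hx a b => ?_, fun e he x hx j k l => ?_, fun e he x hx => ?_⟩,
    fun e he x hx j => ?_⟩
  · simp only [h1, h2]; exact hasDerivAt_const _ _
  · simp only [h1, h2]; exact hasDerivAt_const _ _
  · simp only [h1, h2]; exact hasDerivAt_const _ _
  · have h : inCoord ((0 : TangentConf M).1 : TwoTensor M) e = fun _ => 0 := by
      funext x; ext i j; simp [inCoord]
    rw [h]
    simp [divBilin, covBilin]

end HeteroticSoliton

end

theorem mainTheorem2 {M : Type*} [TopologicalSpace M] [T2Space M] [CompactSpace M]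
    [ChartedSpace HeteroticSoliton.E3 M] [IsManifold (𝓡 3) ∞ M]
    (κ : ℝ) (g : HeteroticSoliton.Metric M) (φ : C^∞⟮𝓡 3, M; 𝓘(ℝ), ℝ⟯)
    (hsol : HeteroticSoliton.IsTorsionlessSoliton κ g φ)
    (hflat : ¬ HeteroticSoliton.IsFlat g)
    (hconst : ∃ c : ℝ, ∀ p : M, φ p = c) :
    HeteroticSoliton.essentialDeformations κ g φ = {0} := by
  obtain ⟨c, hc⟩ := hconst
  refine Set.eq_singleton_iff_unique_mem.2
    ⟨HeteroticSoliton.zero_mem_essentialDeformations κ g φ, fun d hd => Prod.ext ?_ ?_⟩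
  · refine Subtype.ext (ContMDiffSection.ext fun p => ?_)
    exact HeteroticSoliton.metricVariation_eq_zero hsol hc hd p
  · refine ContMDiffMap.ext fun p => ?_
    have h := (HeteroticSoliton.rigidity_inCoord hsol hc hd
      (IsManifold.chart_mem_maximalAtlas p) (mem_chart_target _ p)).1
    rwa [(chartAt _ p).left_inv (mem_chart_source _ p)] at h
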